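/- Let $(\mathbb X,\mathcal X)$ be a standard Borel space and let $(X_n)_{n\ge1}$ be an exchangeable sequence of $\mathbb X$-valued random variables on a probability space $(\Omega,\mathcal H,\mathbb P)$. Let $\theta>0$, let $\nu$ be a probability measure on $\mathbb X$, and let $R$ be a finite (non-negative) transition kernel on $\mathbb X$. Assume that $(X_n)$ is a measure-valued Pólya sequence with parameters $(\theta,\nu,R)$, i.e. $X_1\sim\nu$ and, for all $n\ge1$, $$\mathbb P(X_{n+1}\in\cdot\mid X_1,\dots,X_n)=\frac{\theta\nu(\cdot)+\sum_{i=1}^nR_{X_i}(\cdot)}{\theta+\sum_{i=1}^nR_{X_i}(\mathbb X)}\quad\text{a.s.}$$ Let $Z=\{x:R_x(\mathbb X)=0\}$. Assume that the sequence is in canonical form, i.e. $R_x(\mathbb X)=1$ for all $x\in Z^c$, and that $0<\nu(Z)<1$. Let $\tilde P$ be its directing random measure: a random probability measure on $\mathbb X$ such that, given $\tilde P$, the $X_n$ are i.i.d. with distribution $\tilde P$. For a probability measure $\mu$ say that $(V_j)_{j\ge1},(U_j)_{j\ge1}$ are stick-breaking variables with parameters $(\theta,\mu)$ if $V_j=W_j\prod_{i<j}(1-W_i)$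 with $W_1,W_2,\dots$ i.i.d. $\mathrm{Beta}(1,\theta)$, and $U_1,U_2,\dots$ are i.i.d. with law $\mu$ and independent of $(V_j)$. The Dirichlet process $\mathrm{DP}(\theta,\mu)$ is the law of the random probability measure $\sum_{j\ge1}V_j\delta_{U_j}$. (i) As $n\to\infty$, $$\sup_{A\in\mathcal X}\bigl|\mathbb P(X_{n+1}\in A\mid X_1,\dots,X_n)-\tilde P(A)\bigr|\to0\quad\text{a.s.}$$ Moreover, almost surely, as measures, $$\tilde P(\cdot)=\nu(Z^c)\,\tilde P(\cdot\mid Z^c)+\nu(Z)\,\nu(\cdot\mid Z),$$ and $\tilde P(\cdot\mid Z^c)$ is equal in law to $\sum_{j\ge1}V_jR_{U_j}(\cdot\mid Z^c)$, where $(V_j),(U_j)$ are stick-breaking variables with parameters $(\theta,\nu(\cdot\mid Z^c))$. (ii) There exist a measurable space $(\Pi,\mathcal P)$ and a measurable map $\pi:\mathbb X\to\Pi$ such that, with $\nu_\pi=\nu\circ\pi^{-1}$: $\{p\}\in\mathcal P$ for $\nu_\pi$-almost every $p$; $\sigma(\pi)$ is countably generated under $\nu$, i.e. there is $C\in\sigma(\pi)$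 with $\nu(C)=1$ such that the trace $\sigma(\pi)\cap C$ is countably generated; $\pi(Z^c)\in\mathcal P$ and $\pi^{-1}(\pi(Z^c))=Z^c$; and, on a suitable extension of the probability space, there are a random probability measure $\tilde Q$ on $\Pi$, $\Pi$-valued random variables $\tilde p_n$ and $\{0,1\}$-valued random variables $\xi_n$ $(n\ge1)$ such that - $\tilde Q\sim\mathrm{DP}\bigl(\theta,\nu_\pi(\cdot\mid\pi(Z^c))\bigr)$; - given $\tilde Q$, the pairs $(\tilde p_n,\xi_n)$, $n\ge1$, are i.i.d. with law $\tilde Q\times\mathrm{Ber}(\nu(Z^c))$; - given $\tilde Q$ and $(\tilde p_k,\xi_k)_{k\ge1}$, the variables $X_n$, $n\ge1$, are independent, and $X_n$ has conditional law $\nu(\cdot\mid\pi=\tilde p_n)$ if $\xi_n=1$ and $\nu(\cdot\mid Z)$ if $\xi_n=0$. -/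

import Mathlib

open MeasureTheory ProbabilityTheory Filter Topology
open scoped ENNReal

universe u v

noncomputable section

namespace MVPS

variable {Ω : Type*} [MeasurableSpace Ω] {𝕏 : Type*} [MeasurableSpace 𝕏]

/-- Infinite exchangeability: every finite initial segment of the sequence has a law that is
invariant under permutations of the indices. The sequence is indexed from `0`. -/
def Exchangeable (P : Measure Ω) (X : ℕ → Ω → 𝕏) : Prop :=
  ∀ (n : ℕ) (σ : Equiv.Perm (Fin n)),
    P.map (fun ω (i : Fin n) => X (σ i) ω) = P.map (fun ω (i : Fin n) => X i ω)

/-- Conditionally on the sub-σ-algebra `𝓕`, the variables `Y 0, Y 1, …` are independent and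
`Y n` has the (random, `𝓕`-measurable) distribution `K n`. -/
def CondIndepWithLaws {S : Type*} [MeasurableSpace S] (P : Measure Ω) (𝓕 : MeasurableSpace Ω)
    (Y : ℕ → Ω → S) (K : ℕ → Ω → Measure S) : Prop :=
  ∀ (n : ℕ) (A : ℕ → Set S), (∀ i, MeasurableSet (A i)) →
    P⟦⋂ i ∈ Finset.range n, Y i ⁻¹' A i | 𝓕⟧
      =ᵐ[P] fun ω => ∏ i ∈ Finset.range n, (K i ω).real (A i)

/-- The random probability measure `Pt` is a directing random measure of `X`: given `Pt`, the
variables `X 0, X 1, …` are i.i.d. with distribution `Pt`. -/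
def IsDirecting (P : Measure Ω) (X : ℕ → Ω → 𝕏) (Pt : Kernel Ω 𝕏) : Prop :=
  CondIndepWithLaws P (MeasurableSpace.comap (fun ω => Pt ω) inferInstance) X (fun _ ω => Pt ω)

/-- The predictive distribution of `X n` given `X 0, …, X (n - 1)`: the regular conditional
distribution, evaluated at the observed history. -/
def predDist [StandardBorelSpace 𝕏] [Nonempty 𝕏] (P : Measure Ω) [IsFiniteMeasure P]
    (X : ℕ → Ω → 𝕏) (n : ℕ) (ω : Ω) : Measure 𝕏 :=
  condDistrib (X n) (fun ω' (i : Fin n) => X i ω') P (fun i : Fin n => X i ω)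

/-- Measure-valued Pólya sequence with parameters `θ`, `ν` and `R`. -/
structure IsMVPS [StandardBorelSpace 𝕏] [Nonempty 𝕏] (P : Measure Ω) [IsFiniteMeasure P]
    (X : ℕ → Ω → 𝕏) (θ : ℝ) (ν : Measure 𝕏) (R : Kernel 𝕏 𝕏) : Prop where
  measurable : ∀ n, Measurable (X n)
  theta_pos : 0 < θ
  isProbabilityMeasure : IsProbabilityMeasure ν
  finite_kernel : ∀ x, R x Set.univ < ∞
  law_zero : P.map (X 0) = ν
  predictive : ∀ n, 1 ≤ n → ∀ᵐ ω ∂P,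
    predDist P X n ω =
      (ENNReal.ofReal θ + ∑ i ∈ Finset.range n, R (X i ω) Set.univ)⁻¹ •
        (ENNReal.ofReal θ • ν + ∑ i ∈ Finset.range n, R (X i ω))

/-- The null set `Z` of the reinforcement kernel. -/
def nullPart (R : Kernel 𝕏 𝕏) : Set 𝕏 := {x | R x Set.univ = 0}

/-- Canonical normalisation of the reinforcement: total mass one off the null set. -/
def IsCanonical (R : Kernel 𝕏 𝕏) : Prop := ∀ x ∈ (nullPart R)ᶜ, R x Set.univ = 1

/-- Total variation distance `sup_A |μ A - μ' A|` over measurable sets. -/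
def tvDist (μ μ' : Measure 𝕏) : ℝ :=
  ⨆ A : {A : Set 𝕏 // MeasurableSet A}, |μ.real A - μ'.real A|

/-- Stick-breaking weights `V j = W j * ∏ i < j, (1 - W i)`. -/
def stickWeight (w : ℕ → ℝ) (j : ℕ) : ℝ := w j * ∏ i ∈ Finset.range j, (1 - w i)

/-- The measure `∑ j, V j • K (U j)`, where `V` are the stick-breaking weights of `w`. -/
def stickSum {S T : Type*} [MeasurableSpace T] (K : S → Measure T)
    (w : ℕ → ℝ) (U : ℕ → S) : Measure T :=
  Measure.sum fun j => ENNReal.ofReal (stickWeight w j) • K (U j)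

/-- The law, on the space of measures, of `∑ j, V j • K (U j)`, where `W j` are i.i.d.
`Beta(1, θ)`, `V` are their stick-breaking weights, and `U j` are i.i.d. with law `μ`,
independent of the `W j`. -/
def stickBreakingLaw {S T : Type*} [MeasurableSpace S] [MeasurableSpace T]
    (θ : ℝ) (μ : Measure S) (K : S → Measure T) : Measure (Measure T) :=
  ((Measure.infinitePi fun _ : ℕ => betaMeasure 1 θ).prod (Measure.infinitePi fun _ : ℕ => μ)).map
    fun p => stickSum K p.1 p.2

/-- The Dirichlet process `DP(θ, μ)`: the law of `∑ j, V j • δ_{U j}`. -/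
def dirichletProcess {S : Type*} [MeasurableSpace S] (θ : ℝ) (μ : Measure S) :
    Measure (Measure S) :=
  stickBreakingLaw θ μ Measure.dirac

/-- The sub-σ-algebra `𝓖` is countably generated under `ν`: its trace on some `C ∈ 𝓖` with
`ν C = 1` is countably generated. -/
def CountablyGeneratedUnder (ν : Measure 𝕏) (𝓖 : MeasurableSpace 𝕏) : Prop :=
  ∃ C : Set 𝕏, MeasurableSet[𝓖] C ∧ ν C = 1 ∧
    @MeasurableSpace.CountablyGenerated C (𝓖.comap Subtype.val)

/-- A parameter on the probability space `(𝕏, ν)`: a measurable map for which almost every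
singleton is measurable and whose generated σ-algebra is countably generated under `ν`. -/
structure IsParameter {T : Type*} [MeasurableSpace T] (ν : Measure 𝕏) (π : 𝕏 → T) : Prop where
  measurable : Measurable π
  singleton : ∀ᵐ p ∂(ν.map π), MeasurableSet ({p} : Set T)
  countablyGenerated : CountablyGeneratedUnder ν (MeasurableSpace.comap π inferInstance)

/-- The Bernoulli distribution on `{true, false}` with success probability `ν A`. -/
def bernoulliOf (ν : Measure 𝕏) [IsProbabilityMeasure ν] (A : Set 𝕏) : Measure Bool :=
  bernoulliMeasure true false ⟨ν.real A, measureReal_nonneg, measureReal_le_one⟩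

/-- The hierarchical model with null set `Z` and parameter `π`:
* `Q` is a random probability measure with law `DP(θ, ν_π(· | π(Zᶜ)))`;
* given `Q`, the pairs `(p n, ξ n)` are i.i.d. with law `Q × Ber(ν(Zᶜ))`;
* given all `(p k, ξ k)` and `Q`, the `X n` are independent, with law `ν(· | π = p n)` if `ξ n`
  is a success and `ν(· | Z)` otherwise. -/
structure IsHierarchical [StandardBorelSpace 𝕏] [Nonempty 𝕏] {T : Type*} [MeasurableSpace T]
    (P : Measure Ω) (X : ℕ → Ω → 𝕏) (p : ℕ → Ω → T) (ξ : ℕ → Ω → Bool) (Q : Kernel Ω T)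
    (θ : ℝ) (ν : Measure 𝕏) [IsProbabilityMeasure ν] (Z : Set 𝕏) (π : 𝕏 → T) : Prop where
  measurable_obs : ∀ n, Measurable (X n)
  measurable_param : ∀ n, Measurable (p n)
  measurable_coin : ∀ n, Measurable (ξ n)
  isMarkov : IsMarkovKernel Q
  law_Q : P.map (fun ω => Q ω) = dirichletProcess θ (cond (ν.map π) (π '' Zᶜ))
  latent : CondIndepWithLaws P (MeasurableSpace.comap (fun ω => Q ω) inferInstance)
    (fun n ω => (p n ω, ξ n ω)) (fun _ ω => (Q ω).prod (bernoulliOf ν Zᶜ))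
  obs : CondIndepWithLaws P
    (MeasurableSpace.comap (fun ω => (Q ω, fun n => (p n ω, ξ n ω))) inferInstance)
    X (fun n ω => if ξ n ω = true then condDistrib id π ν (p n ω) else cond ν Z)

end MVPS

end

/-!
Write `Z` for the null set of `R`, `k = offNull R` for the kernel `x ↦ R x (· | Zᶜ)`, and `P̃` for
the directing measure. The expectation of a product of functions of finitely many terms of the
sequence can be computed in two ways: by conditioning on `P̃` (`IsDirecting.lintegral_prod`) or by the
predictive rule (`IsMVPS.lintegral_predictive`). The conditionally i.i.d. form contains the
exchangeability of the sequence, and all information on `R` and `P̃` comes from comparing the two.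

*The kernel.* Symmetry in the first two terms gives, for `ν`-almost every `x ∉ Z`, the identity
`R x = ν|Z + ν(Zᶜ) • k x` (`IsMVPS.ae_eq_add_offNull`) and that `k` maps `ν` to its restriction to
`Zᶜ` (`IsMVPS.bind_offNull`); symmetry in the first three terms gives that `k` is idempotent
(`IsMVPS.ae_offNull_idem`). For such a kernel the function `φ = k(A)` satisfies
`∫ ν(dx) ∫ k x (dy) (φ y - φ x)² = 0`, so `k y = k x`, and hence `R y = R x`, for `k x`-almost
every `y`: the kernel `k` is almost surely carried by the class `{y | R y = R x}` of `x` and constant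
on it (`IsMVPS.ae_isRegularPoint`). In other words `k` is the conditional law under `ν(· | Zᶜ)`
given the class, which is how the classes become the parameters of the hierarchical model. A second
moment argument (`IsMVPS.ae_integral_eq_zero`) carries the structure of `ν` over to `P̃`: almost
surely `P̃ = ν` on `Z`, and `P̃ k = P̃` on `Zᶜ` (`IsMVPS.ae_isTypical`).

*Convergence in total variation.* On `Z` the predictive distribution is a multiple of `ν`, so of `P̃`,
with a factor tending to one. On the class of an observed term, the restriction of `P̃` is a multiple
of `k` at that term; up to a contribution of `θ • ν` that vanishes in the limit, the predictive
distribution is a multiple of `k` as well, and the factors converge by the law of large numbers. The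
classes never observed carry no mass of `P̃` (`IsMVPS.ae_uncovered`), since the probability that a new
class appears tends to zero. So `P̃` is carried by countably many sets on each of which the
convergence is uniform, which suffices (`tendsto_tvDist_of_cover`, `IsMVPS.ae_tendsto_tvDist`).

*The law of `P̃(· | Zᶜ)`.* Fix `f` with values in `[0, 1]`. The predictive rule yields a recursion,
`MomentRecursion`, for the moments of `∫ f dP̃(· | Zᶜ)`, whose data are `θ` and the moments of `k f`
under `ν(· | Zᶜ)` (`IsMVPS.momentRecursion`). The stick-breaking sum `D = ∑ V j • k (U j)` is
self-similar, being equal in law to `W • k (U 0) + (1 - W) • D'` with `D'` an independent copy, and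
expanding powers shows that the moments of `∫ f dD` satisfy the same recursion
(`momentRecursion_stickBreakingLaw`). The recursion has only one solution, and the moments for all
`f` determine the law of a random probability measure (`eq_of_moments`), hence
`IsMVPS.map_cond_directing`.

*The hierarchical model.* The parameter is `π x = R x`, with values in the range of `R`
(`ClassSpace`, `toClass`); `ξ n` records whether `X n ∉ Z`. A term in `Z` has lost its parameter, so
the probability space is extended by parameters that are conditionally i.i.d. given `P̃` and fill in
for these terms (`hierMeasure`). Given `P̃`, the triples of parameter, coin and observation are then
i.i.d.; the law of the observation given the first two is `k` or `ν(· | Z)`, and `k` is the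
conditional law of `ν` given the parameter (`condDistrib_toClass`). Under `π` the measure `k x`
collapses to the point mass at `π x`, so the stick-breaking law of `P̃(· | Zᶜ)` collapses to the
Dirichlet process (`map_stickBreakingLaw_offNull`, `isHierarchical_toClass`).
-/

noncomputable section

namespace MVPS

set_option linter.unusedSectionVars false

/-! ### Conditionally i.i.d. sequences -/

section MixedIID

variable {Ω E S : Type*} [MeasurableSpace Ω] [MeasurableSpace E] [MeasurableSpace S]

/-- The kernel `e ↦ (K e)^ℕ`. -/
def iidKernel (K : Kernel E S) [IsMarkovKernel K] : Kernel E (ℕ → S) where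
  toFun e := Measure.infinitePi fun _ => K e
  measurable' := by
    refine Measurable.measure_of_isPiSystem_of_isProbabilityMeasure
      (generateFrom_squareCylinders (α := fun _ : ℕ => S)).symm
      (isPiSystem_squareCylinders (fun _ => MeasurableSpace.isPiSystem_measurableSet)
        fun _ => MeasurableSet.univ) ?_
    rintro _ ⟨s, t, ht, rfl⟩
    have ht' : ∀ i, MeasurableSet (t i) := fun i => ht i (Set.mem_univ i)
    simp_rw [Measure.infinitePi_pi (fun _ => K _) (fun i _ => ht' i)]
    exact Finset.measurable_fun_prod _ fun i _ => K.measurable_coe (ht' i)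

lemma iidKernel_apply (K : Kernel E S) [IsMarkovKernel K] (e : E) :
    iidKernel K e = Measure.infinitePi fun _ => K e := rfl

instance (K : Kernel E S) [IsMarkovKernel K] : IsMarkovKernel (iidKernel K) :=
  ⟨fun e => by rw [iidKernel_apply]; infer_instance⟩

lemma lintegral_infinitePi_prod (μ : Measure S) [IsProbabilityMeasure μ] (n : ℕ)
    {h : ℕ → S → ℝ≥0∞} (hh : ∀ i, Measurable (h i)) :
    ∫⁻ y, ∏ i ∈ Finset.range n, h i (y i) ∂(Measure.infinitePi fun _ : ℕ => μ) =
      ∏ i ∈ Finset.range n, ∫⁻ y, h i y ∂μ := by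
  rw [lintegral_prod_eq_prod_lintegral_of_indepFun (Finset.range n)
    (fun i (y : ℕ → S) => h i (y i)) (iIndepFun_infinitePi hh)
    fun i => (hh i).comp (measurable_pi_apply i)]
  refine Finset.prod_congr rfl fun i _ => ?_
  rw [← lintegral_map (hh i) (measurable_pi_apply i), Measure.infinitePi_map_eval]

/-- The sequence `Y` is, given the random element `M`, i.i.d. with distribution `K M`; expressed
through the joint law of `M` and `Y`. -/
structure IsMixedIID (P : Measure Ω) (M : Ω → E) (K : Kernel E S) [IsMarkovKernel K]
    (Y : ℕ → Ω → S) : Prop where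
  measurable_param : Measurable M
  measurable : ∀ n, Measurable (Y n)
  map_eq : P.map (fun ω => (M ω, fun n => Y n ω)) = (P.map M) ⊗ₘ iidKernel K

variable {P : Measure Ω} {M : Ω → E} {K : Kernel E S} [IsMarkovKernel K] {Y : ℕ → Ω → S}

omit [MeasurableSpace S] in
/-- Two finite measures on a product agree as soon as they agree on the products of a measurable
set with the members of a π-system that generates the second σ-algebra. -/
lemma ext_prod_of_isPiSystem [mS : MeasurableSpace S] {ρ ρ' : Measure (E × S)} [IsFiniteMeasure ρ]
    {C : Set (Set S)} (hgen : mS = MeasurableSpace.generateFrom C) (hpi : IsPiSystem C)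
    (huniv : Set.univ ∈ C)
    (h : ∀ D, MeasurableSet D → ∀ t ∈ C, ρ (D ×ˢ t) = ρ' (D ×ˢ t)) : ρ = ρ' := by
  have hfin : IsFiniteMeasure ρ' := ⟨by
    have := h Set.univ MeasurableSet.univ _ huniv
    rw [Set.univ_prod_univ] at this
    rw [← this]; exact measure_lt_top _ _⟩
  have hsnd : ∀ (m : Measure (E × S)) (D : Set E) (B : Set S), MeasurableSet B →
      (m.restrict (D ×ˢ Set.univ)).map Prod.snd B = m (D ×ˢ B) := by
    intro m D B hB
    rw [Measure.map_apply measurable_snd hB, Measure.restrict_apply (measurable_snd hB)]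
    congr 1
    ext
    simp [and_comm]
  refine Measure.ext_prod fun {D B} hD hB => ?_
  have key : (ρ.restrict (D ×ˢ Set.univ)).map Prod.snd
      = (ρ'.restrict (D ×ˢ Set.univ)).map Prod.snd := by
    refine ext_of_generate_finite _ hgen hpi (fun t ht => ?_) ?_
    · have htm : MeasurableSet t := hgen ▸ MeasurableSpace.measurableSet_generateFrom ht
      rw [hsnd _ _ _ htm, hsnd _ _ _ htm, h D hD t ht]
    · rw [hsnd _ _ _ MeasurableSet.univ, hsnd _ _ _ MeasurableSet.univ, h D hD _ huniv]
  rw [← hsnd ρ D B hB, key, hsnd _ _ _ hB]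

/-- Two finite measures on `E × S^ℕ` agree as soon as they agree on the sets
`D × A 0 × ⋯ × A (n - 1) × S × S × ⋯`. -/
lemma ext_prod_pi {ρ ρ' : Measure (E × (ℕ → S))} [IsFiniteMeasure ρ]
    (h : ∀ (D : Set E) (n : ℕ) (A : ℕ → Set S), MeasurableSet D → (∀ i, MeasurableSet (A i)) →
      ρ (D ×ˢ {y | ∀ i ∈ Finset.range n, y i ∈ A i}) =
        ρ' (D ×ˢ {y | ∀ i ∈ Finset.range n, y i ∈ A i})) :
    ρ = ρ' := by
  classical
  refine ext_prod_of_isPiSystem (generateFrom_squareCylinders (α := fun _ : ℕ => S)).symm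
    (isPiSystem_squareCylinders (fun _ => MeasurableSpace.isPiSystem_measurableSet)
      fun _ => MeasurableSet.univ) ⟨∅, fun _ => Set.univ, by simp, by simp⟩ ?_
  rintro D hD _ ⟨s, t, ht, rfl⟩
  have ht' : ∀ i, MeasurableSet (t i) := fun i => ht i (Set.mem_univ i)
  obtain ⟨n, hn⟩ := s.exists_nat_subset_range
  have hset : ((s : Set ℕ).pi t) =
      {y | ∀ i ∈ Finset.range n, y i ∈ (if i ∈ s then t i else Set.univ)} := by
    ext y
    simp only [Set.mem_pi, Finset.mem_coe, Set.mem_ofPred_eq]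
    refine ⟨fun hy i _ => ?_, fun hy i hi => ?_⟩
    · split_ifs with his
      · exact hy i his
      · trivial
    · simpa [hi] using hy i (hn hi)
  rw [hset]
  refine h D n _ hD fun i => ?_
  split_ifs
  · exact ht' i
  · exact MeasurableSet.univ

lemma IsMixedIID.measurable_joint (h : IsMixedIID P M K Y) :
    Measurable (fun ω => (M ω, fun n => Y n ω)) :=
  h.measurable_param.prodMk (measurable_pi_lambda _ h.measurable)

lemma IsMixedIID.lintegral [IsFiniteMeasure P] (h : IsMixedIID P M K Y)
    {F : E × (ℕ → S) → ℝ≥0∞} (hF : Measurable F) :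
    ∫⁻ ω, F (M ω, fun n => Y n ω) ∂P =
      ∫⁻ ω, ∫⁻ y, F (M ω, y) ∂(Measure.infinitePi fun _ => K (M ω)) ∂P := by
  rw [← lintegral_map hF h.measurable_joint, h.map_eq, Measure.lintegral_compProd hF,
    lintegral_map _ h.measurable_param]
  · rfl
  · exact hF.lintegral_kernel_prod_right'

lemma IsMixedIID.ae [IsFiniteMeasure P] (h : IsMixedIID P M K Y) {p : E × (ℕ → S) → Prop}
    (hp : MeasurableSet {x | p x})
    (hae : ∀ᵐ ω ∂P, ∀ᵐ y ∂(Measure.infinitePi fun _ => K (M ω)), p (M ω, y)) :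
    ∀ᵐ ω ∂P, p (M ω, fun n => Y n ω) := by
  have h1 : ∀ᵐ x ∂(P.map (fun ω => (M ω, fun n => Y n ω))), p x := by
    rw [h.map_eq, Measure.ae_compProd_iff hp]
    refine (ae_map_iff h.measurable_param.aemeasurable ?_).2 hae
    exact measurableSet_eq_fun
      (Kernel.measurable_kernel_prodMk_left hp.compl : Measurable fun e =>
        iidKernel K e (Prod.mk e ⁻¹' {x | p x}ᶜ)) measurable_const
  exact ae_of_ae_map h.measurable_joint.aemeasurable h1

/-- Mixed moments of a conditionally i.i.d. sequence. -/
lemma IsMixedIID.lintegral_mul_prod [IsFiniteMeasure P] (h : IsMixedIID P M K Y)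
    {Φ : E → ℝ≥0∞} (hΦ : Measurable Φ) (n : ℕ) {f : ℕ → S → ℝ≥0∞} (hf : ∀ i, Measurable (f i)) :
    ∫⁻ ω, Φ (M ω) * ∏ i ∈ Finset.range n, f i (Y i ω) ∂P =
      ∫⁻ ω, Φ (M ω) * ∏ i ∈ Finset.range n, ∫⁻ y, f i y ∂(K (M ω)) ∂P := by
  have hm : Measurable fun y : ℕ → S => ∏ i ∈ Finset.range n, f i (y i) :=
    Finset.measurable_fun_prod _ fun i _ => (hf i).comp (measurable_pi_apply i)
  refine (h.lintegral (F := fun x => Φ x.1 * ∏ i ∈ Finset.range n, f i (x.2 i))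
    ((hΦ.comp measurable_fst).mul (hm.comp measurable_snd))).trans ?_
  refine lintegral_congr fun ω => ?_
  simp only
  rw [lintegral_const_mul _ hm, lintegral_infinitePi_prod _ n hf]

lemma IsMixedIID.of_measure_eq [IsFiniteMeasure P] (hM : Measurable M)
    (hY : ∀ n, Measurable (Y n))
    (h : ∀ (D : Set E) (n : ℕ) (A : ℕ → Set S), MeasurableSet D → (∀ i, MeasurableSet (A i)) →
      P (M ⁻¹' D ∩ ⋂ i ∈ Finset.range n, Y i ⁻¹' A i) =
        ∫⁻ ω in M ⁻¹' D, ∏ i ∈ Finset.range n, K (M ω) (A i) ∂P) :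
    IsMixedIID P M K Y := by
  refine ⟨hM, hY, ext_prod_pi fun D n A hD hA => ?_⟩
  have hmA : MeasurableSet {y : ℕ → S | ∀ i ∈ Finset.range n, y i ∈ A i} :=
    MeasurableSet.pi (Finset.range n).countable_toSet fun i _ => hA i
  have hj : Measurable (fun ω => (M ω, fun n => Y n ω)) :=
    hM.prodMk (measurable_pi_lambda _ hY)
  rw [Measure.map_apply hj (hD.prod hmA), Measure.compProd_apply_prod hD hmA,
    setLIntegral_map hD ((iidKernel K).measurable_coe hmA) hM]
  convert h D n A hD hA using 2
  · ext ω; simp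
  · ext ω
    rw [iidKernel_apply]
    exact Measure.infinitePi_pi (fun _ => K (M ω)) (s := Finset.range n) (fun i _ => hA i)

lemma indicator_one_mul_indicator {α : Type*} (s t : Set α) (g : α → ℝ≥0∞) (a : α) :
    s.indicator (1 : α → ℝ≥0∞) a * t.indicator g a = (s ∩ t).indicator g a := by
  by_cases hs : a ∈ s <;> by_cases ht : a ∈ t <;> simp [hs, ht]

omit [MeasurableSpace Ω] [MeasurableSpace S] in
lemma prod_range_indicator_one (Y : ℕ → Ω → S) (U : ℕ → Set S) (k : ℕ) (ω : Ω) :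
    ∏ i ∈ Finset.range k, (U i).indicator (1 : S → ℝ≥0∞) (Y i ω) =
      (⋂ i ∈ Finset.range k, Y i ⁻¹' U i).indicator 1 ω := by
  classical
  simp only [Set.indicator_apply, Pi.one_apply, Finset.prod_ite_zero, Finset.prod_const_one,
    Set.mem_preimage, Set.mem_iInter]

/-- Given the random element and the first `m` terms of a conditionally i.i.d. sequence, the
remaining terms are still i.i.d. with the same distribution. -/
lemma IsMixedIID.shift [IsFiniteMeasure P] (h : IsMixedIID P M K Y) (m : ℕ) :
    IsMixedIID P (fun ω => (M ω, fun i : Fin m => Y i ω)) (K.comap Prod.fst measurable_fst)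
      (fun j => Y (m + j)) := by
  classical
  have hM := h.measurable_param
  have hpm : Measurable fun ω => (fun i : Fin m => Y i ω) :=
    measurable_pi_lambda _ fun i => h.measurable i
  have hM' := hM.prodMk hpm
  refine IsMixedIID.of_measure_eq hM' (fun n => h.measurable _) fun D n A hD hA => ?_
  set M' := fun ω => (M ω, fun i : Fin m => Y i ω) with hM'def
  set T := ⋂ i ∈ Finset.range n, Y (m + i) ⁻¹' A i with hT
  have mT : MeasurableSet T := Finset.measurableSet_biInter _ fun i _ => h.measurable _ (hA i)
  have mg : Measurable fun ω => ∏ i ∈ Finset.range n, K (M ω) (A i) :=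
    Finset.measurable_fun_prod _ fun i _ => (K.measurable_coe (hA i)).comp hM
  have key : (P.restrict T).map M' =
      (P.withDensity fun ω => ∏ i ∈ Finset.range n, K (M ω) (A i)).map M' := by
    refine ext_prod_of_isPiSystem generateFrom_pi.symm isPiSystem_pi
      ⟨fun _ => Set.univ, by simp, by simp⟩ ?_
    rintro D hD _ ⟨B, hB, rfl⟩
    have hB' : ∀ i, MeasurableSet (B i) := fun i => hB i (Set.mem_univ i)
    have hDB := hD.prod (MeasurableSet.univ_pi hB')
    set B' : ℕ → Set S := fun i => if hi : i < m then B ⟨i, hi⟩ else Set.univ with hB'def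
    have mB' : ∀ i, MeasurableSet (B' i) := fun i => by
      simp only [hB'def]; split_ifs
      · exact hB' _
      · exact MeasurableSet.univ
    have hpre : M' ⁻¹' (D ×ˢ Set.univ.pi B) =
        M ⁻¹' D ∩ ⋂ i ∈ Finset.range m, Y i ⁻¹' B' i := by
      ext ω
      simp only [hM'def, Set.mem_preimage, Set.mem_prod, Set.mem_pi, Set.mem_univ, true_imp_iff,
        Set.mem_inter_iff, Set.mem_iInter, Finset.mem_range, hB'def]
      refine and_congr_right fun _ => ⟨fun hω i hi => ?_, fun hω i => ?_⟩
      · rw [dif_pos hi]; exact hω ⟨i, hi⟩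
      · simpa [i.2] using hω i i.2
    set f : ℕ → S → ℝ≥0∞ := fun i => (if i < m then B' i else A (i - m)).indicator 1 with hf
    have mf : ∀ i, Measurable (f i) := fun i => measurable_one.indicator (by
      split_ifs
      · exact mB' i
      · exact hA _)
    have hsplit : ∀ F : ℕ → (S → ℝ≥0∞) → ℝ≥0∞, ∏ i ∈ Finset.range (m + n), F i (f i) =
        (∏ i ∈ Finset.range m, F i ((B' i).indicator 1)) *
          ∏ i ∈ Finset.range n, F (m + i) ((A i).indicator 1) := by
      intro F
      rw [Finset.prod_range_add]
      congr 1
      · exact Finset.prod_congr rfl fun i hi => by simp [hf, Finset.mem_range.1 hi]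
      · exact Finset.prod_congr rfl fun i hi => by simp [hf]
    have mΦ : Measurable fun e => D.indicator (1 : E → ℝ≥0∞) e * ∏ i ∈ Finset.range n, K e (A i) :=
      (measurable_one.indicator hD).mul
        (Finset.measurable_fun_prod _ fun i _ => K.measurable_coe (hA i))
    have h1 := h.lintegral_mul_prod (measurable_one.indicator hD : Measurable (D.indicator 1))
      (m + n) mf
    have h2 := h.lintegral_mul_prod mΦ m (f := fun i => (B' i).indicator 1)
      fun i => measurable_one.indicator (mB' i)
    have mL : MeasurableSet (M ⁻¹' D ∩ ⋂ i ∈ Finset.range m, Y i ⁻¹' B' i) :=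
      (hM hD).inter (Finset.measurableSet_biInter _ fun i _ => h.measurable i (mB' i))
    rw [Measure.map_apply hM' hDB, Measure.map_apply hM' hDB, hpre, Measure.restrict_apply mL,
      withDensity_apply _ mL, ← lintegral_indicator mL, ← lintegral_indicator_one (mL.inter mT)]
    have e1 : ∀ ω, D.indicator (1 : E → ℝ≥0∞) (M ω) * ∏ i ∈ Finset.range (m + n), f i (Y i ω) =
        (M ⁻¹' D ∩ (⋂ i ∈ Finset.range m, Y i ⁻¹' B' i) ∩ T).indicator 1 ω := by
      intro ω
      rw [hsplit fun i u => u (Y i ω), prod_range_indicator_one Y,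
        prod_range_indicator_one (fun i => Y (m + i)), indicator_one_mul_indicator, Set.inter_assoc]
      exact indicator_one_mul_indicator (M ⁻¹' D) _ _ ω
    have e2 : ∀ ω, (D.indicator (1 : E → ℝ≥0∞) (M ω) * ∏ i ∈ Finset.range n, K (M ω) (A i)) *
        ∏ i ∈ Finset.range m, (B' i).indicator (1 : S → ℝ≥0∞) (Y i ω) =
        (M ⁻¹' D ∩ ⋂ i ∈ Finset.range m, Y i ⁻¹' B' i).indicator
          (fun ω => ∏ i ∈ Finset.range n, K (M ω) (A i)) ω := by
      intro ω
      rw [prod_range_indicator_one Y, mul_right_comm, mul_comm]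
      change _ * ((M ⁻¹' D).indicator 1 ω * _) = _
      rw [indicator_one_mul_indicator, mul_comm]
      by_cases hω : ω ∈ M ⁻¹' D ∩ ⋂ i ∈ Finset.range m, Y i ⁻¹' B' i
      · simp only [Set.indicator_of_mem hω, Pi.one_apply, one_mul]
      · simp only [Set.indicator_of_notMem hω, zero_mul]
    rw [lintegral_congr e1] at h1
    rw [lintegral_congr e2] at h2
    rw [h1, h2]
    refine lintegral_congr fun ω => ?_
    rw [hsplit fun i u => ∫⁻ y, u y ∂(K (M ω))]
    simp only [lintegral_indicator_one (hA _)]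
    ring
  have := congrArg (fun μ => μ D) key
  rw [Measure.map_apply hM' hD, Measure.map_apply hM' hD, Measure.restrict_apply (hM' hD),
    withDensity_apply _ (hM' hD)] at this
  exact this

/-- Conditional independence given a sub-σ-algebra, in terms of integrals over its sets. -/
lemma condIndepWithLaws_iff {Ω : Type*} {𝓕 mΩ : MeasurableSpace Ω} {P : Measure Ω}
    [IsProbabilityMeasure P] {Y : ℕ → Ω → S} (h𝓕 : 𝓕 ≤ mΩ)
    (hY : ∀ n, Measurable (Y n)) {L : ℕ → Ω → Measure S} (hL : ∀ i, ∀ᵐ ω ∂P, L i ω Set.univ ≤ 1)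
    (hLm : ∀ i (A : Set S), MeasurableSet A → Measurable[𝓕] fun ω => L i ω A) :
    CondIndepWithLaws P 𝓕 Y L ↔
      ∀ (n : ℕ) (A : ℕ → Set S), (∀ i, MeasurableSet (A i)) → ∀ D, MeasurableSet[𝓕] D →
        P (D ∩ ⋂ i ∈ Finset.range n, Y i ⁻¹' A i) =
          ∫⁻ ω in D, ∏ i ∈ Finset.range n, L i ω (A i) ∂P := by
  unfold CondIndepWithLaws
  refine forall_congr' fun n => forall_congr' fun A => forall_congr' fun hA => ?_
  have hB : MeasurableSet (⋂ i ∈ Finset.range n, Y i ⁻¹' A i) :=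
    Finset.measurableSet_biInter _ fun i _ => hY i (hA i)
  set B := ⋂ i ∈ Finset.range n, Y i ⁻¹' A i with hBdef
  set G : Ω → ℝ := fun ω => ∏ i ∈ Finset.range n, (L i ω).real (A i) with hG
  have hle : ∀ᵐ ω ∂P, ∀ i ∈ Finset.range n, L i ω (A i) ≤ 1 := by
    have := ae_all_iff.2 hL
    filter_upwards [this] with ω hω i _ using (measure_mono (Set.subset_univ _)).trans (hω i)
  have hGm : Measurable[𝓕] G :=
    Finset.measurable_fun_prod _ fun i _ => (hLm i _ (hA i)).ennreal_toReal
  have hGm' : Measurable G := hGm.mono h𝓕 le_rfl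
  have hGofReal : ∀ᵐ ω ∂P, ENNReal.ofReal (G ω) = ∏ i ∈ Finset.range n, L i ω (A i) := by
    filter_upwards [hle] with ω hω
    rw [hG, ENNReal.ofReal_prod_of_nonneg fun i _ => measureReal_nonneg]
    exact Finset.prod_congr rfl fun i hi =>
      ENNReal.ofReal_toReal ((hω i hi).trans_lt ENNReal.one_lt_top).ne
  have hG0 : ∀ ω, 0 ≤ G ω := fun ω => Finset.prod_nonneg fun i _ => measureReal_nonneg
  have hG1 : ∀ᵐ ω ∂P, ‖G ω‖ ≤ 1 := by
    filter_upwards [hle] with ω hω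
    rw [Real.norm_of_nonneg (hG0 ω)]
    exact Finset.prod_le_one (fun i _ => measureReal_nonneg) fun i hi =>
      ENNReal.toReal_le_of_le_ofReal zero_le_one (by simpa using hω i hi)
  have hGint : Integrable G P := Integrable.of_bound hGm'.aestronglyMeasurable 1 hG1
  have hset : ∀ D, MeasurableSet D →
      ENNReal.ofReal (∫ ω in D, G ω ∂P) = ∫⁻ ω in D, ∏ i ∈ Finset.range n, L i ω (A i) ∂P := by
    intro D hD
    rw [ofReal_integral_eq_lintegral_ofReal hGint.integrableOn
      (Eventually.of_forall hG0)]
    exact lintegral_congr_ae (ae_restrict_of_ae hGofReal)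
  have hInd : Integrable (B.indicator fun _ => (1 : ℝ)) P :=
    (integrable_const 1).indicator hB
  have hsetB : ∀ D, MeasurableSet D →
      ∫ ω in D, B.indicator (fun _ => (1 : ℝ)) ω ∂P = P.real (D ∩ B) := by
    intro D hD
    rw [setIntegral_indicator hB]; simp
  constructor
  · intro h D hD
    have h1 := setIntegral_condExp h𝓕 hInd hD
    rw [setIntegral_congr_ae (h𝓕 _ hD) (h.mono fun ω hω _ => hω), hsetB D (h𝓕 _ hD)] at h1
    rw [← hset D (h𝓕 _ hD)]
    change ∫ ω in D, G ω ∂P = _ at h1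
    rw [h1, ofReal_measureReal]
  · intro h
    refine (ae_eq_condExp_of_forall_setIntegral_eq h𝓕 hInd (fun s _ _ => hGint.integrableOn)
      (fun D hD _ => ?_) hGm.aestronglyMeasurable).symm
    rw [hsetB D (h𝓕 _ hD)]
    have h1 := h D hD
    rw [← hset D (h𝓕 _ hD)] at h1
    rw [Measure.real, h1, ENNReal.toReal_ofReal]
    exact integral_nonneg hG0

/-- A sequence that is conditionally i.i.d. given `σ(M)` is conditionally i.i.d. given `M` in the
sense of joint laws, and conversely. -/
lemma condIndepWithLaws_iff_isMixedIID [IsProbabilityMeasure P] (hM : Measurable M)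
    (hY : ∀ n, Measurable (Y n)) {L : Ω → Measure S} (hL : ∀ᵐ ω ∂P, L ω = K (M ω)) :
    CondIndepWithLaws P (MeasurableSpace.comap M inferInstance) Y (fun _ => L) ↔
      IsMixedIID P M K Y := by
  have h0 : CondIndepWithLaws P (MeasurableSpace.comap M inferInstance) Y (fun _ => L) ↔
      CondIndepWithLaws P (MeasurableSpace.comap M inferInstance) Y (fun _ ω => K (M ω)) := by
    unfold CondIndepWithLaws
    refine forall_congr' fun n => forall_congr' fun A => forall_congr' fun hA => ?_
    have : (fun ω => ∏ i ∈ Finset.range n, (L ω).real (A i)) =ᵐ[P]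
        fun ω => ∏ i ∈ Finset.range n, (K (M ω)).real (A i) := by
      filter_upwards [hL] with ω hω
      rw [hω]
    exact ⟨fun h => h.trans this, fun h => h.trans this.symm⟩
  rw [h0, condIndepWithLaws_iff hM.comap_le hY (fun i => Eventually.of_forall fun ω => by simp)
    (fun i A hA => (K.measurable_coe hA).comp (comap_measurable M))]
  constructor
  · intro h
    exact IsMixedIID.of_measure_eq hM hY fun D n A hD hA => h n A hA _ ⟨D, hD, rfl⟩
  · rintro h n A hA _ ⟨D, hD, rfl⟩
    have h1 := h.lintegral_mul_prod (Φ := D.indicator 1) (measurable_one.indicator hD) n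
      (f := fun i => (A i).indicator 1) (fun i => measurable_one.indicator (hA i))
    have e1 : ∀ ω, (D.indicator 1 (M ω) * ∏ i ∈ Finset.range n, (A i).indicator 1 (Y i ω) : ℝ≥0∞)
        = (M ⁻¹' D ∩ ⋂ i ∈ Finset.range n, Y i ⁻¹' A i).indicator 1 ω := by
      intro ω
      rw [prod_range_indicator_one Y]
      exact indicator_one_mul_indicator (M ⁻¹' D) _ _ ω
    have e2 : ∀ ω, (D.indicator 1 (M ω) * ∏ i ∈ Finset.range n,
        ∫⁻ y, (A i).indicator 1 y ∂(K (M ω)) : ℝ≥0∞)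
        = (M ⁻¹' D).indicator (fun ω => ∏ i ∈ Finset.range n, K (M ω) (A i)) ω := by
      intro ω
      simp only [lintegral_indicator_one (hA _)]
      by_cases hω : M ω ∈ D <;> simp [hω]
    simp_rw [e1, e2] at h1
    rwa [lintegral_indicator_one, lintegral_indicator (hM hD)] at h1
    exact (hM hD).inter (Finset.measurableSet_biInter _ fun i _ => hY i (hA i))

end MixedIID

/-! ### Equality of measures on a countably generated space -/

section CountableDetermination

variable {S : Type*} [MeasurableSpace S] [MeasurableSpace.CountablyGenerated S]

/-- A countable algebra of sets that generates the σ-algebra of `S`. -/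
def countableAlgebra (S : Type*) [MeasurableSpace S] [MeasurableSpace.CountablyGenerated S] :
    Set (Set S) :=
  generateSetAlgebra (MeasurableSpace.countableGeneratingSet S)

lemma countable_countableAlgebra : (countableAlgebra S).Countable :=
  countable_generateSetAlgebra MeasurableSpace.countable_countableGeneratingSet

lemma generateFrom_countableAlgebra :
    MeasurableSpace.generateFrom (countableAlgebra S) = ‹MeasurableSpace S› := by
  rw [countableAlgebra, generateFrom_generateSetAlgebra_eq,
    MeasurableSpace.generateFrom_countableGeneratingSet]

lemma measurableSet_of_mem_countableAlgebra {A : Set S} (hA : A ∈ countableAlgebra S) :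
    MeasurableSet A := by
  rw [← generateFrom_countableAlgebra (S := S)]
  exact MeasurableSpace.measurableSet_generateFrom hA

lemma measure_eq_iff_countableAlgebra {μ μ' : Measure S} [IsFiniteMeasure μ] :
    μ = μ' ↔ ∀ A ∈ countableAlgebra S, μ A = μ' A := by
  refine ⟨fun h A _ => by rw [h], fun h => ?_⟩
  have halg := isSetAlgebra_generateSetAlgebra (𝒜 := MeasurableSpace.countableGeneratingSet S)
  exact ext_of_generate_finite _ (generateFrom_countableAlgebra (S := S)).symm
    halg.isSetRing.isSetSemiring.isPiSystem h (h _ halg.univ_mem)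

lemma measurableSet_eq_measure {α : Type*} [MeasurableSpace α] {f g : α → Measure S}
    (hf : Measurable f) (hg : Measurable g) (hfin : ∀ a, IsFiniteMeasure (f a)) :
    MeasurableSet {a | f a = g a} := by
  have : {a | f a = g a} = ⋂ A ∈ countableAlgebra S, {a | f a A = g a A} := by
    ext a
    have := hfin a
    simp [measure_eq_iff_countableAlgebra]
  rw [this]
  refine MeasurableSet.biInter countable_countableAlgebra fun A hA => ?_
  have hA' := measurableSet_of_mem_countableAlgebra hA
  exact measurableSet_eq_fun ((Measure.measurable_coe hA').comp hf)
    ((Measure.measurable_coe hA').comp hg)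

lemma ae_measure_eq {α : Type*} [MeasurableSpace α] {m : Measure α} {f g : α → Measure S}
    (hfin : ∀ᵐ a ∂m, IsFiniteMeasure (f a))
    (h : ∀ A, MeasurableSet A → ∀ᵐ a ∂m, f a A = g a A) : ∀ᵐ a ∂m, f a = g a := by
  have := (ae_ball_iff (countable_countableAlgebra (S := S))).2
    fun A hA => h A (measurableSet_of_mem_countableAlgebra hA)
  filter_upwards [hfin, this] with a h1 h2
  exact measure_eq_iff_countableAlgebra.2 h2

end CountableDetermination

/-! ### Mixed moments of the sequence -/

section Moments

/-- The identity kernel on probability measures, extended to all measures by a constant. -/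
def probKernel (S : Type*) [MeasurableSpace S] [Nonempty S] : Kernel (Measure S) S := by
  classical
  exact
  { toFun := fun μ => if μ Set.univ = 1 then μ else Measure.dirac (Classical.arbitrary S)
    measurable' := Measurable.ite
      (measurableSet_eq_fun (Measure.measurable_coe MeasurableSet.univ) measurable_const)
      measurable_id measurable_const }

lemma probKernel_apply {S : Type*} [MeasurableSpace S] [Nonempty S] (μ : Measure S)
    [h : IsProbabilityMeasure μ] : probKernel S μ = μ := by
  classical
  exact if_pos h.measure_univ

instance {S : Type*} [MeasurableSpace S] [Nonempty S] : IsMarkovKernel (probKernel S) := by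
  classical
  refine ⟨fun μ => ?_⟩
  change IsProbabilityMeasure
    (if μ Set.univ = 1 then μ else Measure.dirac (Classical.arbitrary S))
  split_ifs with h
  · exact ⟨h⟩
  · infer_instance

variable {Ω : Type*} [MeasurableSpace Ω] {P : Measure Ω} [IsProbabilityMeasure P]
  {𝕏 : Type*} [MeasurableSpace 𝕏] [StandardBorelSpace 𝕏] [Nonempty 𝕏]
  {X : ℕ → Ω → 𝕏} {θ : ℝ} {ν : Measure 𝕏} {R : Kernel 𝕏 𝕏} {Pt : Kernel Ω 𝕏} [IsMarkovKernel Pt]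

omit [StandardBorelSpace 𝕏] in
lemma IsDirecting.isMixedIID (h : IsDirecting P X Pt) (hX : ∀ n, Measurable (X n)) :
    IsMixedIID P (fun ω => Pt ω) (probKernel 𝕏) X :=
  (condIndepWithLaws_iff_isMixedIID Pt.measurable hX
    (Eventually.of_forall fun _ => (probKernel_apply _).symm)).1 h

omit [StandardBorelSpace 𝕏] in
lemma IsDirecting.lintegral_prod (h : IsDirecting P X Pt) (hX : ∀ n, Measurable (X n)) (n : ℕ)
    {f : ℕ → 𝕏 → ℝ≥0∞} (hf : ∀ i, Measurable (f i)) :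
    ∫⁻ ω, ∏ i ∈ Finset.range n, f i (X i ω) ∂P =
      ∫⁻ ω, ∏ i ∈ Finset.range n, ∫⁻ y, f i y ∂(Pt ω) ∂P := by
  simpa [probKernel_apply] using
    (h.isMixedIID hX).lintegral_mul_prod (Φ := fun _ => 1) measurable_const n hf

omit [StandardBorelSpace 𝕏] in
lemma IsDirecting.integral_mul (h : IsDirecting P X Pt) (hX : ∀ n, Measurable (X n))
    {g : 𝕏 → ℝ} (hg : Measurable g) {C : ℝ} (hC : ∀ x, |g x| ≤ C) :
    ∫ ω, g (X 0 ω) * g (X 1 ω) ∂P = ∫ ω, (∫ y, g y ∂(Pt ω)) ^ 2 ∂P := by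
  have hmix := h.isMixedIID hX
  have hm : Measurable fun x : Measure 𝕏 × (ℕ → 𝕏) => g (x.2 0) * g (x.2 1) := by fun_prop
  have h1 : ∫ ω, g (X 0 ω) * g (X 1 ω) ∂P =
      ∫ x, g (x.2 0) * g (x.2 1) ∂(P.map fun ω => (Pt ω, fun n => X n ω)) := by
    rw [integral_map hmix.measurable_joint.aemeasurable hm.aestronglyMeasurable]
  have hint : Integrable (fun x : Measure 𝕏 × (ℕ → 𝕏) => g (x.2 0) * g (x.2 1))
      ((P.map fun ω => Pt ω) ⊗ₘ iidKernel (probKernel 𝕏)) := by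
    refine Integrable.of_bound hm.aestronglyMeasurable (C * C) (Eventually.of_forall fun x => ?_)
    rw [norm_mul]
    exact mul_le_mul (hC _) (hC _) (norm_nonneg _) ((abs_nonneg _).trans (hC (x.2 0)))
  rw [h1, hmix.map_eq, Measure.integral_compProd hint, integral_map Pt.measurable.aemeasurable]
  · refine integral_congr_ae (Eventually.of_forall fun ω => ?_)
    simp only [iidKernel_apply, probKernel_apply]
    have hind := (iIndepFun_infinitePi (P := fun _ : ℕ => Pt ω) (X := fun _ => g)
      fun _ => hg).indepFun (zero_ne_one)
    have h2 := hind.integral_mul_eq_mul_integral (hg.comp (measurable_pi_apply 0)).aestronglyMeasurable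
      (hg.comp (measurable_pi_apply 1)).aestronglyMeasurable
    have h3 : ∀ i : ℕ, ∫ y : ℕ → 𝕏, g (y i) ∂(Measure.infinitePi fun _ : ℕ => Pt ω) =
        ∫ y, g y ∂(Pt ω) := fun i => by
      rw [← integral_map (measurable_pi_apply i).aemeasurable hg.aestronglyMeasurable,
        Measure.infinitePi_map_eval]
    simp only [Pi.mul_apply] at h2
    rw [h2, h3, h3, sq]
  · exact (StronglyMeasurable.integral_kernel_prod_right' hm.stronglyMeasurable).aestronglyMeasurable

lemma lintegral_predDist (hX : ∀ n, Measurable (X n)) (n : ℕ)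
    {F : (Fin n → 𝕏) × 𝕏 → ℝ≥0∞} (hF : Measurable F) :
    ∫⁻ ω, F (fun i => X i ω, X n ω) ∂P =
      ∫⁻ ω, ∫⁻ y, F (fun i => X i ω, y) ∂(predDist P X n ω) ∂P := by
  have hm : Measurable fun ω => (fun i : Fin n => X i ω) :=
    measurable_pi_lambda _ fun i => hX i
  rw [← lintegral_map (f := F) hF (hm.prodMk (hX n)),
    ← compProd_map_condDistrib (hX n).aemeasurable, Measure.lintegral_compProd hF,
    lintegral_map _ hm]
  · rfl
  · exact hF.lintegral_kernel_prod_right'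

lemma IsMVPS.lintegral_predictive (h : IsMVPS P X θ ν R) {n : ℕ} (hn : 1 ≤ n)
    {F : (Fin n → 𝕏) × 𝕏 → ℝ≥0∞} (hF : Measurable F) :
    ∫⁻ ω, F (fun i => X i ω, X n ω) ∂P =
      ∫⁻ ω, (ENNReal.ofReal θ + ∑ i ∈ Finset.range n, R (X i ω) Set.univ)⁻¹ *
        (ENNReal.ofReal θ * ∫⁻ y, F (fun i => X i ω, y) ∂ν +
          ∑ i ∈ Finset.range n, ∫⁻ y, F (fun i => X i ω, y) ∂(R (X i ω))) ∂P := by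
  rw [lintegral_predDist h.measurable n hF]
  refine lintegral_congr_ae ?_
  filter_upwards [h.predictive n hn] with ω hω
  rw [hω, lintegral_smul_measure, lintegral_add_measure, lintegral_smul_measure,
    lintegral_finsetSum_measure]
  simp

end Moments

/-! ### The structure of the reinforcement kernel -/

section Kernel

variable {𝕏 : Type*} [MeasurableSpace 𝕏] {R : Kernel 𝕏 𝕏}

lemma measurableSet_nullPart (R : Kernel 𝕏 𝕏) : MeasurableSet (nullPart R) :=
  measurableSet_eq_fun (R.measurable_coe MeasurableSet.univ) measurable_const

lemma IsCanonical.isFiniteKernel (hR : IsCanonical R) : IsFiniteKernel R :=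
  ⟨1, ENNReal.one_lt_top, fun x => by
    by_cases hx : x ∈ nullPart R
    · rw [show R x Set.univ = 0 from hx]; exact zero_le
    · exact (hR x hx).le⟩

lemma eq_zero_of_mem_nullPart {x : 𝕏} (hx : x ∈ nullPart R) : R x = 0 :=
  Measure.measure_univ_eq_zero.1 hx

/-- The kernel `x ↦ R x (· | Zᶜ)`, where `Z` is the null set of `R`. It vanishes on `Z`. -/
def offNull (R : Kernel 𝕏 𝕏) : Kernel 𝕏 𝕏 where
  toFun x := cond (R x) (nullPart R)ᶜ
  measurable' := by
    refine Measure.measurable_of_measurable_coe _ fun A hA => ?_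
    have hZ := (measurableSet_nullPart R).compl
    simp_rw [cond_apply hZ]
    exact (R.measurable_coe hZ).inv.mul (R.measurable_coe (hZ.inter hA))

lemma offNull_apply (x : 𝕏) : offNull R x = cond (R x) (nullPart R)ᶜ := rfl

lemma offNull_apply_le_one (x : 𝕏) (A : Set 𝕏) : offNull R x A ≤ 1 := by
  refine (measure_mono (Set.subset_univ A)).trans ?_
  rw [offNull_apply, cond_apply (measurableSet_nullPart R).compl, Set.inter_univ]
  exact ENNReal.inv_mul_le_one _

instance : IsFiniteKernel (offNull R) :=
  ⟨1, ENNReal.one_lt_top, fun x => offNull_apply_le_one x _⟩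

lemma offNull_eq_zero_of_mem {x : 𝕏} (hx : x ∈ nullPart R) : offNull R x = 0 := by
  rw [offNull_apply, eq_zero_of_mem_nullPart hx]
  simp [ProbabilityTheory.cond]

lemma offNull_apply_nullPart (x : 𝕏) : offNull R x (nullPart R) = 0 := by
  rw [offNull_apply, cond_apply (measurableSet_nullPart R).compl]
  simp

end Kernel

section Structure

variable {Ω : Type*} [MeasurableSpace Ω] {P : Measure Ω} [IsProbabilityMeasure P]
  {𝕏 : Type*} [MeasurableSpace 𝕏] [StandardBorelSpace 𝕏] [Nonempty 𝕏]
  {X : ℕ → Ω → 𝕏} {θ : ℝ} {ν : Measure 𝕏} [IsProbabilityMeasure ν] {R : Kernel 𝕏 𝕏}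
  {Pt : Kernel Ω 𝕏} [IsMarkovKernel Pt]

lemma IsMVPS.lintegral_zero (h : IsMVPS P X θ ν R) {f : 𝕏 → ℝ≥0∞} (hf : Measurable f) :
    ∫⁻ ω, f (X 0 ω) ∂P = ∫⁻ x, f x ∂ν := by
  rw [← h.law_zero, lintegral_map hf (h.measurable 0)]

lemma IsMVPS.lintegral_two (h : IsMVPS P X θ ν R) (hR : IsCanonical R) {F : 𝕏 × 𝕏 → ℝ≥0∞}
    (hF : Measurable F) :
    ∫⁻ ω, F (X 0 ω, X 1 ω) ∂P =
      ∫⁻ x, (ENNReal.ofReal θ + R x Set.univ)⁻¹ *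
        (ENNReal.ofReal θ * ∫⁻ y, F (x, y) ∂ν + ∫⁻ y, F (x, y) ∂(R x)) ∂ν := by
  have := hR.isFiniteKernel
  have h1 := h.lintegral_predictive (n := 1) le_rfl (F := fun p => F (p.1 0, p.2)) (by fun_prop)
  have hm : Measurable fun x => (ENNReal.ofReal θ + R x Set.univ)⁻¹ *
        (ENNReal.ofReal θ * ∫⁻ y, F (x, y) ∂ν + ∫⁻ y, F (x, y) ∂(R x)) :=
    ((measurable_const.add (R.measurable_coe MeasurableSet.univ)).inv).mul
      ((measurable_const.mul hF.lintegral_prod_right').add hF.lintegral_kernel_prod_right')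
  rw [← h.lintegral_zero hm]
  simpa using h1

lemma IsMVPS.lintegral_three (h : IsMVPS P X θ ν R) {F : 𝕏 × 𝕏 → ℝ≥0∞}
    {f : 𝕏 → ℝ≥0∞} (hF : Measurable F) (hf : Measurable f) :
    ∫⁻ ω, F (X 0 ω, X 1 ω) * f (X 2 ω) ∂P =
      ∫⁻ ω, F (X 0 ω, X 1 ω) * ((ENNReal.ofReal θ + R (X 0 ω) Set.univ + R (X 1 ω) Set.univ)⁻¹ *
        (ENNReal.ofReal θ * ∫⁻ y, f y ∂ν + ∫⁻ y, f y ∂(R (X 0 ω)) +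
          ∫⁻ y, f y ∂(R (X 1 ω)))) ∂P := by
  have h1 := h.lintegral_predictive (n := 2) one_le_two
    (F := fun p => F (p.1 0, p.1 1) * f p.2) (by fun_prop)
  simp only [Fin.val_zero, Fin.val_one] at h1
  rw [h1]
  refine lintegral_congr fun ω => ?_
  simp only [lintegral_const_mul _ hf, Finset.sum_range_succ, Finset.sum_range_zero, zero_add]
  ring_nf

lemma lintegral_indicator_mul_indicator {m : Measure 𝕏} {A : Set 𝕏} (hA : MeasurableSet A)
    (g : 𝕏 → ℝ≥0∞) : ∫⁻ x, A.indicator 1 x * g x ∂m = ∫⁻ x in A, g x ∂m := by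
  rw [← lintegral_indicator hA]
  refine lintegral_congr fun x => ?_
  by_cases hx : x ∈ A <;> simp [hx]

lemma lintegral_const_mul_const_add {m : Measure 𝕏} {f : 𝕏 → ℝ≥0∞} (hf : Measurable f)
    (a b : ℝ≥0∞) : ∫⁻ x, a * (b + f x) ∂m = a * (b * m Set.univ + ∫⁻ x, f x ∂m) := by
  rw [lintegral_const_mul _ (hf.const_add b), lintegral_add_left measurable_const, lintegral_const]

lemma IsDirecting.lintegral_apply (hPt : IsDirecting P X Pt) (h : IsMVPS P X θ ν R)
    {A : Set 𝕏} (hA : MeasurableSet A) : ∫⁻ ω, Pt ω A ∂P = ν A := by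
  have h1 := hPt.lintegral_prod h.measurable 1 (f := fun _ => A.indicator 1)
    fun _ => measurable_one.indicator hA
  simp only [Finset.prod_range_one, lintegral_indicator_one hA] at h1
  rw [← h1, h.lintegral_zero (measurable_one.indicator hA), lintegral_indicator_one hA]

/-- The mean of the directing measure is `ν`, so a property that holds `ν`-almost everywhere holds
almost everywhere under almost every realisation. -/
lemma IsDirecting.ae_of_ae (hPt : IsDirecting P X Pt) (h : IsMVPS P X θ ν R) {p : 𝕏 → Prop}
    (hp : ∀ᵐ x ∂ν, p x) : ∀ᵐ ω ∂P, ∀ᵐ x ∂(Pt ω), p x := by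
  obtain ⟨t, ht, htm, ht0⟩ := exists_measurable_superset_of_null (ae_iff.1 hp)
  have h1 := hPt.lintegral_apply h htm
  rw [ht0, lintegral_eq_zero_iff (Pt.measurable_coe htm)] at h1
  filter_upwards [h1] with ω hω
  exact ae_iff.2 (measure_mono_null ht hω)

lemma IsDirecting.lintegral_apply_mul (hPt : IsDirecting P X Pt) (h : IsMVPS P X θ ν R)
    (hR : IsCanonical R) {A B : Set 𝕏} (hA : MeasurableSet A) (hB : MeasurableSet B) :
    ∫⁻ ω, Pt ω A * Pt ω B ∂P =
      ∫⁻ x in A, (ENNReal.ofReal θ + R x Set.univ)⁻¹ *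
        (ENNReal.ofReal θ * ν B + R x B) ∂ν := by
  have h1 := hPt.lintegral_prod h.measurable 2 (f := fun i => (if i = 0 then A else B).indicator 1)
    fun i => measurable_one.indicator (by split_ifs <;> assumption)
  simp only [Finset.prod_range_succ, Finset.prod_range_zero, one_mul, if_true, one_ne_zero,
    if_false, lintegral_indicator_one hA, lintegral_indicator_one hB] at h1
  rw [← h1, h.lintegral_two hR (F := fun p => A.indicator 1 p.1 * B.indicator 1 p.2)
    (((measurable_one.indicator hA).comp measurable_fst).mul
      ((measurable_one.indicator hB).comp measurable_snd)),
    ← lintegral_indicator_mul_indicator hA]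
  refine lintegral_congr fun x => ?_
  simp only [lintegral_const_mul _ (measurable_one.indicator hB), lintegral_indicator_one hB]
  ring

lemma IsDirecting.lintegral_apply_mul_mul (hPt : IsDirecting P X Pt) (h : IsMVPS P X θ ν R)
    {A B C : Set 𝕏} (hA : MeasurableSet A) (hB : MeasurableSet B)
    (hC : MeasurableSet C) :
    ∫⁻ ω, A.indicator 1 (X 0 ω) * B.indicator 1 (X 1 ω) * C.indicator 1 (X 2 ω) ∂P =
      ∫⁻ ω, Pt ω A * Pt ω B * Pt ω C ∂P := by
  have h1 := hPt.lintegral_prod h.measurable 3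
    (f := fun i => (if i = 0 then A else if i = 1 then B else C).indicator 1)
    fun i => measurable_one.indicator (by split_ifs <;> assumption)
  simpa only [Finset.prod_range_succ, Finset.prod_range_zero, one_mul, if_true, one_ne_zero,
    if_false, lintegral_indicator_one hA, lintegral_indicator_one hB, OfNat.ofNat_ne_zero,
    OfNat.ofNat_ne_one, lintegral_indicator_one hC] using h1

/-- Off the null set, the reinforcement at `x` puts the same mass as `ν` on subsets of `Z`. -/
lemma IsMVPS.ae_apply_eq_of_subset (h : IsMVPS P X θ ν R) (hR : IsCanonical R)
    (hPt : IsDirecting P X Pt) {A : Set 𝕏} (hA : MeasurableSet A) (hAZ : A ⊆ nullPart R) :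
    ∀ᵐ x ∂ν, x ∈ (nullPart R)ᶜ → R x A = ν A := by
  have := hR.isFiniteKernel
  have hZ := (measurableSet_nullPart R).compl
  have ht0 : ENNReal.ofReal θ ≠ 0 := by simpa using h.theta_pos
  have key : ∀ B, MeasurableSet B → B ⊆ (nullPart R)ᶜ →
      ∫⁻ x in B, R x A ∂ν = ∫⁻ x in B, ν A ∂ν := by
    intro B hB hBZ
    have h1 := hPt.lintegral_apply_mul h hR hA hB
    have h2 := hPt.lintegral_apply_mul h hR hB hA
    simp_rw [mul_comm (Pt _ B)] at h2
    rw [h1] at h2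
    have e1 : ∫⁻ x in A, (ENNReal.ofReal θ + R x Set.univ)⁻¹ *
        (ENNReal.ofReal θ * ν B + R x B) ∂ν = ν A * ν B := by
      rw [setLIntegral_congr_fun hA (g := fun _ => ν B) fun x hx => by
        simp only [eq_zero_of_mem_nullPart (hAZ hx), Measure.coe_zero, Pi.zero_apply, add_zero]
        rw [← mul_assoc, ENNReal.inv_mul_cancel ht0 ENNReal.ofReal_ne_top, one_mul]]
      simp [mul_comm]
    have e2 : ∫⁻ x in B, (ENNReal.ofReal θ + R x Set.univ)⁻¹ *
        (ENNReal.ofReal θ * ν A + R x A) ∂ν =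
        (ENNReal.ofReal θ + 1)⁻¹ * (ENNReal.ofReal θ * ν A * ν B + ∫⁻ x in B, R x A ∂ν) := by
      rw [setLIntegral_congr_fun hB (g := fun x => (ENNReal.ofReal θ + 1)⁻¹ *
          (ENNReal.ofReal θ * ν A + R x A)) fun x hx => by simp only [hR x (hBZ hx)],
        lintegral_const_mul_const_add (R.measurable_coe hA)]
      simp
    rw [e1, e2] at h2
    have h3 : (ENNReal.ofReal θ + 1) * (ν A * ν B) =
        ENNReal.ofReal θ * ν A * ν B + ∫⁻ x in B, R x A ∂ν := by
      rw [h2, ← mul_assoc, ENNReal.mul_inv_cancel (by simp) (by simp), one_mul]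
    have h4 : ENNReal.ofReal θ * ν A * ν B + ν A * ν B =
        ENNReal.ofReal θ * ν A * ν B + ∫⁻ x in B, R x A ∂ν := by
      rw [← h3]; ring
    rw [ENNReal.add_right_inj (by finiteness)] at h4
    rw [← h4]; simp
  rw [← ae_restrict_iff' hZ]
  refine ae_eq_of_forall_setLIntegral_eq_of_sigmaFinite (R.measurable_coe hA) measurable_const
    fun B hB _ => ?_
  rw [Measure.restrict_restrict hB]
  exact key _ (hB.inter hZ) Set.inter_subset_right

/-- Off the null set, the reinforcement is `ν` on `Z` plus a multiple of its restriction to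
`Zᶜ`. -/
lemma IsMVPS.ae_eq_add_offNull (h : IsMVPS P X θ ν R) (hR : IsCanonical R)
    (hPt : IsDirecting P X Pt) :
    ∀ᵐ x ∂ν, x ∈ (nullPart R)ᶜ →
      R x (nullPart R)ᶜ = ν (nullPart R)ᶜ ∧
        R x = ν.restrict (nullPart R) + ν (nullPart R)ᶜ • offNull R x := by
  have := hR.isFiniteKernel
  have hZ := measurableSet_nullPart R
  have h1 : ∀ᵐ x ∂(ν.restrict (nullPart R)ᶜ),
      (R x).restrict (nullPart R) = ν.restrict (nullPart R) := by
    refine ae_measure_eq (Eventually.of_forall fun x => inferInstance) fun A hA => ?_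
    rw [ae_restrict_iff' hZ.compl]
    filter_upwards [h.ae_apply_eq_of_subset hR hPt (hA.inter hZ) Set.inter_subset_right]
      with x hx hxZ
    rw [Measure.restrict_apply hA, Measure.restrict_apply hA, hx hxZ]
  rw [ae_restrict_iff' hZ.compl] at h1
  filter_upwards [h1] with x hx hxZ
  specialize hx hxZ
  have hm : R x (nullPart R)ᶜ = ν (nullPart R)ᶜ := by
    have e1 : R x (nullPart R) = ν (nullPart R) := by
      simpa using congrArg (fun m => m (nullPart R)) hx
    rw [measure_compl hZ (measure_ne_top _ _), measure_compl hZ (measure_ne_top _ _), e1,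
      hR x hxZ, measure_univ]
  refine ⟨hm, ?_⟩
  rw [offNull_apply, ProbabilityTheory.cond, hm, smul_smul]
  by_cases hc : ν (nullPart R)ᶜ = 0
  · have : (R x).restrict (nullPart R)ᶜ = 0 := by
      rw [Measure.restrict_eq_zero, hm, hc]
    rw [this, smul_zero, add_zero, ← hx]
    exact (Measure.restrict_add_restrict_compl hZ).symm.trans (by rw [this, add_zero])
  · rw [ENNReal.mul_inv_cancel hc (measure_ne_top _ _), one_smul, ← hx,
      Measure.restrict_add_restrict_compl hZ]

/-- The measure `ν(dx) R x (dy)` is symmetric on `Zᶜ × Zᶜ`. -/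
lemma IsMVPS.setLIntegral_symm (h : IsMVPS P X θ ν R) (hR : IsCanonical R)
    (hPt : IsDirecting P X Pt) {A B : Set 𝕏} (hA : MeasurableSet A) (hB : MeasurableSet B)
    (hAZ : A ⊆ (nullPart R)ᶜ) (hBZ : B ⊆ (nullPart R)ᶜ) :
    ∫⁻ x in A, R x B ∂ν = ∫⁻ x in B, R x A ∂ν := by
  have := hR.isFiniteKernel
  have e : ∀ A B, MeasurableSet A → MeasurableSet B → A ⊆ (nullPart R)ᶜ →
      ∫⁻ ω, Pt ω A * Pt ω B ∂P =
        (ENNReal.ofReal θ + 1)⁻¹ * (ENNReal.ofReal θ * ν A * ν B + ∫⁻ x in A, R x B ∂ν) := by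
    intro A B hA hB hAZ
    rw [hPt.lintegral_apply_mul h hR hA hB,
      setLIntegral_congr_fun hA (g := fun x => (ENNReal.ofReal θ + 1)⁻¹ *
          (ENNReal.ofReal θ * ν B + R x B)) fun x hx => by simp only [hR x (hAZ hx)],
        lintegral_const_mul_const_add (R.measurable_coe hB), Measure.restrict_apply_univ,
        mul_right_comm]
  have h1 := e A B hA hB hAZ
  have h2 := e B A hB hA hBZ
  simp_rw [mul_comm (Pt _ B)] at h2
  rw [h1, ENNReal.mul_right_inj (by simp) (by simp)] at h2
  rw [mul_right_comm, ENNReal.add_right_inj (by finiteness)] at h2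
  exact h2

lemma IsMVPS.lintegral_offNull (h : IsMVPS P X θ ν R) (hR : IsCanonical R)
    (hPt : IsDirecting P X Pt) (hc : ν (nullPart R)ᶜ ≠ 0) {A : Set 𝕏} (hA : MeasurableSet A) :
    ∫⁻ x, offNull R x A ∂ν = ν (A ∩ (nullPart R)ᶜ) := by
  have hZ := measurableSet_nullPart R
  have e1 : ∫⁻ x, offNull R x A ∂ν = ∫⁻ x in (nullPart R)ᶜ, offNull R x A ∂ν := by
    refine (setLIntegral_eq_of_support_subset fun x hx => ?_).symm
    by_contra hxZ
    simp only [Set.mem_compl_iff, not_not] at hxZ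
    exact hx (by simp [offNull_eq_zero_of_mem hxZ])
  have e2 : ∫⁻ x in (nullPart R)ᶜ, offNull R x A ∂ν =
      (ν (nullPart R)ᶜ)⁻¹ * ∫⁻ x in (nullPart R)ᶜ, R x (A ∩ (nullPart R)ᶜ) ∂ν := by
    rw [← lintegral_const_mul _ (R.measurable_coe (hA.inter hZ.compl))]
    refine setLIntegral_congr_fun_ae hZ.compl ?_
    filter_upwards [h.ae_eq_add_offNull hR hPt] with x hx hxZ
    rw [offNull_apply, cond_apply hZ.compl, (hx hxZ).1, Set.inter_comm]
  have e3 : ∫⁻ x in A ∩ (nullPart R)ᶜ, R x (nullPart R)ᶜ ∂ν =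
      ν (nullPart R)ᶜ * ν (A ∩ (nullPart R)ᶜ) := by
    rw [setLIntegral_congr_fun_ae (hA.inter hZ.compl) (g := fun _ => ν (nullPart R)ᶜ)]
    · simp
    · filter_upwards [h.ae_eq_add_offNull hR hPt] with x hx hxA using (hx hxA.2).1
  rw [e1, e2, h.setLIntegral_symm hR hPt hZ.compl (hA.inter hZ.compl) le_rfl
    Set.inter_subset_right, e3, ← mul_assoc, ENNReal.inv_mul_cancel hc (measure_ne_top _ _),
    one_mul]

/-- A property that holds `ν`-almost everywhere holds `offNull R x`-almost everywhere, for
`ν`-almost every `x`. -/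
lemma IsMVPS.ae_ae_offNull (h : IsMVPS P X θ ν R) (hR : IsCanonical R)
    (hPt : IsDirecting P X Pt) (hc : ν (nullPart R)ᶜ ≠ 0) {p : 𝕏 → Prop} (hp : ∀ᵐ x ∂ν, p x) :
    ∀ᵐ x ∂ν, ∀ᵐ y ∂(offNull R x), p y := by
  obtain ⟨t, ht, htm, ht0⟩ := exists_measurable_superset_of_null (ae_iff.1 hp)
  have h1 := h.lintegral_offNull hR hPt hc htm
  rw [measure_mono_null Set.inter_subset_left ht0,
    lintegral_eq_zero_iff ((offNull R).measurable_coe htm)] at h1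
  filter_upwards [h1] with ω hω
  exact ae_iff.2 (measure_mono_null ht hω)

/-- Exchangeability of the first three terms makes the normalised kernel idempotent. -/
lemma IsMVPS.ae_offNull_idem (h : IsMVPS P X θ ν R) (hR : IsCanonical R)
    (hPt : IsDirecting P X Pt) (hc : ν (nullPart R)ᶜ ≠ 0) {A : Set 𝕏} (hA : MeasurableSet A) :
    ∀ᵐ x ∂ν, ∫⁻ y, offNull R y A ∂(offNull R x) = offNull R x A := by
  have := hR.isFiniteKernel
  have hZ := measurableSet_nullPart R
  set t := ENNReal.ofReal θ with ht
  have htop : t ≠ ⊤ := ENNReal.ofReal_ne_top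
  -- the law of the first three terms on `Zᶜ × Zᶜ × Zᶜ`
  have e : ∀ A B C, MeasurableSet A → MeasurableSet B → MeasurableSet C → A ⊆ (nullPart R)ᶜ →
      B ⊆ (nullPart R)ᶜ → C ⊆ (nullPart R)ᶜ →
      ∫⁻ ω, Pt ω A * Pt ω B * Pt ω C ∂P = (t + 1 + 1)⁻¹ * ((t + 1)⁻¹ *
        (∫⁻ x in A, (t * ν B + R x B) * (t * ν C + R x C) ∂ν + ν A * (t * ∫⁻ y in B, R y C ∂ν) +
          ∫⁻ x in A, ∫⁻ y in B, R y C ∂(R x) ∂ν)) := by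
    intro A B C hA hB hC hAZ hBZ hCZ
    have mC := R.measurable_coe hC
    have mB := R.measurable_coe hB
    have mI : Measurable fun x => ∫⁻ y in B, R y C ∂(R x) := by
      simp_rw [← lintegral_indicator_mul_indicator hB]
      exact ((measurable_one.indicator hB).mul mC).lintegral_kernel
    have hmF : Measurable fun p : 𝕏 × 𝕏 =>
        (A.indicator 1 p.1 * B.indicator 1 p.2 : ℝ≥0∞) :=
      ((measurable_one.indicator hA).comp measurable_fst).mul
        ((measurable_one.indicator hB).comp measurable_snd)
    rw [← hPt.lintegral_apply_mul_mul h hA hB hC, h.lintegral_three hmF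
      (measurable_one.indicator hC)]
    have e1 : ∀ x y : 𝕏, (A.indicator 1 x * B.indicator 1 y *
        ((t + R x Set.univ + R y Set.univ)⁻¹ *
        (t * ∫⁻ z, C.indicator 1 z ∂ν + ∫⁻ z, C.indicator 1 z ∂(R x) +
          ∫⁻ z, C.indicator 1 z ∂(R y))) : ℝ≥0∞) = (t + 1 + 1)⁻¹ * (A.indicator 1 x *
          (B.indicator 1 y * (t * ν C + R x C + R y C))) := by
      intro x y
      simp only [lintegral_indicator_one hC]
      by_cases hx : x ∈ A
      · by_cases hy : y ∈ B
        · simp [hx, hy, hR x (hAZ hx), hR y (hBZ hy)]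
        · simp [hy]
      · simp [hx]
    have hmG : Measurable fun p : 𝕏 × 𝕏 => (A.indicator 1 p.1 *
          (B.indicator 1 p.2 * (t * ν C + R p.1 C + R p.2 C)) : ℝ≥0∞) := by
      refine ((measurable_one.indicator hA).comp measurable_fst).mul
        (((measurable_one.indicator hB).comp measurable_snd).mul ?_)
      exact (measurable_const.add (mC.comp measurable_fst)).add (mC.comp measurable_snd)
    simp only [← ht, e1]
    rw [lintegral_const_mul' _ _ (by simp), h.lintegral_two hR hmG]
    congr 1
    have e2 : ∀ x, ((t + R x Set.univ)⁻¹ *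
        (t * ∫⁻ y, A.indicator 1 x * (B.indicator 1 y * (t * ν C + R x C + R y C)) ∂ν +
          ∫⁻ y, A.indicator 1 x * (B.indicator 1 y * (t * ν C + R x C + R y C)) ∂(R x)) : ℝ≥0∞) =
        (t + 1)⁻¹ * (A.indicator 1 x * ((t * ν B + R x B) * (t * ν C + R x C) +
          t * ∫⁻ y in B, R y C ∂ν + ∫⁻ y in B, R y C ∂(R x))) := by
      intro x
      by_cases hx : x ∈ A
      · simp only [hx, Set.indicator_of_mem, Pi.one_apply, one_mul, hR x (hAZ hx),
          lintegral_indicator_mul_indicator hB, lintegral_add_left (f := fun _ => t * ν C + R x C)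
          measurable_const, lintegral_const, Measure.restrict_apply MeasurableSet.univ,
          Set.univ_inter]
        ring
      · simp [hx]
    simp only [← ht, e2]
    rw [lintegral_const_mul' _ _ (by simp), lintegral_indicator_mul_indicator hA,
      lintegral_add_right _ mI, lintegral_add_right _ measurable_const]
    simp [mul_comm]
  -- its symmetry in the last two coordinates
  have sym : ∀ A B C, MeasurableSet A → MeasurableSet B → MeasurableSet C → A ⊆ (nullPart R)ᶜ →
      B ⊆ (nullPart R)ᶜ → C ⊆ (nullPart R)ᶜ →
      ∫⁻ x in A, ∫⁻ y in B, R y C ∂(R x) ∂ν = ∫⁻ x in A, ∫⁻ y in C, R y B ∂(R x) ∂ν := by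
    intro A B C hA hB hC hAZ hBZ hCZ
    have h1 := e A B C hA hB hC hAZ hBZ hCZ
    have h2 := e A C B hA hC hB hAZ hCZ hBZ
    simp_rw [mul_right_comm (Pt _ A)] at h2
    have hR1 : ∀ x D, R x D ≤ 1 := fun x D => by
      refine (measure_mono (Set.subset_univ D)).trans ?_
      by_cases hx : x ∈ nullPart R
      · rw [show R x Set.univ = 0 from hx]; exact zero_le
      · exact (hR x hx).le
    have f1 : ∫⁻ x in A, (t * ν C + R x C) * (t * ν B + R x B) ∂ν ≠ ⊤ := by
      refine ((lintegral_mono (g := fun _ => (t * 1 + 1) * (t * 1 + 1)) fun x => ?_).trans_lt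
        ?_).ne
      · exact mul_le_mul' (add_le_add (mul_le_mul' le_rfl prob_le_one) (hR1 _ _))
          (add_le_add (mul_le_mul' le_rfl prob_le_one) (hR1 _ _))
      · rw [lintegral_const]; finiteness
    have f2 : ∫⁻ y in C, R y B ∂ν ≠ ⊤ := by
      refine ((lintegral_mono (g := fun _ => 1) fun x => hR1 _ _).trans_lt ?_).ne
      rw [lintegral_const]; finiteness
    rw [h1, ENNReal.mul_right_inj (by simp [htop]) (by finiteness),
      ENNReal.mul_right_inj (by simp [htop]) (by finiteness), h.setLIntegral_symm hR hPt hB hC hBZ hCZ] at h2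
    simp_rw [mul_comm (t * ν B + R _ B)] at h2
    rwa [ENNReal.add_right_inj (by finiteness)] at h2
  set c := ν (nullPart R)ᶜ with hcdef
  have hctop : c ≠ ⊤ := measure_ne_top _ _
  have mA := R.measurable_coe (hA.inter hZ.compl)
  have mI : Measurable fun x => ∫⁻ y in (nullPart R)ᶜ, R y (A ∩ (nullPart R)ᶜ) ∂(R x) := by
    simp_rw [← lintegral_indicator_mul_indicator hZ.compl]
    exact ((measurable_one.indicator hZ.compl).mul mA).lintegral_kernel
  have key : ∀ᵐ x ∂ν, x ∈ (nullPart R)ᶜ →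
      ∫⁻ y in (nullPart R)ᶜ, R y (A ∩ (nullPart R)ᶜ) ∂(R x) = c * R x (A ∩ (nullPart R)ᶜ) := by
    rw [← ae_restrict_iff' hZ.compl]
    refine ae_eq_of_forall_setLIntegral_eq_of_sigmaFinite mI (measurable_const.mul mA)
      fun B hB _ => ?_
    rw [Measure.restrict_restrict hB, sym _ _ _ (hB.inter hZ.compl) hZ.compl (hA.inter hZ.compl)
      Set.inter_subset_right le_rfl Set.inter_subset_right]
    refine setLIntegral_congr_fun_ae (hB.inter hZ.compl) ?_
    filter_upwards [h.ae_eq_add_offNull hR hPt, h.ae_ae_offNull hR hPt hc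
      (h.ae_eq_add_offNull hR hPt)] with x hx hx' hxB
    have hx2 := (hx hxB.2).2
    have : ∀ᵐ y ∂(R x), y ∈ A ∩ (nullPart R)ᶜ → R y (nullPart R)ᶜ = c := by
      rw [hx2, ae_add_measure_iff]
      constructor
      · rw [ae_restrict_iff' hZ]
        exact Eventually.of_forall fun y hy hy' => absurd hy hy'.2
      · refine Measure.ae_smul_measure ?_ _
        filter_upwards [hx'] with y hy hyA using (hy hyA.2).1
    rw [setLIntegral_congr_fun_ae (hA.inter hZ.compl) this]
    simp
  filter_upwards [key, h.ae_eq_add_offNull hR hPt, h.ae_ae_offNull hR hPt hc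
      (h.ae_eq_add_offNull hR hPt)] with x hx1 hx2 hx3
  by_cases hxZ : x ∈ nullPart R
  · simp [offNull_eq_zero_of_mem hxZ]
  have hk : ∀ y, R y (nullPart R)ᶜ = c → offNull R y A = c⁻¹ * R y (A ∩ (nullPart R)ᶜ) := by
    intro y hy
    rw [offNull_apply, cond_apply hZ.compl, hy, Set.inter_comm]
  have hoff : offNull R x = c⁻¹ • (R x).restrict (nullPart R)ᶜ := by
    rw [offNull_apply, ProbabilityTheory.cond, (hx2 hxZ).1]
  have hnz : ∀ᵐ y ∂(offNull R x), y ∈ (nullPart R)ᶜ :=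
    compl_mem_ae_iff.2 (offNull_apply_nullPart x)
  have e1 : ∫⁻ y, offNull R y A ∂(offNull R x) =
      ∫⁻ y, c⁻¹ * R y (A ∩ (nullPart R)ᶜ) ∂(offNull R x) := by
    refine lintegral_congr_ae ?_
    filter_upwards [hx3, hnz] with y hy hyZ using hk y (hy hyZ).1
  rw [e1, lintegral_const_mul _ mA, hk x (hx2 hxZ).1, hoff, lintegral_smul_measure, smul_eq_mul,
    hx1 hxZ]
  rw [← mul_assoc c⁻¹ c, ENNReal.inv_mul_cancel hc hctop, one_mul]

end Structure

section Concentration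

variable {Ω : Type*} [MeasurableSpace Ω] {P : Measure Ω} [IsProbabilityMeasure P]
  {𝕏 : Type*} [MeasurableSpace 𝕏] [StandardBorelSpace 𝕏] [Nonempty 𝕏]
  {X : ℕ → Ω → 𝕏} {θ : ℝ} {ν : Measure 𝕏} [IsProbabilityMeasure ν] {R : Kernel 𝕏 𝕏}
  {Pt : Kernel Ω 𝕏} [IsMarkovKernel Pt]

lemma IsMVPS.bind_offNull (h : IsMVPS P X θ ν R) (hR : IsCanonical R)
    (hPt : IsDirecting P X Pt) (hc : ν (nullPart R)ᶜ ≠ 0) :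
    ν.bind (offNull R) = ν.restrict (nullPart R)ᶜ := by
  ext A hA
  rw [Measure.bind_apply hA (offNull R).aemeasurable, Measure.restrict_apply hA,
    h.lintegral_offNull hR hPt hc hA]

/-- The class `{y | R y = R x}`. -/
def fiber (R : Kernel 𝕏 𝕏) (x : 𝕏) : Set 𝕏 := {y | R y = R x}

lemma measurableSet_fiber (hR : IsCanonical R) (x : 𝕏) : MeasurableSet (fiber R x) :=
  have := hR.isFiniteKernel
  measurableSet_eq_measure R.measurable measurable_const fun _ => inferInstance

lemma measurableSet_fiber_prod (hR : IsCanonical R) :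
    MeasurableSet {p : 𝕏 × 𝕏 | p.2 ∈ fiber R p.1} :=
  have := hR.isFiniteKernel
  measurableSet_eq_measure (R.measurable.comp measurable_snd) (R.measurable.comp measurable_fst)
    fun _ => inferInstance

/-- The properties of the reinforcement kernel at a typical point `x` of `Zᶜ`: it is `ν` on `Z`,
and its normalised restriction to `Zᶜ` is carried by the class of `x`. -/
structure IsRegularPoint (ν : Measure 𝕏) (R : Kernel 𝕏 𝕏) (x : 𝕏) : Prop where
  apply_compl : R x (nullPart R)ᶜ = ν (nullPart R)ᶜ
  eq_add : R x = ν.restrict (nullPart R) + ν (nullPart R)ᶜ • offNull R x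
  ae_mem_fiber : ∀ᵐ y ∂(offNull R x), y ∈ fiber R x

/-- For an invariant and idempotent kernel `k` and `φ = k(A)`, the variance
`∫ ν(dx) ∫ k x (dy) (φ y - φ x)²` vanishes. -/
lemma IsMVPS.ae_ae_offNull_apply_eq (h : IsMVPS P X θ ν R) (hR : IsCanonical R)
    (hPt : IsDirecting P X Pt) (hc : ν (nullPart R)ᶜ ≠ 0) {A : Set 𝕏} (hA : MeasurableSet A) :
    ∀ᵐ x ∂ν, ∀ᵐ y ∂(offNull R x), offNull R y A = offNull R x A := by
  have hZ := measurableSet_nullPart R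
  set φ : 𝕏 → ℝ≥0∞ := fun x => offNull R x A with hφ
  have mφ : Measurable φ := (offNull R).measurable_coe hA
  have φ1 : ∀ x, φ x ≤ 1 := fun x => offNull_apply_le_one x A
  have φt : ∀ x, φ x ≠ ⊤ := fun x => ((φ1 x).trans_lt ENNReal.one_lt_top).ne
  set D : 𝕏 × 𝕏 → ℝ≥0∞ := fun p => ENNReal.ofReal (((φ p.2).toReal - (φ p.1).toReal) ^ 2) with hD
  have mD : Measurable D := by
    refine Measurable.ennreal_ofReal (Measurable.pow_const (Measurable.sub ?_ ?_) 2)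
    · exact (mφ.comp measurable_snd).ennreal_toReal
    · exact (mφ.comp measurable_fst).ennreal_toReal
  have hpt : ∀ x y, D (x, y) + 2 * φ x * φ y = φ y ^ 2 + φ x ^ 2 := by
    intro x y
    rw [← ENNReal.ofReal_toReal (φt x), ← ENNReal.ofReal_toReal (φt y), hD]
    rw [← ENNReal.ofReal_pow ENNReal.toReal_nonneg, ← ENNReal.ofReal_pow ENNReal.toReal_nonneg,
      show (2 : ℝ≥0∞) = ENNReal.ofReal 2 by simp, ← ENNReal.ofReal_mul zero_le_two,
      ← ENNReal.ofReal_mul (by positivity), ← ENNReal.ofReal_add (by positivity) (by positivity),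
      ← ENNReal.ofReal_add (by positivity) (by positivity)]
    ring_nf
  have mV : Measurable fun x => ∫⁻ y, D (x, y) ∂(offNull R x) := mD.lintegral_kernel_prod_right'
  have hV : ∀ᵐ x ∂ν, ∫⁻ y, D (x, y) ∂(offNull R x) + 2 * φ x ^ 2 ≤
      ∫⁻ y, φ y ^ 2 ∂(offNull R x) + φ x ^ 2 := by
    filter_upwards [h.ae_offNull_idem hR hPt hc hA] with x hx
    have e1 : 2 * φ x ^ 2 = ∫⁻ y, 2 * φ x * φ y ∂(offNull R x) := by
      rw [lintegral_const_mul _ mφ, hx]; ring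
    rw [e1, ← lintegral_add_right _ (mφ.const_mul _)]
    simp_rw [hpt]
    rw [lintegral_add_right _ measurable_const, lintegral_const]
    gcongr
    exact mul_le_of_le_one_right' (offNull_apply_le_one x _)
  have hφZ : ∫⁻ x, ∫⁻ y, φ y ^ 2 ∂(offNull R x) ∂ν = ∫⁻ x, φ x ^ 2 ∂ν := by
    rw [← Measure.lintegral_bind (offNull R).aemeasurable (mφ.pow_const 2).aemeasurable,
      h.bind_offNull hR hPt hc]
    refine setLIntegral_eq_of_support_subset fun x hx => ?_
    by_contra hxZ
    simp only [Set.mem_compl_iff, not_not] at hxZ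
    exact hx (by simp [hφ, offNull_eq_zero_of_mem hxZ])
  have hI := lintegral_mono_ae hV
  have hfin : ∫⁻ x, φ x ^ 2 ∂ν ≠ ⊤ := by
    refine ((lintegral_mono (g := fun _ => 1) fun x => pow_le_one₀ zero_le (φ1 x)).trans_lt ?_).ne
    simp
  rw [lintegral_add_left mV, lintegral_add_right _ (mφ.pow_const 2), hφZ,
    lintegral_const_mul _ (mφ.pow_const 2), two_mul] at hI
  have hzero : ∫⁻ x, ∫⁻ y, D (x, y) ∂(offNull R x) ∂ν = 0 := by
    have := ENNReal.le_of_add_le_add_right (a := ∫⁻ x, φ x ^ 2 ∂ν + ∫⁻ x, φ x ^ 2 ∂ν)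
      (by finiteness) (hI.trans_eq (zero_add _).symm)
    exact le_antisymm this zero_le
  rw [lintegral_eq_zero_iff mV] at hzero
  filter_upwards [hzero] with x hx
  have hx' : ∫⁻ y, D (x, y) ∂(offNull R x) = 0 := hx
  replace hx' := (lintegral_eq_zero_iff (mD.comp measurable_prodMk_left)).1 hx'
  filter_upwards [hx'] with y hy
  have : ((φ y).toReal - (φ x).toReal) ^ 2 ≤ 0 := by simpa [hD] using hy
  have h0 : (φ y).toReal - (φ x).toReal = 0 := by nlinarith
  exact (ENNReal.toReal_eq_toReal_iff' (φt y) (φt x)).1 (sub_eq_zero.1 h0)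

/-- For `k x`-almost every `y` the measures `k y` and `k x` agree on a countable generating algebra,
and `R` is a function of `k` at typical points, so `y` lies in the class of `x`. -/
lemma IsMVPS.ae_isRegularPoint (h : IsMVPS P X θ ν R) (hR : IsCanonical R)
    (hPt : IsDirecting P X Pt) (hc : ν (nullPart R)ᶜ ≠ 0) :
    ∀ᵐ x ∂ν, x ∈ (nullPart R)ᶜ → IsRegularPoint ν R x := by
  have h1 : ∀ᵐ x ∂ν, ∀ A ∈ countableAlgebra 𝕏, ∀ᵐ y ∂(offNull R x),
      offNull R y A = offNull R x A :=
    (ae_ball_iff countable_countableAlgebra).2 fun A hA =>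
      h.ae_ae_offNull_apply_eq hR hPt hc (measurableSet_of_mem_countableAlgebra hA)
  have h2 := h.ae_eq_add_offNull hR hPt
  filter_upwards [h1, h2, h.ae_ae_offNull hR hPt hc h2] with x hx1 hx2 hx3 hxZ
  refine ⟨(hx2 hxZ).1, (hx2 hxZ).2, ?_⟩
  have h4 := (ae_ball_iff countable_countableAlgebra).2 hx1
  have h5 : ∀ᵐ y ∂(offNull R x), y ∈ (nullPart R)ᶜ :=
    compl_mem_ae_iff.2 (offNull_apply_nullPart x)
  filter_upwards [h4, hx3, h5] with y hy1 hy2 hyZ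
  have : offNull R y = offNull R x := measure_eq_iff_countableAlgebra.2 hy1
  rw [fiber, Set.mem_ofPred_eq, (hy2 hyZ).2, (hx2 hxZ).2, this]

/-- A function whose integral under `ν` and under almost every `R x` vanishes has a vanishing
integral under the directing measure, because its second moment is `E[g(X 0) g(X 1)]`. -/
lemma IsMVPS.ae_integral_eq_zero (h : IsMVPS P X θ ν R) (hR : IsCanonical R)
    (hPt : IsDirecting P X Pt) {g : 𝕏 → ℝ} (hg : Measurable g) {C : ℝ} (hC : ∀ x, |g x| ≤ C)
    (hν : ∫ x, g x ∂ν = 0) (hRg : ∀ᵐ x ∂ν, ∫ y, g y ∂(R x) = 0) :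
    ∀ᵐ ω ∂P, ∫ x, g x ∂(Pt ω) = 0 := by
  have := hR.isFiniteKernel
  have hint : ∀ m : Measure 𝕏, IsFiniteMeasure m → Integrable g m := fun m _ =>
    Integrable.of_bound hg.aestronglyMeasurable C (Eventually.of_forall hC)
  have h0 : ∫ ω, g (X 0 ω) * g (X 1 ω) ∂P = 0 := by
    have hmX : Measurable fun ω => (fun i : Fin 1 => X i ω) :=
      measurable_pi_lambda _ fun i => h.measurable i
    have hm : Measurable fun p : (Fin 1 → 𝕏) × 𝕏 => g (p.1 0) * g p.2 := by fun_prop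
    have hi : Integrable (fun p : (Fin 1 → 𝕏) × 𝕏 => g (p.1 0) * g p.2)
        ((P.map fun ω (i : Fin 1) => X i ω) ⊗ₘ condDistrib (X 1) (fun ω (i : Fin 1) => X i ω) P) := by
      refine Integrable.of_bound hm.aestronglyMeasurable (C * C) (Eventually.of_forall fun x => ?_)
      rw [norm_mul]
      exact mul_le_mul (hC _) (hC _) (norm_nonneg _) ((abs_nonneg _).trans (hC x.2))
    have e1 : ∫ ω, g (X 0 ω) * g (X 1 ω) ∂P =
        ∫ p, g (p.1 0) * g p.2 ∂(P.map fun ω => ((fun i : Fin 1 => X i ω), X 1 ω)) := by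
      rw [integral_map (hmX.prodMk (h.measurable 1)).aemeasurable hm.aestronglyMeasurable]
      rfl
    rw [e1, ← compProd_map_condDistrib (h.measurable 1).aemeasurable,
      Measure.integral_compProd hi, integral_map hmX.aemeasurable]
    · refine integral_eq_zero_of_ae ?_
      have hR0 : ∀ᵐ ω ∂P, ∫ y, g y ∂(R (X 0 ω)) = 0 := by
        rw [← h.law_zero] at hRg
        exact ae_of_ae_map (h.measurable 0).aemeasurable hRg
      filter_upwards [h.predictive 1 le_rfl, hR0] with ω hω hω0
      simp only [Fin.val_zero, Pi.zero_apply, integral_const_mul]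
      change g (X 0 ω) * ∫ y, g y ∂(predDist P X 1 ω) = 0
      rw [hω, integral_smul_measure, integral_add_measure, integral_smul_measure, hν]
      · simp [hω0]
      · exact (hint ν inferInstance).smul_measure ENNReal.ofReal_ne_top
      · simpa using hint _ inferInstance
    · exact (StronglyMeasurable.integral_kernel_prod_right'
        hm.stronglyMeasurable).aestronglyMeasurable
  rw [hPt.integral_mul h.measurable hg hC] at h0
  have hmI : StronglyMeasurable fun ω => ∫ y, g y ∂(Pt ω) :=
    hg.stronglyMeasurable.integral_kernel
  have hb : ∀ ω, ‖(∫ y, g y ∂(Pt ω)) ^ 2‖ ≤ C ^ 2 := fun ω => by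
    rw [norm_pow]
    refine pow_le_pow_left₀ (norm_nonneg _) ?_ 2
    simpa using norm_integral_le_of_norm_le_const (μ := Pt ω) (f := g) (C := C)
      (Eventually.of_forall hC)
  rw [integral_eq_zero_iff_of_nonneg (fun ω => sq_nonneg _)
    (Integrable.of_bound (hmI.pow 2).aestronglyMeasurable (C ^ 2) (Eventually.of_forall hb))] at h0
  filter_upwards [h0] with ω hω
  simpa using hω

lemma IsMVPS.ae_restrict_nullPart (h : IsMVPS P X θ ν R) (hR : IsCanonical R)
    (hPt : IsDirecting P X Pt) :
    ∀ᵐ ω ∂P, (Pt ω).restrict (nullPart R) = ν.restrict (nullPart R) := by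
  have hZ := measurableSet_nullPart R
  have := hR.isFiniteKernel
  refine ae_measure_eq (Eventually.of_forall fun ω => inferInstance) fun A hA => ?_
  have hB := hA.inter hZ
  set B := A ∩ nullPart R with hBdef
  have hint : ∀ m : Measure 𝕏, IsFiniteMeasure m →
      ∫ x, (B.indicator (fun _ => (1 : ℝ)) x - ν.real B) ∂m = m.real B - ν.real B * m.real Set.univ :=
    fun m _ => by
      rw [integral_sub ((integrable_const _).indicator hB) (integrable_const _),
        integral_indicator hB, setIntegral_const, integral_const]
      simp [mul_comm]
  have h1 := h.ae_integral_eq_zero hR hPt (g := fun x => B.indicator (fun _ => (1 : ℝ)) x - ν.real B)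
    (C := 1) ((measurable_const.indicator hB).sub measurable_const) (fun x => by
      have h0 : 0 ≤ ν.real B := measureReal_nonneg
      have h1 : ν.real B ≤ 1 := measureReal_le_one
      by_cases hx : x ∈ B <;> simp only [hx, Set.indicator_of_mem, not_false_eq_true,
        Set.indicator_of_notMem] <;> rw [abs_le] <;> constructor <;> linarith)
    (by rw [hint ν inferInstance]; simp) (by
      filter_upwards [h.ae_apply_eq_of_subset hR hPt hB Set.inter_subset_right] with x hx
      rw [hint _ inferInstance]
      by_cases hxZ : x ∈ nullPart R
      · simp [eq_zero_of_mem_nullPart hxZ]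
      · simp [Measure.real, hx hxZ, hR x hxZ])
  filter_upwards [h1] with ω hω
  rw [hint _ inferInstance, probReal_univ, mul_one, sub_eq_zero] at hω
  rw [Measure.restrict_apply hA, Measure.restrict_apply hA]
  exact (measureReal_eq_measureReal_iff).1 hω

lemma IsMVPS.ae_bind_offNull (h : IsMVPS P X θ ν R) (hR : IsCanonical R)
    (hPt : IsDirecting P X Pt) (hc : ν (nullPart R)ᶜ ≠ 0) :
    ∀ᵐ ω ∂P, (Pt ω).restrict (nullPart R)ᶜ = (Pt ω).bind (offNull R) := by
  have hZ := measurableSet_nullPart R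
  have := hR.isFiniteKernel
  refine ae_measure_eq (Eventually.of_forall fun ω => inferInstance) fun A hA => ?_
  have hB := hA.inter hZ.compl
  set B := A ∩ (nullPart R)ᶜ with hBdef
  set φ : 𝕏 → ℝ≥0∞ := fun x => offNull R x A with hφ
  have mφ : Measurable φ := (offNull R).measurable_coe hA
  have φ1 : ∀ x, φ x ≤ 1 := fun x => offNull_apply_le_one x A
  have φt : ∀ x, φ x < ⊤ := fun x => (φ1 x).trans_lt ENNReal.one_lt_top
  have φr : ∀ x, (φ x).toReal ≤ 1 := fun x =>
    ENNReal.toReal_le_of_le_ofReal zero_le_one (by simpa using φ1 x)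
  have hint : ∀ m : Measure 𝕏, IsFiniteMeasure m →
      ∫ x, (B.indicator (fun _ => (1 : ℝ)) x - (φ x).toReal) ∂m =
        m.real B - (∫⁻ x, φ x ∂m).toReal := fun m _ => by
    rw [integral_sub ((integrable_const _).indicator hB) (Integrable.of_bound
        mφ.ennreal_toReal.aestronglyMeasurable 1 (Eventually.of_forall fun x => by
          rw [Real.norm_of_nonneg ENNReal.toReal_nonneg]; exact φr x)),
      integral_indicator hB, setIntegral_const,
      integral_toReal mφ.aemeasurable (Eventually.of_forall φt)]
    simp
  have hφfin : ∀ m : Measure 𝕏, IsFiniteMeasure m → ∫⁻ x, φ x ∂m ≠ ⊤ := fun m _ => by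
    refine ((lintegral_mono (g := fun _ => 1) φ1).trans_lt ?_).ne
    simp
  have h1 := h.ae_integral_eq_zero hR hPt
    (g := fun x => B.indicator (fun _ => (1 : ℝ)) x - (φ x).toReal)
    (C := 1) ((measurable_const.indicator hB).sub mφ.ennreal_toReal) (fun x => by
      have h0 : 0 ≤ (φ x).toReal := ENNReal.toReal_nonneg
      have h1 := φr x
      by_cases hx : x ∈ B <;> simp only [hx, Set.indicator_of_mem, not_false_eq_true,
        Set.indicator_of_notMem] <;> rw [abs_le] <;> constructor <;> linarith)
    (by
      rw [hint ν inferInstance, h.lintegral_offNull hR hPt hc hA, Measure.real, sub_self]) (by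
      filter_upwards [h.ae_isRegularPoint hR hPt hc, h.ae_offNull_idem hR hPt hc hA] with x hx hx'
      rw [hint _ inferInstance]
      by_cases hxZ : x ∈ nullPart R
      · simp [eq_zero_of_mem_nullPart hxZ]
      · have hr := hx hxZ
        have e1 : ∫⁻ y, φ y ∂(R x) = ν (nullPart R)ᶜ * φ x := by
          rw [hr.eq_add, lintegral_add_measure, lintegral_smul_measure, hx',
            setLIntegral_congr_fun hZ (g := fun _ => 0) fun y hy => by
              simp [hφ, offNull_eq_zero_of_mem hy]]
          simp [hφ]
        have e2 : R x B = ν (nullPart R)ᶜ * φ x := by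
          rw [hφ]
          simp only
          rw [offNull_apply, cond_apply hZ.compl, hr.apply_compl, ← mul_assoc,
            ENNReal.mul_inv_cancel hc (measure_ne_top _ _), one_mul, Set.inter_comm]
        rw [Measure.real, e1, e2, sub_self])
  filter_upwards [h1] with ω hω
  rw [hint _ inferInstance, sub_eq_zero] at hω
  rw [Measure.restrict_apply hA, Measure.bind_apply hA (offNull R).aemeasurable]
  exact (ENNReal.toReal_eq_toReal_iff' (measure_ne_top _ _) (hφfin _ inferInstance)).1 hω

/-- The properties shared by almost all realisations `μ` of the directing measure: `μ` agrees with
`ν` on `Z`, is invariant under the normalised reinforcement on `Zᶜ`, and is carried by regular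
points. -/
structure IsTypical (ν : Measure 𝕏) (R : Kernel 𝕏 𝕏) (μ : Measure 𝕏) : Prop where
  restrict_nullPart : μ.restrict (nullPart R) = ν.restrict (nullPart R)
  bind_offNull : μ.restrict (nullPart R)ᶜ = μ.bind (offNull R)
  ae_isRegularPoint : ∀ᵐ x ∂μ, x ∈ (nullPart R)ᶜ → IsRegularPoint ν R x

lemma IsMVPS.ae_isTypical (h : IsMVPS P X θ ν R) (hR : IsCanonical R)
    (hPt : IsDirecting P X Pt) (hc : ν (nullPart R)ᶜ ≠ 0) :
    ∀ᵐ ω ∂P, IsTypical ν R (Pt ω) := by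
  filter_upwards [h.ae_restrict_nullPart hR hPt, h.ae_bind_offNull hR hPt hc,
    hPt.ae_of_ae h (h.ae_isRegularPoint hR hPt hc)] with ω h1 h2 h3 using ⟨h1, h2, h3⟩

lemma IsRegularPoint.offNull_compl_fiber {x : 𝕏} (hx : IsRegularPoint ν R x) :
    offNull R x (fiber R x)ᶜ = 0 := ae_iff.1 hx.ae_mem_fiber

lemma fiber_subset_compl {x : 𝕏} (hx : x ∈ (nullPart R)ᶜ) : fiber R x ⊆ (nullPart R)ᶜ := by
  intro y hy hyZ
  refine hx ?_
  rw [nullPart, Set.mem_ofPred_eq, ← (show R y = R x from hy)]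
  exact hyZ

lemma offNull_congr {x y : 𝕏} (h : R y = R x) : offNull R y = offNull R x := by
  rw [offNull_apply, offNull_apply, h]

variable {μ : Measure 𝕏}

lemma IsTypical.apply_nullPart (hμ : IsTypical ν R μ) : μ (nullPart R) = ν (nullPart R) := by
  simpa using congrArg (fun m => m (nullPart R)) hμ.restrict_nullPart

lemma IsTypical.apply_compl [IsProbabilityMeasure μ] (hμ : IsTypical ν R μ) :
    μ (nullPart R)ᶜ = ν (nullPart R)ᶜ := by
  have hZ := measurableSet_nullPart R
  rw [prob_compl_eq_one_sub hZ, prob_compl_eq_one_sub hZ, hμ.apply_nullPart]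

/-- On each class the directing measure is proportional to the normalised reinforcement. -/
lemma IsTypical.apply_inter_fiber (hR : IsCanonical R) (hμ : IsTypical ν R μ) {a : 𝕏}
    (ha : a ∈ (nullPart R)ᶜ) {A : Set 𝕏} (hA : MeasurableSet A) :
    μ (A ∩ fiber R a) = offNull R a A * μ (fiber R a) := by
  have hF := measurableSet_fiber hR a
  have e1 : μ (A ∩ fiber R a) = ∫⁻ y, offNull R y (A ∩ fiber R a) ∂μ := by
    rw [← Measure.bind_apply (hA.inter hF) (offNull R).aemeasurable, ← hμ.bind_offNull,
      Measure.restrict_apply (hA.inter hF), Set.inter_eq_self_of_subset_left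
        (Set.inter_subset_right.trans (fiber_subset_compl ha))]
  rw [e1, ← setLIntegral_const, ← lintegral_indicator hF]
  refine lintegral_congr_ae ?_
  filter_upwards [hμ.ae_isRegularPoint] with y hy
  by_cases hya : y ∈ fiber R a
  · have hr := hy (fiber_subset_compl ha hya)
    have hf : fiber R y = fiber R a := by
      ext z; rw [fiber, fiber, Set.mem_ofPred_eq, Set.mem_ofPred_eq, (show R y = R a from hya)]
    rw [Set.indicator_of_mem hya, ← offNull_congr hya, ← hf]
    exact measure_inter_conull hr.offNull_compl_fiber
  · rw [Set.indicator_of_notMem hya]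
    by_cases hyZ : y ∈ nullPart R
    · simp [offNull_eq_zero_of_mem hyZ]
    · refine measure_mono_null (fun z hz => ?_) (hy hyZ).offNull_compl_fiber
      intro hzy
      exact hya ((show R z = R y from hzy).symm.trans hz.2)

end Concentration

/-! ### Convergence in total variation -/

section TotalVariation

/-- Probability measures that converge in total variation on each member of a countable cover
converge in total variation. -/
lemma tendsto_tvDist_of_cover {S : Type*} [MeasurableSpace S] {m : ℕ → Measure S} {μ : Measure S}
    [∀ n, IsProbabilityMeasure (m n)] [IsProbabilityMeasure μ] {B : ℕ → Set S}
    (hB : ∀ i, MeasurableSet (B i)) (hcov : μ (⋃ i, B i)ᶜ = 0)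
    (h : ∀ i, ∃ δ : ℕ → ℝ, Tendsto δ atTop (𝓝 0) ∧ ∀ᶠ n in atTop, ∀ A, MeasurableSet A →
      |(m n).real (A ∩ B i) - μ.real (A ∩ B i)| ≤ δ n) :
    Tendsto (fun n => tvDist (m n) μ) atTop (𝓝 0) := by
  set U : ℕ → Set S := fun k => ⋃ i ∈ Finset.range k, B i with hU
  have mU : ∀ k, MeasurableSet (U k) := fun k => Finset.measurableSet_biUnion _ fun i _ => hB i
  have hstep : ∀ k, ∃ δ : ℕ → ℝ, Tendsto δ atTop (𝓝 0) ∧ ∀ᶠ n in atTop, ∀ A, MeasurableSet A →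
      |(m n).real (A ∩ U k) - μ.real (A ∩ U k)| ≤ δ n := by
    intro k
    induction k with
    | zero => exact ⟨fun _ => 0, tendsto_const_nhds, Eventually.of_forall fun n A _ => by simp [hU]⟩
    | succ k ih =>
      obtain ⟨δ, hδ, hk⟩ := ih
      obtain ⟨ε, hε, hk'⟩ := h k
      refine ⟨fun n => δ n + ε n, by simpa using hδ.add hε, ?_⟩
      filter_upwards [hk, hk'] with n h1 h2 A hA
      have hs : ∀ ρ : Measure S, IsFiniteMeasure ρ → ρ.real (A ∩ U (k + 1)) =
          ρ.real (A ∩ U k) + ρ.real (A \ U k ∩ B k) := by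
        intro ρ _
        rw [← measureReal_union _ ((hA.diff (mU k)).inter (hB k))]
        · congr 1
          simp only [hU, Finset.range_add_one, Finset.set_biUnion_insert]
          ext x
          simp only [Set.mem_inter_iff, Set.mem_union, Set.mem_sdiff]
          tauto
        · rw [Set.disjoint_left]
          exact fun x hx hx' => hx'.1.2 hx.2
      rw [hs _ inferInstance, hs _ inferInstance, add_sub_add_comm]
      exact (abs_add_le _ _).trans (add_le_add (h1 A hA) (h2 _ (hA.diff (mU k))))
  have hmono : Monotone U := fun k l hkl => by
    refine Set.biUnion_subset_biUnion_left fun i hi => ?_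
    simp only [Finset.mem_coe, Finset.mem_range] at hi ⊢
    omega
  have hUk : Tendsto (fun k => μ.real (U k)ᶜ) atTop (𝓝 0) := by
    have h1 : Tendsto (fun k => μ (U k)ᶜ) atTop (𝓝 (μ (⋂ k, (U k)ᶜ))) :=
      tendsto_measure_iInter_atTop (fun k => (mU k).compl.nullMeasurableSet)
        (fun k l hkl => Set.compl_subset_compl.2 (hmono hkl)) ⟨0, measure_ne_top _ _⟩
    have h2 : (⋂ k, (U k)ᶜ) = (⋃ i, B i)ᶜ := by
      rw [← Set.compl_iUnion]
      congr 1
      ext x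
      simp only [hU, Set.mem_iUnion, Finset.mem_range]
      exact ⟨fun ⟨k, i, _, hx⟩ => ⟨i, hx⟩, fun ⟨i, hx⟩ => ⟨i + 1, i, Nat.lt_succ_self i, hx⟩⟩
    rw [h2, hcov] at h1
    exact (ENNReal.tendsto_toReal ENNReal.zero_ne_top).comp h1
  have htv0 : ∀ n, 0 ≤ tvDist (m n) μ := fun n => Real.iSup_nonneg fun A => abs_nonneg _
  rw [Metric.tendsto_atTop]
  intro ε hε
  obtain ⟨k, hk⟩ := (hUk.eventually (gt_mem_nhds (show (0 : ℝ) < ε / 6 by positivity))).exists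
  obtain ⟨δ, hδ, hn⟩ := hstep k
  obtain ⟨N, hN⟩ := eventually_atTop.1 (hn.and (hδ.eventually
    (gt_mem_nhds (show (0 : ℝ) < ε / 6 by positivity))))
  refine ⟨N, fun n hnN => ?_⟩
  obtain ⟨h1, h2⟩ := hN n hnN
  rw [Real.dist_eq, sub_zero, abs_of_nonneg (htv0 n)]
  refine lt_of_le_of_lt (Real.iSup_le (a := 4 * (ε / 6)) (fun A => ?_) (by positivity)) (by linarith)
  obtain ⟨A, hA⟩ := A
  have hd : ∀ ρ : Measure S, IsProbabilityMeasure ρ → |ρ.real A - ρ.real (A ∩ U k)| ≤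
      1 - ρ.real (U k) := by
    intro ρ _
    have e1 : ρ.real A - ρ.real (A ∩ U k) = ρ.real (A \ U k) := by
      rw [← measureReal_inter_add_sdiff (s := A) (mU k)]; ring
    rw [e1, abs_of_nonneg measureReal_nonneg, ← probReal_compl_eq_one_sub (mU k)]
    exact measureReal_mono fun x hx => hx.2
  have a1 := hd (m n) inferInstance
  have a2 := hd μ inferInstance
  have a3 := h1 A hA
  have a4 := h1 Set.univ MeasurableSet.univ
  rw [Set.univ_inter] at a4
  rw [probReal_compl_eq_one_sub (mU k)] at hk
  simp only
  rw [abs_le] at *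
  constructor <;> linarith [a1.1, a1.2, a2.1, a2.2, a3.1, a3.2, a4.1, a4.2]

/-- Strong law of large numbers for the frequencies of a set in an i.i.d. sequence. -/
lemma ae_tendsto_frequency {S : Type*} [MeasurableSpace S] (μ : Measure S) [IsProbabilityMeasure μ]
    {A : Set S} (hA : MeasurableSet A) :
    ∀ᵐ y ∂(Measure.infinitePi fun _ : ℕ => μ),
      Tendsto (fun n : ℕ => (∑ j ∈ Finset.range n, A.indicator (fun _ => (1 : ℝ)) (y j)) / n) atTop
        (𝓝 (μ.real A)) := by
  have hm : Measurable (A.indicator fun _ => (1 : ℝ)) := measurable_const.indicator hA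
  have hint : Integrable (A.indicator fun _ => (1 : ℝ)) μ := (integrable_const 1).indicator hA
  have hmap : ∀ i : ℕ, (Measure.infinitePi fun _ : ℕ => μ).map (fun y => y i) = μ :=
    fun i => Measure.infinitePi_map_eval _ i
  have hlaw := strong_law_ae_real (μ := Measure.infinitePi fun _ : ℕ => μ)
    (fun i (y : ℕ → S) => A.indicator (fun _ => (1 : ℝ)) (y i))
    (by
      refine Integrable.comp_measurable (g := A.indicator fun _ => (1 : ℝ))
        (f := fun y : ℕ → S => y 0) ?_ (measurable_pi_apply 0)
      rw [hmap]; exact hint)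
    (fun i j hij => (iIndepFun_infinitePi (P := fun _ : ℕ => μ)
      (X := fun _ => A.indicator fun _ => (1 : ℝ)) fun _ => hm).indepFun hij)
    (fun i => ⟨(hm.comp (measurable_pi_apply i)).aemeasurable,
      (hm.comp (measurable_pi_apply 0)).aemeasurable, by
        have : ∀ i : ℕ, (Measure.infinitePi fun _ : ℕ => μ).map
            (fun y => A.indicator (fun _ => (1 : ℝ)) (y i)) = μ.map (A.indicator fun _ => (1 : ℝ)) := by
          intro i
          conv_rhs => rw [← hmap i, Measure.map_map hm (measurable_pi_apply i)]
          rfl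
        rw [this, this]⟩)
  have hval : ∫ y : ℕ → S, A.indicator (fun _ => (1 : ℝ)) (y 0) ∂(Measure.infinitePi fun _ : ℕ => μ) =
      μ.real A := by
    rw [← integral_map (measurable_pi_apply 0).aemeasurable hm.aestronglyMeasurable, hmap,
      integral_indicator hA]
    simp
  rw [hval] at hlaw
  exact hlaw

lemma tendsto_average_of_shift {f : ℕ → ℝ} {l : ℝ} (m : ℕ)
    (h : Tendsto (fun n : ℕ => (∑ j ∈ Finset.range n, f (m + j)) / n) atTop (𝓝 l)) :
    Tendsto (fun n : ℕ => (∑ j ∈ Finset.range n, f j) / n) atTop (𝓝 l) := by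
  rw [← tendsto_add_atTop_iff_nat m]
  have h1 : Tendsto (fun n : ℕ => (∑ j ∈ Finset.range m, f j) / ((n + m : ℕ) : ℝ) +
      (∑ j ∈ Finset.range n, f (m + j)) / n * ((n : ℝ) / (n + m : ℕ))) atTop (𝓝 (0 + l * 1)) := by
    refine Tendsto.add ?_ (h.mul ?_)
    · exact Tendsto.div_atTop tendsto_const_nhds
        (tendsto_natCast_atTop_atTop.comp (tendsto_add_atTop_nat m))
    · have := tendsto_natCast_div_add_atTop (𝕜 := ℝ) (m : ℝ)
      simpa using this
  rw [zero_add, mul_one] at h1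
  refine h1.congr' ?_
  filter_upwards [eventually_gt_atTop 0] with n hn
  have hn' : (n : ℝ) ≠ 0 := by positivity
  have hnm : ((n + m : ℕ) : ℝ) ≠ 0 := by positivity
  rw [add_comm n m, Finset.sum_range_add]
  rw [add_comm n m] at hnm
  field_simp

variable {Ω : Type*} [MeasurableSpace Ω] {P : Measure Ω} [IsProbabilityMeasure P]
  {𝕏 : Type*} [MeasurableSpace 𝕏] [StandardBorelSpace 𝕏] [Nonempty 𝕏]
  {X : ℕ → Ω → 𝕏} {θ : ℝ} {ν : Measure 𝕏} [IsProbabilityMeasure ν] {R : Kernel 𝕏 𝕏}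
  {Pt : Kernel Ω 𝕏} [IsMarkovKernel Pt]

/-- If, for fixed initial terms `x`, the set `B x` is fixed, its frequency in the sequence converges
to its mass under the directing measure. -/
lemma IsDirecting.ae_tendsto_frequency (hPt : IsDirecting P X Pt) (hX : ∀ n, Measurable (X n))
    (m : ℕ) {B : (Fin m → 𝕏) → Set 𝕏} (hB : MeasurableSet {p : (Fin m → 𝕏) × 𝕏 | p.2 ∈ B p.1}) :
    ∀ᵐ ω ∂P, Tendsto (fun n : ℕ => (∑ j ∈ Finset.range n,
      (B fun i => X i ω).indicator (fun _ => (1 : ℝ)) (X j ω)) / n) atTop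
        (𝓝 ((Pt ω).real (B fun i => X i ω))) := by
  have hsh := (hPt.isMixedIID hX).shift m
  have hBx : ∀ x, MeasurableSet (B x) := fun x => measurable_prodMk_left hB
  have hmeas : MeasurableSet {q : (Measure 𝕏 × (Fin m → 𝕏)) × (ℕ → 𝕏) |
      Tendsto (fun n : ℕ => (∑ j ∈ Finset.range n,
        (B q.1.2).indicator (fun _ => (1 : ℝ)) (q.2 j)) / n) atTop
        (𝓝 ((probKernel 𝕏 q.1.1).real (B q.1.2)))} := by
    refine measurableSet_tendsto_fun (fun n => ?_) ?_
    · refine Measurable.div_const (Finset.measurable_fun_sum _ fun j _ => ?_) _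
      have h1 : Measurable ({p : (Fin m → 𝕏) × 𝕏 | p.2 ∈ B p.1}.indicator fun _ => (1 : ℝ)) :=
        measurable_const.indicator hB
      exact h1.comp (f := fun q : (Measure 𝕏 × (Fin m → 𝕏)) × (ℕ → 𝕏) => (q.1.2, q.2 j))
        (by fun_prop)
    · refine Measurable.ennreal_toReal ?_
      have h1 := Kernel.measurable_kernel_prodMk_left
        (κ := (probKernel 𝕏).comap (Prod.fst : Measure 𝕏 × (Fin m → 𝕏) → Measure 𝕏) measurable_fst)
        (t := {r | r.2 ∈ B r.1.2})
        (hB.preimage (f := fun r : (Measure 𝕏 × (Fin m → 𝕏)) × 𝕏 => (r.1.2, r.2)) (by fun_prop))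
      exact h1.comp (f := fun q : (Measure 𝕏 × (Fin m → 𝕏)) × (ℕ → 𝕏) => q.1) measurable_fst
  have := hsh.ae hmeas (Eventually.of_forall fun ω => by
    simpa using MVPS.ae_tendsto_frequency (probKernel 𝕏 (Pt ω)) (hBx fun i => X i ω))
  filter_upwards [this] with ω hω
  refine tendsto_average_of_shift m ?_
  simpa [probKernel_apply] using hω

/-- The next term falls in a set depending on the past with probability the expected mass of this
set under the directing measure. -/
lemma IsDirecting.lintegral_apply_past (hPt : IsDirecting P X Pt) (hX : ∀ n, Measurable (X n))
    (m : ℕ) {B : (Fin m → 𝕏) → Set 𝕏} (hB : MeasurableSet {p : (Fin m → 𝕏) × 𝕏 | p.2 ∈ B p.1}) :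
    ∫⁻ ω, (B fun i => X i ω).indicator 1 (X m ω) ∂P = ∫⁻ ω, Pt ω (B fun i => X i ω) ∂P := by
  have hsh := (hPt.isMixedIID hX).shift m
  have hBx : ∀ x, MeasurableSet (B x) := fun x => measurable_prodMk_left hB
  have hF : Measurable fun q : (Measure 𝕏 × (Fin m → 𝕏)) × (ℕ → 𝕏) =>
      (B q.1.2).indicator (1 : 𝕏 → ℝ≥0∞) (q.2 0) := by
    have h1 : Measurable ({p : (Fin m → 𝕏) × 𝕏 | p.2 ∈ B p.1}.indicator
        (1 : (Fin m → 𝕏) × 𝕏 → ℝ≥0∞)) :=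
      measurable_one.indicator hB
    exact h1.comp (f := fun q : (Measure 𝕏 × (Fin m → 𝕏)) × (ℕ → 𝕏) => (q.1.2, q.2 0))
      (by fun_prop)
  have h1 := hsh.lintegral hF
  simp only [add_zero] at h1
  rw [h1]
  refine lintegral_congr fun ω => ?_
  have hm : Measurable ((B fun i => X i ω).indicator (1 : 𝕏 → ℝ≥0∞)) :=
    measurable_one.indicator (hBx _)
  rw [← lintegral_map (f := (B fun i => X i ω).indicator (1 : 𝕏 → ℝ≥0∞)) hm
    (measurable_pi_apply 0), Measure.infinitePi_map_eval, lintegral_indicator_one (hBx _)]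
  simp [probKernel_apply]

end TotalVariation

section Predictive

variable {Ω : Type*} [MeasurableSpace Ω] {P : Measure Ω} [IsProbabilityMeasure P]
  {𝕏 : Type*} [MeasurableSpace 𝕏] [StandardBorelSpace 𝕏] [Nonempty 𝕏]
  {X : ℕ → Ω → 𝕏} {θ : ℝ} {ν : Measure 𝕏} [IsProbabilityMeasure ν] {R : Kernel 𝕏 𝕏}
  {Pt : Kernel Ω 𝕏} [IsMarkovKernel Pt]

/-- Every term of the sequence has law `ν`, hence avoids `ν`-null sets. -/
lemma IsDirecting.ae_of_ae_apply (hPt : IsDirecting P X Pt) (h : IsMVPS P X θ ν R) {p : 𝕏 → Prop}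
    (hp : ∀ᵐ x ∂ν, p x) : ∀ᵐ ω ∂P, ∀ i, p (X i ω) := by
  rw [ae_all_iff]
  intro i
  obtain ⟨t, ht, htm, ht0⟩ := exists_measurable_superset_of_null (ae_iff.1 hp)
  have h1 := hPt.lintegral_apply_past h.measurable i (B := fun _ => t) (htm.preimage measurable_snd)
  rw [hPt.lintegral_apply h htm, ht0] at h1
  replace h1 := (lintegral_eq_zero_iff ((measurable_one.indicator htm).comp (h.measurable i))).1 h1
  filter_upwards [h1] with ω hω
  by_contra hn
  have : X i ω ∈ t := ht hn
  simp [this] at hω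

lemma IsRegularPoint.apply_subset_nullPart {x : 𝕏} (hx : IsRegularPoint ν R x) {A : Set 𝕏}
    (hA : MeasurableSet A) (hAZ : A ⊆ nullPart R) : R x A = ν A := by
  have h0 : offNull R x A = 0 := measure_mono_null hAZ (offNull_apply_nullPart x)
  rw [hx.eq_add, Measure.add_apply, Measure.smul_apply, h0, Measure.restrict_apply hA,
    Set.inter_eq_self_of_subset_left hAZ]
  simp

lemma IsRegularPoint.apply_subset_compl {x : 𝕏} (hx : IsRegularPoint ν R x) {A : Set 𝕏}
    (hA : MeasurableSet A) (hAZ : A ⊆ (nullPart R)ᶜ) :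
    R x A = ν (nullPart R)ᶜ * offNull R x A := by
  rw [hx.eq_add, Measure.add_apply, Measure.smul_apply, Measure.restrict_apply hA,
    Set.disjoint_iff_inter_eq_empty.1 (Set.disjoint_left.2 fun a ha => hAZ ha)]
  simp

/-- A regular reinforcement does not charge sets disjoint from `Z` and from its class. -/
lemma IsRegularPoint.apply_eq_zero {x : 𝕏} (hx : IsRegularPoint ν R x) {A : Set 𝕏}
    (hA : MeasurableSet A) (hAZ : A ⊆ (nullPart R)ᶜ) (hAF : Disjoint A (fiber R x)) :
    R x A = 0 := by
  rw [hx.apply_subset_compl hA hAZ,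
    measure_mono_null (fun a ha => Set.disjoint_left.1 hAF ha) hx.offNull_compl_fiber, mul_zero]

lemma measurableSet_uncovered (hR : IsCanonical R) (m : ℕ) :
    MeasurableSet {p : (Fin m → 𝕏) × 𝕏 |
      p.2 ∈ {z | z ∈ (nullPart R)ᶜ ∧ ∀ i, z ∉ fiber R (p.1 i)}} := by
  have h1 : MeasurableSet {p : (Fin m → 𝕏) × 𝕏 | p.2 ∈ (nullPart R)ᶜ} :=
    (measurableSet_nullPart R).compl.preimage measurable_snd
  have h2 : ∀ i : Fin m, MeasurableSet {p : (Fin m → 𝕏) × 𝕏 | p.2 ∉ fiber R (p.1 i)} := fun i =>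
    ((measurableSet_fiber_prod hR).preimage
      (f := fun p : (Fin m → 𝕏) × 𝕏 => (p.1 i, p.2)) (by fun_prop)).compl
  convert h1.inter (MeasurableSet.iInter h2) using 1
  ext p
  simp

lemma sum_apply_univ (hR : IsCanonical R) (n : ℕ) (ω : Ω) :
    ∑ i ∈ Finset.range n, R (X i ω) Set.univ =
      ENNReal.ofReal (∑ i ∈ Finset.range n,
        (nullPart R)ᶜ.indicator (fun _ => (1 : ℝ)) (X i ω)) := by
  rw [ENNReal.ofReal_sum_of_nonneg fun i _ => Set.indicator_nonneg (fun _ _ => zero_le_one) _]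
  refine Finset.sum_congr rfl fun i _ => ?_
  by_cases hx : X i ω ∈ nullPart R
  · simp [eq_zero_of_mem_nullPart hx, hx]
  · rw [hR _ hx, Set.indicator_of_mem (show X i ω ∈ (nullPart R)ᶜ from hx)]; simp

/-- Almost surely `Zᶜ` is visited with frequency `ν(Zᶜ)`. -/
lemma IsMVPS.ae_tendsto_frequency_compl (h : IsMVPS P X θ ν R) (hR : IsCanonical R)
    (hPt : IsDirecting P X Pt) :
    ∀ᵐ ω ∂P, Tendsto (fun n : ℕ => (∑ j ∈ Finset.range n,
      (nullPart R)ᶜ.indicator (fun _ => (1 : ℝ)) (X j ω)) / n) atTop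
        (𝓝 (ν.real (nullPart R)ᶜ)) := by
  have hZ := measurableSet_nullPart R
  filter_upwards [hPt.ae_tendsto_frequency h.measurable 0 (B := fun _ => (nullPart R)ᶜ)
    (hZ.compl.preimage measurable_snd), h.ae_restrict_nullPart hR hPt] with ω h1 h2
  have : (Pt ω) (nullPart R) = ν (nullPart R) := by
    simpa using congrArg (fun m => m (nullPart R)) h2
  rwa [probReal_compl_eq_one_sub hZ, Measure.real, this, ← Measure.real,
    ← probReal_compl_eq_one_sub hZ] at h1

lemma tendsto_atTop_of_tendsto_average {f : ℕ → ℝ} {l : ℝ} (hl : 0 < l)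
    (h : Tendsto (fun n : ℕ => f n / n) atTop (𝓝 l)) : Tendsto f atTop atTop := by
  refine (h.pos_mul_atTop hl tendsto_natCast_atTop_atTop).congr' ?_
  filter_upwards [eventually_gt_atTop 0] with n hn
  have : (n : ℝ) ≠ 0 := by positivity
  field_simp

/-- A new class appears at time `m` with conditional probability at most
`θ / (θ + #{i < m | X i ∈ Zᶜ})`; so almost surely the directing measure does not charge the
complement of the classes that appear. -/
lemma IsMVPS.ae_uncovered (h : IsMVPS P X θ ν R) (hR : IsCanonical R)
    (hPt : IsDirecting P X Pt) (hc : ν (nullPart R)ᶜ ≠ 0) :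
    ∀ᵐ ω ∂P, Pt ω {z | z ∈ (nullPart R)ᶜ ∧ ∀ i, z ∉ fiber R (X i ω)} = 0 := by
  have hZ := measurableSet_nullPart R
  set V : (m : ℕ) → (Fin m → 𝕏) → Set 𝕏 :=
    fun m x => {z | z ∈ (nullPart R)ᶜ ∧ ∀ i, z ∉ fiber R (x i)} with hV
  have mV : ∀ m, MeasurableSet {p : (Fin m → 𝕏) × 𝕏 | p.2 ∈ V m p.1} := measurableSet_uncovered hR
  have mVx : ∀ m x, MeasurableSet (V m x) := fun m x => measurable_prodMk_left (mV m)
  have hreg := hPt.ae_of_ae_apply h (h.ae_isRegularPoint hR hPt hc)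
  set N : ℕ → Ω → ℝ := fun n ω => ∑ j ∈ Finset.range n,
      (nullPart R)ᶜ.indicator (fun _ => (1 : ℝ)) (X j ω) with hN
  have hN0 : ∀ n ω, 0 ≤ N n ω := fun n ω =>
    Finset.sum_nonneg fun i _ => Set.indicator_nonneg (fun _ _ => zero_le_one) _
  have hNm : ∀ n, Measurable (N n) := fun n => Finset.measurable_fun_sum _ fun i _ =>
    (measurable_const.indicator hZ.compl).comp (h.measurable i)
  have hθ := h.theta_pos
  -- the conditional probability of a new class
  have hle : ∀ m, 1 ≤ m → ∫⁻ ω, Pt ω (V m fun i => X i ω) ∂P ≤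
      ∫⁻ ω, ENNReal.ofReal (θ / (θ + N m ω)) ∂P := by
    intro m hm
    have hF : Measurable fun p : (Fin m → 𝕏) × 𝕏 => (V m p.1).indicator (1 : 𝕏 → ℝ≥0∞) p.2 := by
      have h1 : Measurable ({p : (Fin m → 𝕏) × 𝕏 | p.2 ∈ V m p.1}.indicator
        (1 : (Fin m → 𝕏) × 𝕏 → ℝ≥0∞)) := measurable_one.indicator (mV m)
      exact h1
    rw [← hPt.lintegral_apply_past h.measurable m (mV m), h.lintegral_predictive hm hF]
    refine lintegral_mono_ae ?_
    filter_upwards [hreg] with ω hω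
    simp only [lintegral_indicator_one (mVx _ _)]
    have h0 : ∀ i ∈ Finset.range m, R (X i ω) (V m fun i => X i ω) = 0 := by
      intro i hi
      by_cases hxZ : X i ω ∈ nullPart R
      · simp [eq_zero_of_mem_nullPart hxZ]
      · refine (hω i hxZ).apply_eq_zero (mVx _ _) (fun z hz => hz.1) ?_
        rw [Set.disjoint_left]
        exact fun z hz => hz.2 ⟨i, Finset.mem_range.1 hi⟩
    rw [Finset.sum_eq_zero h0, add_zero, sum_apply_univ hR, ← ENNReal.ofReal_add hθ.le (hN0 m ω),
      div_eq_mul_inv, mul_comm θ, ENNReal.ofReal_mul (inv_nonneg.2 (add_nonneg hθ.le (hN0 m ω))),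
      ENNReal.ofReal_inv_of_pos (add_pos_of_pos_of_nonneg hθ (hN0 m ω))]
    gcongr
    exact mul_le_of_le_one_right' prob_le_one
  have hlim : Tendsto (fun m => ∫⁻ ω, ENNReal.ofReal (θ / (θ + N m ω)) ∂P) atTop (𝓝 0) := by
    have := tendsto_lintegral_of_dominated_convergence (μ := P)
      (F := fun m ω => ENNReal.ofReal (θ / (θ + N m ω))) (f := fun _ => 0) (fun _ => 1)
      (fun m => (measurable_const.div (measurable_const.add (hNm m))).ennreal_ofReal)
      (fun m => Eventually.of_forall fun ω => by
        rw [← ENNReal.ofReal_one]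
        refine ENNReal.ofReal_le_ofReal ((div_le_one ?_).2 ?_)
        · linarith [hN0 m ω]
        · linarith [hN0 m ω]) (by simp) (by
        filter_upwards [h.ae_tendsto_frequency_compl hR hPt] with ω hω
        have hc' : 0 < ν.real (nullPart R)ᶜ :=
          ENNReal.toReal_pos hc (measure_ne_top _ _)
        have h1 := tendsto_atTop_of_tendsto_average hc' hω
        have h2 : Tendsto (fun m => θ / (θ + N m ω)) atTop (𝓝 0) :=
          Tendsto.div_atTop tendsto_const_nhds (tendsto_atTop_add_const_left _ _ h1)
        simpa using ENNReal.tendsto_ofReal h2)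
    simpa using this
  set W : Ω → Set 𝕏 := fun ω => {z | z ∈ (nullPart R)ᶜ ∧ ∀ i, z ∉ fiber R (X i ω)} with hW
  have hWV : ∀ m ω, W ω ⊆ V m fun i => X i ω := fun m ω z hz => ⟨hz.1, fun i => hz.2 i⟩
  have mW : Measurable fun ω => Pt ω (W ω) := by
    have h2 : MeasurableSet {p : Ω × 𝕏 | p.2 ∈ W p.1} := by
      have h3 : ∀ i, MeasurableSet {p : Ω × 𝕏 | p.2 ∉ fiber R (X i p.1)} := fun i =>
        ((measurableSet_fiber_prod hR).preimage (f := fun p : Ω × 𝕏 => (X i p.1, p.2))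
          (((h.measurable i).comp measurable_fst).prodMk measurable_snd)).compl
      convert (hZ.compl.preimage (measurable_snd : Measurable (Prod.snd : Ω × 𝕏 → 𝕏))).inter
        (MeasurableSet.iInter h3) using 1
      ext p
      simp [hW]
    exact Kernel.measurable_kernel_prodMk_left (κ := Pt) h2
  have hzero : ∫⁻ ω, Pt ω (W ω) ∂P = 0 := by
    refine le_antisymm (ge_of_tendsto hlim ?_) zero_le
    filter_upwards [eventually_ge_atTop 1] with m hm
    exact (lintegral_mono fun ω => measure_mono (hWV m ω)).trans (hle m hm)
  rw [lintegral_eq_zero_iff mW] at hzero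
  exact hzero

/-- The predictive distributions converge to the directing measure in total variation. On `Z` they
agree, and on the class of each term `a` of the sequence both are proportional to the normalised
reinforcement at `a`, with factors that converge by the strong law of large numbers. -/
theorem IsMVPS.ae_tendsto_tvDist (h : IsMVPS P X θ ν R) (hR : IsCanonical R)
    (hPt : IsDirecting P X Pt) (hc : ν (nullPart R)ᶜ ≠ 0) :
    ∀ᵐ ω ∂P, Tendsto (fun n => tvDist (predDist P X n ω) (Pt ω)) atTop (𝓝 0) := by
  have hZ := measurableSet_nullPart R
  have := hR.isFiniteKernel
  have hθ := h.theta_pos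
  have hc' : 0 < ν.real (nullPart R)ᶜ := ENNReal.toReal_pos hc (measure_ne_top _ _)
  have hfreq : ∀ᵐ ω ∂P, ∀ i, Tendsto (fun n : ℕ => (∑ j ∈ Finset.range n,
      (fiber R (X i ω)).indicator (fun _ => (1 : ℝ)) (X j ω)) / n) atTop
        (𝓝 ((Pt ω).real (fiber R (X i ω)))) := by
    rw [ae_all_iff]
    intro i
    exact hPt.ae_tendsto_frequency h.measurable (i + 1) (B := fun x => fiber R (x (Fin.last i)))
      ((measurableSet_fiber_prod hR).preimage
        (f := fun p : (Fin (i + 1) → 𝕏) × 𝕏 => (p.1 (Fin.last i), p.2)) (by fun_prop))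
  have hpred : ∀ᵐ ω ∂P, ∀ n, 1 ≤ n → predDist P X n ω =
      (ENNReal.ofReal θ + ∑ i ∈ Finset.range n, R (X i ω) Set.univ)⁻¹ •
        (ENNReal.ofReal θ • ν + ∑ i ∈ Finset.range n, R (X i ω)) := by
    rw [ae_all_iff]
    intro n
    by_cases hn : 1 ≤ n
    · filter_upwards [h.predictive n hn] with ω hω _ using hω
    · exact Eventually.of_forall fun ω hn' => absurd hn' hn
  filter_upwards [hfreq, hpred, h.ae_isTypical hR hPt hc, h.ae_uncovered hR hPt hc,
    hPt.ae_of_ae_apply h (h.ae_isRegularPoint hR hPt hc), h.ae_tendsto_frequency_compl hR hPt]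
    with ω hfreq hpred htyp hunc hreg hN
  have hprob : ∀ n, IsProbabilityMeasure (predDist P X n ω) := fun n => by
    unfold predDist; infer_instance
  set N : ℕ → ℝ := fun n => ∑ j ∈ Finset.range n,
      (nullPart R)ᶜ.indicator (fun _ => (1 : ℝ)) (X j ω) with hNdef
  have hN0 : ∀ n, 0 ≤ N n := fun n =>
    Finset.sum_nonneg fun i _ => Set.indicator_nonneg (fun _ _ => zero_le_one) _
  have hNpos : ∀ n, 0 < θ + N n := fun n => by linarith [hN0 n]
  have hNtop : Tendsto (fun n => θ + N n) atTop atTop :=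
    tendsto_atTop_add_const_left _ _ (tendsto_atTop_of_tendsto_average hc' hN)
  have hreal : ∀ n, 1 ≤ n → ∀ A, (predDist P X n ω).real A =
      (θ + N n)⁻¹ * (θ * ν.real A + ∑ i ∈ Finset.range n, (R (X i ω)).real A) := by
    intro n hn A
    rw [Measure.real, hpred n hn, sum_apply_univ hR, ← ENNReal.ofReal_add hθ.le (hN0 n)]
    simp only [Measure.smul_apply, Measure.add_apply, Measure.finsetSum_apply, smul_eq_mul,
      ENNReal.toReal_mul, ENNReal.toReal_inv, ENNReal.toReal_ofReal (hNpos n).le]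
    rw [ENNReal.toReal_add (by finiteness) (ENNReal.sum_ne_top.2 fun i _ => measure_ne_top _ _),
      ENNReal.toReal_mul, ENNReal.toReal_ofReal hθ.le,
      ENNReal.toReal_sum fun i _ => measure_ne_top _ _]
    rfl
  have hnull : ∀ n, 1 ≤ n → ∀ A, MeasurableSet A → A ⊆ nullPart R →
      (predDist P X n ω).real A = (Pt ω).real A := by
    intro n hn A hA hAZ
    have e1 : (Pt ω).real A = ν.real A := by
      have := congrArg (fun m => m.real A) htyp.restrict_nullPart
      simpa [measureReal_restrict_apply hA, Set.inter_eq_self_of_subset_left hAZ] using this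
    have e2 : ∀ i, (R (X i ω)).real A =
        (nullPart R)ᶜ.indicator (fun _ => (1 : ℝ)) (X i ω) * ν.real A := by
      intro i
      by_cases hx : X i ω ∈ nullPart R
      · simp [eq_zero_of_mem_nullPart hx, hx]
      · rw [Measure.real, (hreg i hx).apply_subset_nullPart hA hAZ,
          Set.indicator_of_mem (show X i ω ∈ (nullPart R)ᶜ from hx), one_mul, Measure.real]
    rw [hreal n hn, e1]
    simp_rw [e2]
    rw [← Finset.sum_mul, ← add_mul, ← mul_assoc, inv_mul_cancel₀ (hNpos n).ne', one_mul]
  refine tendsto_tvDist_of_cover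
    (B := fun i => Nat.casesOn i (nullPart R) fun i => fiber R (X i ω)) (fun i => ?_) ?_ fun i => ?_
  · cases i with
    | zero => exact hZ
    | succ i => exact measurableSet_fiber hR _
  · refine measure_mono_null (fun z hz => ?_) hunc
    simp only [Set.mem_compl_iff, Set.mem_iUnion, not_exists] at hz
    exact ⟨hz 0, fun i => hz (i + 1)⟩
  · have hzero : ∀ B, MeasurableSet B → B ⊆ nullPart R → ∃ δ : ℕ → ℝ, Tendsto δ atTop (𝓝 0) ∧
        ∀ᶠ n in atTop, ∀ A, MeasurableSet A →
          |(predDist P X n ω).real (A ∩ B) - (Pt ω).real (A ∩ B)| ≤ δ n := by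
      intro B hB hBZ
      refine ⟨fun _ => 0, tendsto_const_nhds, ?_⟩
      filter_upwards [eventually_ge_atTop 1] with n hn A hA
      rw [hnull n hn _ (hA.inter hB) (Set.inter_subset_right.trans hBZ), sub_self, abs_zero]
    cases i with
    | zero => exact hzero _ hZ le_rfl
    | succ i =>
      have hF := measurableSet_fiber hR (X i ω)
      by_cases ha : X i ω ∈ nullPart R
      · refine hzero _ hF fun y hy => ?_
        change R y Set.univ = 0
        rw [show R y = R (X i ω) from hy]
        exact ha
      · set a := X i ω with hadef
        set k : ℕ → ℝ := fun n => ∑ j ∈ Finset.range n,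
          (fiber R a).indicator (fun _ => (1 : ℝ)) (X j ω) with hk
        set c := ν.real (nullPart R)ᶜ with hcdef
        refine ⟨fun n => θ / (θ + N n) + |c * k n / (θ + N n) - (Pt ω).real (fiber R a)|, ?_, ?_⟩
        · have h1 : Tendsto (fun n => θ / (θ + N n)) atTop (𝓝 0) :=
            Tendsto.div_atTop tendsto_const_nhds hNtop
          have h2 : Tendsto (fun n : ℕ => c * (k n / n) / (θ / n + N n / n)) atTop
              (𝓝 (c * (Pt ω).real (fiber R a) / (0 + c))) :=
            ((hfreq i).const_mul c).div
              ((tendsto_const_nhds.div_atTop tendsto_natCast_atTop_atTop).add hN)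
              (by rw [zero_add]; exact hc'.ne')
          have h3 : Tendsto (fun n : ℕ => c * k n / (θ + N n)) atTop
              (𝓝 ((Pt ω).real (fiber R a))) := by
            rw [zero_add, mul_div_cancel_left₀ _ hc'.ne'] at h2
            refine h2.congr' ?_
            filter_upwards [eventually_gt_atTop 0] with n hn
            have hn' : (n : ℝ) ≠ 0 := by positivity
            have := (hNpos n).ne'
            field_simp
          have h4 := h1.add (h3.sub_const ((Pt ω).real (fiber R a))).abs
          simpa using h4
        · filter_upwards [eventually_ge_atTop 1] with n hn A hA
          have hAF := hA.inter hF
          have hsub : A ∩ fiber R a ⊆ (nullPart R)ᶜ :=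
            Set.inter_subset_right.trans (fiber_subset_compl ha)
          have e1 : (Pt ω).real (A ∩ fiber R a) =
              (offNull R a).real A * (Pt ω).real (fiber R a) := by
            rw [Measure.real, htyp.apply_inter_fiber hR ha hA, ENNReal.toReal_mul]; rfl
          have e2 : ∀ j, (R (X j ω)).real (A ∩ fiber R a) =
              (fiber R a).indicator (fun _ => (1 : ℝ)) (X j ω) * (c * (offNull R a).real A) := by
            intro j
            by_cases hj : X j ω ∈ fiber R a
            · rw [Set.indicator_of_mem hj, one_mul, Measure.real, show R (X j ω) = R a from hj,
                (hreg i ha).apply_subset_compl hAF hsub,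
                measure_inter_conull (hreg i ha).offNull_compl_fiber, ENNReal.toReal_mul]
              rfl
            · rw [Set.indicator_of_notMem hj, zero_mul]
              by_cases hjZ : X j ω ∈ nullPart R
              · simp [eq_zero_of_mem_nullPart hjZ]
              · rw [Measure.real, (hreg j hjZ).apply_eq_zero hAF hsub, ENNReal.toReal_zero]
                rw [Set.disjoint_left]
                exact fun z hz hz' => hj ((show R z = R (X j ω) from hz').symm.trans hz.2)
          have hb0 : 0 ≤ (offNull R a).real A := measureReal_nonneg
          have hb1 : (offNull R a).real A ≤ 1 :=
            ENNReal.toReal_le_of_le_ofReal zero_le_one (by simpa using offNull_apply_le_one a A)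
          change |(predDist P X n ω).real (A ∩ fiber R a) - (Pt ω).real (A ∩ fiber R a)| ≤ _
          rw [hreal n hn, e1, Finset.sum_congr rfl fun j _ => e2 j, ← Finset.sum_mul]
          have e3 : (θ + N n)⁻¹ * (θ * ν.real (A ∩ fiber R a) +
              (∑ j ∈ Finset.range n, (fiber R a).indicator (fun _ => (1 : ℝ)) (X j ω)) *
                (c * (offNull R a).real A)) - (offNull R a).real A * (Pt ω).real (fiber R a) =
              θ / (θ + N n) * ν.real (A ∩ fiber R a) +
                (offNull R a).real A * (c * k n / (θ + N n) - (Pt ω).real (fiber R a)) := by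
            rw [hk]; ring
          rw [e3]
          refine (abs_add_le _ _).trans (add_le_add ?_ ?_)
          · have hq : 0 ≤ θ / (θ + N n) := (div_pos hθ (hNpos n)).le
            rw [abs_of_nonneg (mul_nonneg hq measureReal_nonneg)]
            exact mul_le_of_le_one_right hq measureReal_le_one
          · rw [abs_mul, abs_of_nonneg hb0]
            exact mul_le_of_le_one_left (abs_nonneg _) hb1

end Predictive

/-! ### Recursions for moments -/

section Recursion

/-- The rising factorial `θ (θ + 1) ⋯ (θ + n - 1)`. -/
def risingFactorial (θ : ℝ) (n : ℕ) : ℝ := ∏ i ∈ Finset.range n, (θ + i)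

lemma risingFactorial_zero (θ : ℝ) : risingFactorial θ 0 = 1 := by simp [risingFactorial]

lemma risingFactorial_succ (θ : ℝ) (n : ℕ) :
    risingFactorial θ (n + 1) = risingFactorial θ n * (θ + n) := by
  rw [risingFactorial, Finset.prod_range_succ, risingFactorial]

lemma risingFactorial_pos {θ : ℝ} (hθ : 0 < θ) (n : ℕ) : 0 < risingFactorial θ n :=
  Finset.prod_pos fun i _ => by positivity

lemma Gamma_add_natCast {θ : ℝ} (hθ : 0 < θ) (n : ℕ) :
    Real.Gamma (θ + n) = risingFactorial θ n * Real.Gamma θ := by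
  induction n with
  | zero => simp [risingFactorial_zero]
  | succ n ih =>
    rw [risingFactorial_succ, Nat.cast_succ, ← add_assoc,
      Real.Gamma_add_one (by positivity), ih]
    ring

/-- The recursion of the moments `a n` of the integral of a function with moments `q k` against a
Dirichlet process; in terms of generating functions, the Markov–Krein identity. -/
def MomentRecursion (θ : ℝ) (q a : ℕ → ℝ) : Prop :=
  ∀ n : ℕ, (n + 1) * (risingFactorial θ (n + 1) * a (n + 1) / (n + 1).factorial) =
    θ * ∑ j ∈ Finset.range (n + 1),
      q (1 + j) * (risingFactorial θ (n - j) * a (n - j) / (n - j).factorial)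

lemma MomentRecursion.unique {θ : ℝ} (hθ : 0 < θ) {q a a' : ℕ → ℝ} (h : MomentRecursion θ q a)
    (h' : MomentRecursion θ q a') (h0 : a 0 = a' 0) (n : ℕ) : a n = a' n := by
  induction n using Nat.strong_induction_on with
  | _ n ih =>
    cases n with
    | zero => exact h0
    | succ n =>
      have h1 := h n
      rw [Finset.sum_congr rfl fun j _ => by rw [ih (n - j) (by omega)], ← h' n] at h1
      have hr := (risingFactorial_pos hθ (n + 1)).ne'
      have hf : ((n + 1).factorial : ℝ) ≠ 0 := by positivity
      have hn : ((n : ℝ) + 1) ≠ 0 := by positivity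
      have h2 := mul_left_cancel₀ hn h1
      rw [div_left_inj' hf] at h2
      exact mul_left_cancel₀ hr h2

/-- The recursion obtained from a predictive rule: `l k n` is the mixed moment of order `n` in the
function and order one in its `k`-th power. -/
lemma momentRecursion_of_predictive {θ : ℝ} {q a : ℕ → ℝ} {l : ℕ → ℕ → ℝ}
    (h1 : ∀ n, a (n + 1) = l 1 n) (h0 : ∀ k, 1 ≤ k → θ * l k 0 = θ * (q k * a 0))
    (hl : ∀ k n, 1 ≤ k → (θ + (n + 1 : ℕ)) * l k (n + 1) =
      θ * (q k * a (n + 1)) + (n + 1 : ℕ) * l (k + 1) n) :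
    MomentRecursion θ q a := by
  have key : ∀ n k, 1 ≤ k → risingFactorial θ (n + 1) * l k n / n.factorial =
      θ * ∑ j ∈ Finset.range (n + 1),
        q (k + j) * (risingFactorial θ (n - j) * a (n - j) / (n - j).factorial) := by
    intro n
    induction n with
    | zero =>
      intro k hk
      simp [risingFactorial_succ, risingFactorial_zero, h0 k hk]
    | succ n ih =>
      intro k hk
      rw [Finset.sum_range_succ']
      have e1 : ∑ j ∈ Finset.range (n + 1), q (k + (j + 1)) *
          (risingFactorial θ (n + 1 - (j + 1)) * a (n + 1 - (j + 1)) / (n + 1 - (j + 1)).factorial) =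
          ∑ j ∈ Finset.range (n + 1), q (k + 1 + j) *
            (risingFactorial θ (n - j) * a (n - j) / (n - j).factorial) := by
        refine Finset.sum_congr rfl fun j _ => ?_
        rw [Nat.add_sub_add_right, add_assoc k 1 j, add_comm 1 j]
      have hf : (n.factorial : ℝ) ≠ 0 := by positivity
      have hn : ((n : ℝ) + 1) ≠ 0 := by positivity
      rw [e1, mul_add, ← ih (k + 1) (by omega), risingFactorial_succ θ (n + 1), mul_assoc,
        hl k n hk, Nat.factorial_succ]
      push_cast
      simp only [add_zero, Nat.factorial_succ]
      push_cast
      field_simp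
      ring
  intro n
  rw [← key n 1 le_rfl, h1, Nat.factorial_succ]
  have hf : (n.factorial : ℝ) ≠ 0 := by positivity
  have hn : ((n : ℝ) + 1) ≠ 0 := by positivity
  push_cast
  field_simp

/-- The recursion obtained from the self-similarity `D = W g(U) + (1 - W) D'` of a stick-breaking
sum. -/
lemma momentRecursion_of_selfSimilar {θ : ℝ} (hθ : 0 < θ) {q a : ℕ → ℝ} (hq : q 0 = 1)
    (h : ∀ n, a n = ∑ k ∈ Finset.range (n + 1), θ * k.factorial * risingFactorial θ (n - k) /
      risingFactorial θ (n + 1) * q k * a (n - k) * n.choose k) :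
    MomentRecursion θ q a := by
  have key : ∀ n, (θ + n) * (risingFactorial θ n * a n / n.factorial) =
      θ * ∑ k ∈ Finset.range (n + 1),
        q k * (risingFactorial θ (n - k) * a (n - k) / (n - k).factorial) := by
    intro n
    have hr := (risingFactorial_pos hθ (n + 1)).ne'
    calc (θ + n) * (risingFactorial θ n * a n / n.factorial)
        = risingFactorial θ (n + 1) / n.factorial * a n := by rw [risingFactorial_succ]; ring
      _ = _ := by
        rw [h n, Finset.mul_sum, Finset.mul_sum]
        refine Finset.sum_congr rfl fun k hk => ?_
        have hkn : k ≤ n := Nat.lt_succ_iff.1 (Finset.mem_range.1 hk)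
        rw [Nat.cast_choose ℝ hkn]
        have f1 : (n.factorial : ℝ) ≠ 0 := by positivity
        have f2 : (k.factorial : ℝ) ≠ 0 := by positivity
        have f3 : ((n - k).factorial : ℝ) ≠ 0 := by positivity
        field_simp
  intro n
  have h1 := key (n + 1)
  rw [Finset.sum_range_succ', hq, Nat.sub_zero, one_mul, mul_add, add_mul, add_comm] at h1
  have h2 := add_right_cancel h1
  push_cast at h2 ⊢
  rw [h2]
  congr 1
  refine Finset.sum_congr rfl fun j _ => ?_
  rw [add_comm 1 j]

end Recursion

/-! ### Stick-breaking sums -/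

section StickBreaking

/-- The mixed moments `E[W ^ k (1 - W) ^ m]` of a `Beta(1, θ)` variable. -/
lemma lintegral_betaMeasure {θ : ℝ} (hθ : 0 < θ) (k m : ℕ) :
    ∫⁻ x, ENNReal.ofReal x ^ k * ENNReal.ofReal (1 - x) ^ m ∂(betaMeasure 1 θ) =
      ENNReal.ofReal (θ * k.factorial * risingFactorial θ m / risingFactorial θ (k + m + 1)) := by
  have mpdf : ∀ α β, Measurable (betaPDF α β) := fun α β =>
    (measurable_betaPDFReal α β).ennreal_ofReal
  have hk : (0 : ℝ) < k + 1 := by positivity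
  have hm : (0 : ℝ) < θ + m := by positivity
  have hb1 := beta_pos one_pos hθ
  have hb2 := beta_pos hk hm
  have hbeta : beta (k + 1) (θ + m) / beta 1 θ =
      θ * k.factorial * risingFactorial θ m / risingFactorial θ (k + m + 1) := by
    have hΓ := (Real.Gamma_pos_of_pos hθ).ne'
    have hr := (risingFactorial_pos hθ (k + m + 1)).ne'
    have e1 : Real.Gamma (k + 1 + (θ + m)) = risingFactorial θ (k + m + 1) * Real.Gamma θ := by
      rw [← Gamma_add_natCast hθ]; push_cast; ring_nf
    rw [beta, beta, Real.Gamma_nat_eq_factorial, e1, Gamma_add_natCast hθ, Real.Gamma_one,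
      add_comm 1 θ, Real.Gamma_add_one hθ.ne']
    field_simp
  rw [betaMeasure, lintegral_withDensity_eq_lintegral_mul _ (mpdf 1 θ) (by fun_prop), ← hbeta]
  have hpt : ∀ x, (betaPDF 1 θ * fun x => ENNReal.ofReal x ^ k * ENNReal.ofReal (1 - x) ^ m) x =
      ENNReal.ofReal (beta (k + 1) (θ + m) / beta 1 θ) * betaPDF (k + 1) (θ + m) x := by
    intro x
    rw [Pi.mul_apply]
    by_cases hx : 0 < x ∧ x < 1
    · have hx' : 0 < 1 - x := by linarith [hx.2]
      rw [betaPDF_of_pos_lt_one hx.1 hx.2, betaPDF_of_pos_lt_one hx.1 hx.2,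
        ← ENNReal.ofReal_pow hx.1.le, ← ENNReal.ofReal_pow hx'.le,
        ← ENNReal.ofReal_mul (pow_nonneg hx.1.le k), ← ENNReal.ofReal_mul (div_pos hb2 hb1).le,
        ← ENNReal.ofReal_mul (mul_nonneg (mul_nonneg (one_div_pos.2 hb1).le
          (Real.rpow_nonneg hx.1.le _)) (Real.rpow_nonneg hx'.le _))]
      congr 1
      rw [sub_self, Real.rpow_zero, show (k : ℝ) + 1 - 1 = (k : ℕ) by ring, Real.rpow_natCast,
        show θ + m - 1 = θ - 1 + (m : ℕ) by ring, Real.rpow_add hx', Real.rpow_natCast]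
      field_simp
    · rw [betaPDF_eq, betaPDF_eq, if_neg hx, if_neg hx]; simp
  rw [lintegral_congr hpt, lintegral_const_mul _ (mpdf _ _), lintegral_betaPDF_eq_one hk hm, mul_one]

lemma ae_betaMeasure (θ : ℝ) : ∀ᵐ x ∂(betaMeasure 1 θ), 0 < x ∧ x < 1 := by
  have mpdf : Measurable (betaPDF 1 θ) := (measurable_betaPDFReal 1 θ).ennreal_ofReal
  rw [betaMeasure, ae_withDensity_iff mpdf]
  refine Eventually.of_forall fun x hx => ?_
  by_contra hn
  exact hx (by rw [betaPDF_eq, if_neg hn, ENNReal.ofReal_zero])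

/-- Splitting off the first coordinate of an i.i.d. sequence. -/
lemma lintegral_infinitePi_split {S : Type*} [MeasurableSpace S] (μ : Measure S)
    [IsProbabilityMeasure μ] {F : S × (ℕ → S) → ℝ≥0∞} (hF : Measurable F) :
    ∫⁻ y, F (y 0, fun j => y (j + 1)) ∂(Measure.infinitePi fun _ : ℕ => μ) =
      ∫⁻ x, ∫⁻ y, F (x, y) ∂(Measure.infinitePi fun _ : ℕ => μ) ∂μ := by
  have h0 : IsMixedIID (Measure.infinitePi fun _ : ℕ => μ) (fun _ => ()) (Kernel.const Unit μ)
      (fun i y => y i) := by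
    refine IsMixedIID.of_measure_eq measurable_const measurable_pi_apply fun D n A hD hA => ?_
    have e1 : (⋂ i ∈ Finset.range n, (fun y : ℕ → S => y i) ⁻¹' A i) =
        Set.pi (Finset.range n) A := by ext y; simp
    by_cases hDu : () ∈ D
    · simp only [Set.preimage_const_of_mem hDu, Set.univ_inter, Kernel.const_apply,
        lintegral_const, Measure.restrict_univ, measure_univ, mul_one, e1]
      exact Measure.infinitePi_pi (fun _ => μ) fun i _ => hA i
    · simp [Set.preimage_const_of_notMem hDu]
  have h1 := (h0.shift 1).lintegral (F := fun q => F (q.1.2 0, q.2)) (by fun_prop)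
  simp only [Fin.val_zero, add_comm 1] at h1
  refine h1.trans ?_
  have hm : Measurable fun x => ∫⁻ y, F (x, y) ∂(Measure.infinitePi fun _ : ℕ => μ) :=
    hF.lintegral_prod_right'
  exact ((lintegral_map hm (measurable_pi_apply 0)).symm.trans (by
    rw [Measure.infinitePi_map_eval]))

end StickBreaking

section StickSum

variable {S T : Type*} [MeasurableSpace S] [MeasurableSpace T]

lemma measurable_stickWeight (j : ℕ) : Measurable fun w : ℕ → ℝ => stickWeight w j := by
  unfold stickWeight
  fun_prop

lemma stickWeight_zero (w : ℕ → ℝ) : stickWeight w 0 = w 0 := by simp [stickWeight]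

lemma stickWeight_succ (w : ℕ → ℝ) (j : ℕ) :
    stickWeight w (j + 1) = (1 - w 0) * stickWeight (fun i => w (i + 1)) j := by
  rw [stickWeight, stickWeight, Finset.prod_range_succ']
  ring

lemma stickWeight_nonneg {w : ℕ → ℝ} (hw : ∀ i, 0 < w i ∧ w i < 1) (j : ℕ) :
    0 ≤ stickWeight w j :=
  mul_nonneg (hw j).1.le (Finset.prod_nonneg fun i _ => by linarith [(hw i).2])

lemma sum_stickWeight (w : ℕ → ℝ) (n : ℕ) :
    ∑ j ∈ Finset.range n, stickWeight w j = 1 - ∏ i ∈ Finset.range n, (1 - w i) := by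
  induction n with
  | zero => simp
  | succ n ih => rw [Finset.sum_range_succ, ih, Finset.prod_range_succ, stickWeight]; ring

lemma tsum_stickWeight_le_one {w : ℕ → ℝ} (hw : ∀ i, 0 < w i ∧ w i < 1) :
    ∑' j, ENNReal.ofReal (stickWeight w j) ≤ 1 := by
  rw [ENNReal.tsum_eq_iSup_nat]
  refine iSup_le fun n => ?_
  rw [← ENNReal.ofReal_sum_of_nonneg fun j _ => stickWeight_nonneg hw j, sum_stickWeight,
    ← ENNReal.ofReal_one]
  refine ENNReal.ofReal_le_ofReal ?_
  have : 0 ≤ ∏ i ∈ Finset.range n, (1 - w i) :=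
    Finset.prod_nonneg fun i _ => by linarith [(hw i).2]
  linarith

/-- The integral of a function against a stick-breaking sum, in terms of its integrals `g` against
the summands. -/
def stickIntegral (g : S → ℝ≥0∞) (p : (ℕ → ℝ) × (ℕ → S)) : ℝ≥0∞ :=
  ∑' j, ENNReal.ofReal (stickWeight p.1 j) * g (p.2 j)

lemma measurable_stickIntegral {g : S → ℝ≥0∞} (hg : Measurable g) :
    Measurable (stickIntegral g) := by
  refine Measurable.tsum fun j => ?_
  exact ((measurable_stickWeight j).comp measurable_fst).ennreal_ofReal.mul
    (hg.comp ((measurable_pi_apply j).comp measurable_snd))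

lemma lintegral_stickSum (K : S → Measure T) (f : T → ℝ≥0∞) (p : (ℕ → ℝ) × (ℕ → S)) :
    ∫⁻ x, f x ∂(stickSum K p.1 p.2) = stickIntegral (fun s => ∫⁻ x, f x ∂(K s)) p := by
  rw [stickSum, lintegral_sum_measure]
  simp [stickIntegral, lintegral_smul_measure]

lemma stickSum_apply (K : S → Measure T) {A : Set T} (hA : MeasurableSet A)
    (p : (ℕ → ℝ) × (ℕ → S)) :
    stickSum K p.1 p.2 A = stickIntegral (fun s => K s A) p := by
  rw [stickSum, Measure.sum_apply _ hA]
  simp [stickIntegral]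

lemma measurable_stickSum {K : S → Measure T} (hK : Measurable K) :
    Measurable fun p : (ℕ → ℝ) × (ℕ → S) => stickSum K p.1 p.2 := by
  refine Measure.measurable_of_measurable_coe _ fun A hA => ?_
  simp_rw [stickSum_apply K hA]
  exact measurable_stickIntegral ((Measure.measurable_coe hA).comp hK)

/-- Self-similarity of stick-breaking sums: after the first stick, the remaining ones form again a
stick-breaking sum. -/
lemma stickIntegral_split (g : S → ℝ≥0∞) {w : ℕ → ℝ} (hw : ∀ i, 0 < w i ∧ w i < 1) (u : ℕ → S) :
    stickIntegral g (w, u) = ENNReal.ofReal (w 0) * g (u 0) + ENNReal.ofReal (1 - w 0) *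
      stickIntegral g (fun i => w (i + 1), fun i => u (i + 1)) := by
  rw [stickIntegral, tsum_eq_zero_add' ENNReal.summable, stickWeight_zero, stickIntegral,
    ← ENNReal.tsum_mul_left]
  congr 1
  refine tsum_congr fun j => ?_
  rw [stickWeight_succ, ENNReal.ofReal_mul (by linarith [(hw 0).2]), mul_assoc]

lemma ae_infinitePi_of_ae {μ : Measure S} [IsProbabilityMeasure μ] {p : S → Prop}
    (h : ∀ᵐ x ∂μ, p x) : ∀ᵐ y ∂(Measure.infinitePi fun _ : ℕ => μ), ∀ i, p (y i) := by
  rw [ae_all_iff]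
  exact fun i => (measurePreserving_eval_infinitePi (fun _ : ℕ => μ) i).quasiMeasurePreserving.ae h

variable (θ : ℝ) (μ : Measure S) [IsProbabilityMeasure μ]

/-- The joint law of the stick proportions and the atoms. -/
abbrev stickInput : Measure ((ℕ → ℝ) × (ℕ → S)) :=
  (Measure.infinitePi fun _ : ℕ => betaMeasure 1 θ).prod (Measure.infinitePi fun _ : ℕ => μ)

variable {θ μ}

/-- Splitting off the first stick and the first atom. -/
lemma lintegral_stickInput_split (hθ : 0 < θ)
    {F : (ℝ × (ℕ → ℝ)) × S × (ℕ → S) → ℝ≥0∞} (hF : Measurable F) :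
    ∫⁻ w, ∫⁻ u, F ((w 0, fun i => w (i + 1)), u 0, fun i => u (i + 1))
        ∂(Measure.infinitePi fun _ : ℕ => μ) ∂(Measure.infinitePi fun _ : ℕ => betaMeasure 1 θ) =
      ∫⁻ y, ∫⁻ w, ∫⁻ x, ∫⁻ u, F ((y, w), x, u) ∂(Measure.infinitePi fun _ : ℕ => μ) ∂μ
        ∂(Measure.infinitePi fun _ : ℕ => betaMeasure 1 θ) ∂(betaMeasure 1 θ) := by
  have := isProbabilityMeasureBeta one_pos hθ
  have h1 : ∀ w : ℕ → ℝ, ∫⁻ u, F ((w 0, fun i => w (i + 1)), u 0, fun i => u (i + 1))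
      ∂(Measure.infinitePi fun _ : ℕ => μ) =
      ∫⁻ x, ∫⁻ u, F ((w 0, fun i => w (i + 1)), x, u) ∂(Measure.infinitePi fun _ : ℕ => μ) ∂μ :=
    fun w => lintegral_infinitePi_split μ
      (F := fun q => F ((w 0, fun i => w (i + 1)), q)) (hF.comp measurable_prodMk_left)
  rw [lintegral_congr h1]
  have m1 : Measurable fun q : (ℝ × (ℕ → ℝ)) × S =>
      ∫⁻ u, F (q.1, q.2, u) ∂(Measure.infinitePi fun _ : ℕ => μ) := by
    have : Measurable fun q : ((ℝ × (ℕ → ℝ)) × S) × (ℕ → S) => F (q.1.1, q.1.2, q.2) :=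
      hF.comp (by fun_prop)
    exact this.lintegral_prod_right'
  exact lintegral_infinitePi_split (betaMeasure 1 θ) (F := fun q =>
    ∫⁻ x, ∫⁻ u, F (q, x, u) ∂(Measure.infinitePi fun _ : ℕ => μ) ∂μ) m1.lintegral_prod_right'

/-- The recursion of the moments of a stick-breaking sum, from its self-similarity. -/
lemma lintegral_stickIntegral_pow (hθ : 0 < θ) {g : S → ℝ≥0∞} (hg : Measurable g) (n : ℕ) :
    ∫⁻ p, stickIntegral g p ^ n ∂(stickInput θ μ) =
      ∑ k ∈ Finset.range (n + 1), ENNReal.ofReal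
        (θ * k.factorial * risingFactorial θ (n - k) / risingFactorial θ (n + 1)) *
        (∫⁻ x, g x ^ k ∂μ) * (∫⁻ p, stickIntegral g p ^ (n - k) ∂(stickInput θ μ)) *
        n.choose k := by
  have := isProbabilityMeasureBeta one_pos hθ
  have hw := ae_infinitePi_of_ae (ae_betaMeasure θ)
  have hD := measurable_stickIntegral hg
  have hF : Measurable fun q : (ℝ × (ℕ → ℝ)) × S × (ℕ → S) =>
      (ENNReal.ofReal q.1.1 * g q.2.1 +
        ENNReal.ofReal (1 - q.1.1) * stickIntegral g (q.1.2, q.2.2)) ^ n := by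
    have : Measurable fun q : (ℝ × (ℕ → ℝ)) × S × (ℕ → S) =>
      stickIntegral g (q.1.2, q.2.2) := hD.comp (by fun_prop)
    fun_prop
  calc ∫⁻ p, stickIntegral g p ^ n ∂(stickInput θ μ)
      = ∫⁻ w, ∫⁻ u, stickIntegral g (w, u) ^ n ∂(Measure.infinitePi fun _ : ℕ => μ)
          ∂(Measure.infinitePi fun _ : ℕ => betaMeasure 1 θ) :=
        lintegral_prod _ (hD.pow_const n).aemeasurable
    _ = ∫⁻ w, ∫⁻ u, (ENNReal.ofReal (w 0) * g (u 0) + ENNReal.ofReal (1 - w 0) *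
          stickIntegral g (fun i => w (i + 1), fun i => u (i + 1))) ^ n
          ∂(Measure.infinitePi fun _ : ℕ => μ)
          ∂(Measure.infinitePi fun _ : ℕ => betaMeasure 1 θ) := by
        refine lintegral_congr_ae (hw.mono fun w hw => lintegral_congr fun u => ?_)
        rw [stickIntegral_split g hw]
    _ = _ := lintegral_stickInput_split hθ hF
    _ = ∫⁻ y, ∫⁻ w, ∫⁻ x, ∫⁻ u, ∑ k ∈ Finset.range (n + 1),
          (ENNReal.ofReal y ^ k * ENNReal.ofReal (1 - y) ^ (n - k) * n.choose k) *
            (g x ^ k * stickIntegral g (w, u) ^ (n - k))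
          ∂(Measure.infinitePi fun _ : ℕ => μ) ∂μ
          ∂(Measure.infinitePi fun _ : ℕ => betaMeasure 1 θ) ∂(betaMeasure 1 θ) := by
        refine lintegral_congr fun y => lintegral_congr fun w => lintegral_congr fun x =>
          lintegral_congr fun u => ?_
        rw [add_pow]
        refine Finset.sum_congr rfl fun k _ => ?_
        ring
    _ = ∫⁻ y, ∑ k ∈ Finset.range (n + 1),
          (ENNReal.ofReal y ^ k * ENNReal.ofReal (1 - y) ^ (n - k) * n.choose k) *
            ((∫⁻ x, g x ^ k ∂μ) * ∫⁻ p, stickIntegral g p ^ (n - k) ∂(stickInput θ μ))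
          ∂(betaMeasure 1 θ) := by
        refine lintegral_congr fun y => ?_
        have m1 : ∀ k (w : ℕ → ℝ), Measurable fun u => stickIntegral g (w, u) ^ k := fun k w =>
          (hD.comp measurable_prodMk_left).pow_const k
        have m2 : ∀ k, Measurable fun w => ∫⁻ u, stickIntegral g (w, u) ^ k
            ∂(Measure.infinitePi fun _ : ℕ => μ) := fun k =>
          (hD.pow_const k).lintegral_prod_right'
        simp_rw [lintegral_prod _ (hD.pow_const _).aemeasurable]
        have e1 : ∀ w x, ∫⁻ u, ∑ k ∈ Finset.range (n + 1),
            (ENNReal.ofReal y ^ k * ENNReal.ofReal (1 - y) ^ (n - k) * n.choose k) *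
            (g x ^ k * stickIntegral g (w, u) ^ (n - k)) ∂(Measure.infinitePi fun _ : ℕ => μ) =
            ∑ k ∈ Finset.range (n + 1),
            (ENNReal.ofReal y ^ k * ENNReal.ofReal (1 - y) ^ (n - k) * n.choose k) *
            (g x ^ k * ∫⁻ u, stickIntegral g (w, u) ^ (n - k)
              ∂(Measure.infinitePi fun _ : ℕ => μ)) := by
          intro w x
          rw [lintegral_finsetSum _ fun k _ => ((m1 _ w).const_mul _).const_mul _]
          refine Finset.sum_congr rfl fun k _ => ?_
          rw [lintegral_const_mul _ ((m1 _ w).const_mul _), lintegral_const_mul _ (m1 _ w)]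
        simp_rw [e1]
        have e2 : ∀ w, ∫⁻ x, ∑ k ∈ Finset.range (n + 1),
            (ENNReal.ofReal y ^ k * ENNReal.ofReal (1 - y) ^ (n - k) * n.choose k) *
            (g x ^ k * ∫⁻ u, stickIntegral g (w, u) ^ (n - k)
              ∂(Measure.infinitePi fun _ : ℕ => μ)) ∂μ =
            ∑ k ∈ Finset.range (n + 1),
            (ENNReal.ofReal y ^ k * ENNReal.ofReal (1 - y) ^ (n - k) * n.choose k) *
            ((∫⁻ x, g x ^ k ∂μ) * ∫⁻ u, stickIntegral g (w, u) ^ (n - k)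
              ∂(Measure.infinitePi fun _ : ℕ => μ)) := by
          intro w
          rw [lintegral_finsetSum _ fun k _ => ((hg.pow_const k).mul_const _).const_mul _]
          refine Finset.sum_congr rfl fun k _ => ?_
          rw [lintegral_const_mul _ ((hg.pow_const k).mul_const _),
            lintegral_mul_const _ (hg.pow_const k)]
        simp_rw [e2]
        rw [lintegral_finsetSum _ fun k _ => ((m2 _).const_mul _).const_mul _]
        refine Finset.sum_congr rfl fun k _ => ?_
        rw [lintegral_const_mul _ ((m2 _).const_mul _), lintegral_const_mul _ (m2 _)]
    _ = _ := by
        rw [lintegral_finsetSum _ fun k _ => by fun_prop]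
        refine Finset.sum_congr rfl fun k hk => ?_
        have hkn : k ≤ n := Nat.lt_succ_iff.1 (Finset.mem_range.1 hk)
        rw [lintegral_mul_const _ (by fun_prop), lintegral_mul_const _ (by fun_prop),
          lintegral_betaMeasure hθ, Nat.add_sub_cancel' hkn]
        ring

lemma ae_stickIntegral_le_one {g : S → ℝ≥0∞} (hθ : 0 < θ) (hg : ∀ᵐ x ∂μ, g x ≤ 1) :
    ∀ᵐ p ∂(stickInput θ μ), stickIntegral g p ≤ 1 := by
  have := isProbabilityMeasureBeta one_pos hθ
  filter_upwards [Measure.quasiMeasurePreserving_fst.ae (ae_infinitePi_of_ae (ae_betaMeasure θ)),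
    Measure.quasiMeasurePreserving_snd.ae (ae_infinitePi_of_ae hg)] with p hw hu
  calc stickIntegral g p ≤ ∑' j, ENNReal.ofReal (stickWeight p.1 j) * 1 :=
        ENNReal.tsum_le_tsum fun j => by gcongr; exact hu j
    _ ≤ 1 := by simpa using tsum_stickWeight_le_one hw

/-- The sticks use up the whole unit interval: their total length is at most one, and has mean
one. -/
lemma ae_stickIntegral_one (hθ : 0 < θ) :
    ∀ᵐ p ∂(stickInput θ μ), stickIntegral (fun _ => 1) p = 1 := by
  have := isProbabilityMeasureBeta one_pos hθ
  have hle := ae_stickIntegral_le_one (μ := μ) hθ (g := fun _ => 1) (Eventually.of_forall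
    fun _ => le_rfl)
  have hm := measurable_stickIntegral (S := S) (g := fun _ => 1) measurable_const
  have h1 := lintegral_stickIntegral_pow (μ := μ) hθ (g := fun _ => 1) measurable_const 1
  have hlt : ∫⁻ p, stickIntegral (fun _ => 1) p ∂(stickInput θ μ) ≤ 1 := by
    refine (lintegral_mono_ae hle).trans ?_
    simp
  have hint : ∫⁻ p, stickIntegral (fun _ => 1) p ∂(stickInput θ μ) = 1 := by
    set a := ∫⁻ p, stickIntegral (fun _ => 1) p ∂(stickInput θ μ) with ha
    have hfin : a ≠ ∞ := (hlt.trans_lt ENNReal.one_lt_top).ne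
    simp only [pow_one, Finset.sum_range_succ, Finset.sum_range_zero, one_pow, lintegral_const,
      measure_univ, Nat.sub_zero, Nat.sub_self, pow_zero, ← ha] at h1
    have h2 := congrArg ENNReal.toReal h1
    simp [ENNReal.toReal_add, ENNReal.mul_eq_top, hfin, risingFactorial_succ,
      risingFactorial_zero] at h2
    rw [ENNReal.toReal_ofReal (by positivity), ENNReal.toReal_ofReal (by positivity)] at h2
    rw [← ENNReal.toReal_eq_one_iff]
    field_simp at h2
    linarith
  have h3 : ∫⁻ p, (1 - stickIntegral (fun _ => 1) p) ∂(stickInput θ μ) = 0 := by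
    rw [lintegral_sub hm (by rw [hint]; simp) hle, hint]
    simp
  have h4 := (lintegral_eq_zero_iff (measurable_const.sub hm)).1 h3
  filter_upwards [h4, hle] with p h5 h6
  exact le_antisymm h6 (tsub_eq_zero_iff_le.1 h5)

variable {K : S → Measure T}

lemma ae_isProbabilityMeasure_stickBreakingLaw (hθ : 0 < θ) (hK : Measurable K)
    (hK1 : ∀ᵐ x ∂μ, K x Set.univ = 1) :
    ∀ᵐ m ∂(stickBreakingLaw θ μ K), IsProbabilityMeasure m := by
  have := isProbabilityMeasureBeta one_pos hθ
  have hms : MeasurableSet {m : Measure T | IsProbabilityMeasure m} := by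
    simp_rw [isProbabilityMeasure_iff]
    exact Measure.measurable_coe MeasurableSet.univ (measurableSet_singleton 1)
  rw [stickBreakingLaw, ae_map_iff (measurable_stickSum hK).aemeasurable hms]
  filter_upwards [ae_stickIntegral_one (μ := μ) hθ,
    Measure.quasiMeasurePreserving_snd.ae (ae_infinitePi_of_ae hK1)] with p h1 h2
  refine ⟨?_⟩
  rw [stickSum_apply K MeasurableSet.univ, ← h1]
  simp only [stickIntegral, h2]

lemma isProbabilityMeasure_stickBreakingLaw (hθ : 0 < θ) (hK : Measurable K) :
    IsProbabilityMeasure (stickBreakingLaw θ μ K) := by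
  have := isProbabilityMeasureBeta one_pos hθ
  exact Measure.isProbabilityMeasure_map (measurable_stickSum hK).aemeasurable

/-- The moments of the integral of a function under a stick-breaking law. -/
lemma momentRecursion_stickBreakingLaw (hθ : 0 < θ) (hK : Measurable K)
    (hK1 : ∀ᵐ x ∂μ, K x Set.univ = 1) {f : T → ℝ≥0∞} (hf : Measurable f) (hf1 : ∀ x, f x ≤ 1) :
    MomentRecursion θ (fun k => (∫⁻ x, (∫⁻ t, f t ∂(K x)) ^ k ∂μ).toReal)
      (fun n => (∫⁻ m, (∫⁻ t, f t ∂m) ^ n ∂(stickBreakingLaw θ μ K)).toReal) := by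
  have := isProbabilityMeasureBeta one_pos hθ
  have hg : Measurable fun x => ∫⁻ t, f t ∂(K x) := (Measure.measurable_lintegral hf).comp hK
  have hg1 : ∀ᵐ x ∂μ, ∫⁻ t, f t ∂(K x) ≤ 1 := hK1.mono fun x hx =>
    (lintegral_mono hf1).trans (by simp [hx])
  have hq : ∀ k, ∫⁻ x, (∫⁻ t, f t ∂(K x)) ^ k ∂μ ≠ ∞ := fun k =>
    ((lintegral_mono_ae (hg1.mono fun x hx => pow_le_one' hx k)).trans_lt (by simp)).ne
  have ha : ∀ n, ∫⁻ p, stickIntegral (fun s => ∫⁻ t, f t ∂(K s)) p ^ n ∂(stickInput θ μ) ≠ ∞ :=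
    fun n => ((lintegral_mono_ae ((ae_stickIntegral_le_one hθ hg1).mono fun p hp =>
      pow_le_one' hp n)).trans_lt (by simp)).ne
  have hlaw : ∀ n, ∫⁻ m, (∫⁻ t, f t ∂m) ^ n ∂(stickBreakingLaw θ μ K) =
      ∫⁻ p, stickIntegral (fun s => ∫⁻ t, f t ∂(K s)) p ^ n ∂(stickInput θ μ) := by
    intro n
    rw [stickBreakingLaw, lintegral_map ((Measure.measurable_lintegral hf).pow_const n)
      (measurable_stickSum hK)]
    simp_rw [lintegral_stickSum]
  refine momentRecursion_of_selfSimilar hθ (by simp) fun n => ?_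
  simp only [hlaw]
  rw [lintegral_stickIntegral_pow hθ hg, ENNReal.toReal_sum fun k _ =>
    ENNReal.mul_ne_top (ENNReal.mul_ne_top (ENNReal.mul_ne_top ENNReal.ofReal_ne_top (hq k))
      (ha _)) (ENNReal.natCast_ne_top _)]
  refine Finset.sum_congr rfl fun k _ => ?_
  have h1 := (risingFactorial_pos hθ (n - k)).le
  have h2 := (risingFactorial_pos hθ (n + 1)).le
  rw [ENNReal.toReal_mul, ENNReal.toReal_mul, ENNReal.toReal_mul,
    ENNReal.toReal_ofReal (by positivity), ENNReal.toReal_natCast]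

end StickSum

/-! ### Laws of random measures are determined by moments -/

section Moments

lemma hasSum_integral_cexp {α : Type*} [MeasurableSpace α] (m : Measure α) [IsFiniteMeasure m]
    {Z : α → ℝ} (hZ : Measurable Z) (hZ1 : ∀ᵐ x ∂m, |Z x| ≤ 1) (c : ℂ) :
    HasSum (fun n : ℕ => c ^ n / n.factorial * ((∫ x, Z x ^ n ∂m : ℝ) : ℂ))
      (∫ x, Complex.exp (c * Z x) ∂m) := by
  have hb : ∀ n : ℕ, ∀ᵐ x ∂m, ‖(c * Z x) ^ n / (n.factorial : ℂ)‖ ≤ ‖c‖ ^ n / n.factorial := by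
    intro n
    filter_upwards [hZ1] with x hx
    rw [norm_div, norm_pow, norm_mul, Complex.norm_real, Complex.norm_natCast, mul_pow]
    gcongr
    exact mul_le_of_le_one_right (by positivity) (pow_le_one₀ (norm_nonneg _) hx)
  have hint : ∀ n : ℕ, Integrable (fun x => (c * Z x) ^ n / (n.factorial : ℂ)) m := fun n =>
    Integrable.of_bound (by fun_prop) _ (hb n)
  have hsum : Summable fun n : ℕ => ∫ x, ‖(c * Z x) ^ n / (n.factorial : ℂ)‖ ∂m := by
    refine Summable.of_nonneg_of_le (fun n => integral_nonneg fun x => norm_nonneg _) (fun n => ?_)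
      ((Real.summable_pow_div_factorial ‖c‖).mul_right (m.real Set.univ))
    calc ∫ x, ‖(c * Z x) ^ n / (n.factorial : ℂ)‖ ∂m
        ≤ ∫ _, ‖c‖ ^ n / n.factorial ∂m :=
          integral_mono_ae (hint n).norm (integrable_const _) (hb n)
      _ = _ := by rw [integral_const, smul_eq_mul, mul_comm]
  have h := hasSum_integral_of_summable_integral_norm hint hsum
  have e1 : ∀ n : ℕ, ∫ x, (c * Z x) ^ n / (n.factorial : ℂ) ∂m =
      c ^ n / n.factorial * ((∫ x, Z x ^ n ∂m : ℝ) : ℂ) := by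
    intro n
    rw [← integral_complex_ofReal, ← integral_const_mul]
    refine integral_congr_ae (Eventually.of_forall fun x => ?_)
    simp only [Complex.ofReal_pow]
    ring
  have e2 : ∀ x, ∑' n : ℕ, (c * Z x) ^ n / (n.factorial : ℂ) = Complex.exp (c * Z x) := fun x => by
    rw [Complex.exp_eq_exp_ℂ, NormedSpace.exp_eq_tsum_div]
  simp_rw [e1, e2] at h
  exact h

variable {S : Type*} [MeasurableSpace S]

/-- A linear combination of values of a probability measure is an affine function of its integral
against a measurable function with values in `[0, 1]`. -/
lemma exists_lintegral_eq_sum {ι : Type*} [Fintype ι] (A : ι → Set S)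
    (hA : ∀ i, MeasurableSet (A i)) (t : ι → ℝ) :
    ∃ (f : S → ℝ≥0∞) (s : ℝ), Measurable f ∧ (∀ x, f x ≤ 1) ∧
      ∀ m : Measure S, IsProbabilityMeasure m →
        ∑ i, t i * m.real (A i) = 2 * s * (∫⁻ x, f x ∂m).toReal - s := by
  set s : ℝ := 1 + ∑ i, |t i| with hs
  have hspos : 0 < s := by positivity
  let h : S → ℝ := fun x => ∑ i, t i * (A i).indicator (fun _ => (1 : ℝ)) x
  have hh : Measurable h := Finset.measurable_sum _ fun i _ =>
    (measurable_const.indicator (hA i)).const_mul _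
  have habs : ∀ x, |h x| ≤ s := by
    intro x
    calc |h x| ≤ ∑ i, |t i * (A i).indicator (fun _ => (1 : ℝ)) x| := Finset.abs_sum_le_sum_abs _ _
      _ ≤ ∑ i, |t i| := by
        refine Finset.sum_le_sum fun i _ => ?_
        rw [abs_mul]
        refine mul_le_of_le_one_right (abs_nonneg _) ?_
        by_cases hx : x ∈ A i <;> simp [hx]
      _ ≤ s := by rw [hs]; linarith
  refine ⟨fun x => ENNReal.ofReal ((h x + s) / (2 * s)), s, (hh.add_const s |>.div_const _).ennreal_ofReal,
    fun x => ?_, fun m hm => ?_⟩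
  · rw [ENNReal.ofReal_le_one, div_le_one (by positivity)]
    linarith [(abs_le.1 (habs x)).2]
  · have hint : Integrable h m := Integrable.of_bound hh.aestronglyMeasurable s
      (Eventually.of_forall habs)
    rw [← integral_eq_lintegral_of_nonneg_ae
      (Eventually.of_forall fun x => div_nonneg (by linarith [(abs_le.1 (habs x)).1])
        (by positivity)) (hh.add_const s |>.div_const _).aestronglyMeasurable,
      integral_div, integral_add hint (integrable_const _), integral_const, probReal_univ]
    have : ∫ x, h x ∂m = ∑ i, t i * m.real (A i) := by
      rw [integral_finsetSum _ fun i _ =>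
        ((integrable_const (1 : ℝ)).indicator (hA i)).const_mul _]
      refine Finset.sum_congr rfl fun i _ => ?_
      rw [integral_const_mul, integral_indicator (hA i)]
      simp
    rw [this, one_smul]
    field_simp
    ring

/-- The values of a measure on all measurable sets, as real numbers. -/
def realEval (m : Measure S) : {A : Set S // MeasurableSet A} → ℝ := fun A => m.real A.1

lemma measurable_realEval : Measurable (realEval (S := S)) :=
  measurable_pi_lambda _ fun A => (Measure.measurable_coe A.2).ennreal_toReal

/-- A law of random probability measures is determined by its image under `realEval`. -/
lemma eq_of_map_realEval {m₁ m₂ : Measure (Measure S)}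
    (h₁ : ∀ᵐ m ∂m₁, IsProbabilityMeasure m) (h₂ : ∀ᵐ m ∂m₂, IsProbabilityMeasure m)
    (h : m₁.map realEval = m₂.map realEval) : m₁ = m₂ := by
  have hgen : (inferInstance : MeasurableSpace (Measure S)) ≤ MeasurableSpace.comap
      (fun m (A : {A : Set S // MeasurableSet A}) => m A.1) inferInstance := by
    refine iSup₂_le fun A hA => ?_
    rintro _ ⟨B, hB, rfl⟩
    exact ⟨{y | y ⟨A, hA⟩ ∈ B}, measurable_pi_apply _ hB, rfl⟩
  ext B hB
  obtain ⟨C, hC, rfl⟩ := hgen B hB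
  have hmeas : Measurable fun y : {A : Set S // MeasurableSet A} → ℝ =>
      fun A => ENNReal.ofReal (y A) := by fun_prop
  have key : ∀ m' : Measure (Measure S), (∀ᵐ m ∂m', IsProbabilityMeasure m) →
      m' ((fun m (A : {A : Set S // MeasurableSet A}) => m A.1) ⁻¹' C) =
        m'.map realEval ((fun y A => ENNReal.ofReal (y A)) ⁻¹' C) := by
    intro m' hm'
    rw [Measure.map_apply measurable_realEval (hmeas hC)]
    refine measure_congr (hm'.mono fun m hm => ?_)
    have : (fun A : {A : Set S // MeasurableSet A} => ENNReal.ofReal (realEval m A)) =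
        fun A => m A.1 := by
      funext A
      exact ofReal_measureReal
    simp only [eq_iff_iff]
    change _ ∈ C ↔ (fun A : {A : Set S // MeasurableSet A} => ENNReal.ofReal (realEval m A)) ∈ C
    rw [this]
  rw [key m₁ h₁, key m₂ h₂, h]

/-- The law of a random probability measure is determined by the moments of its integrals against
measurable functions with values in `[0, 1]`: these moments determine the characteristic functions
of the finite-dimensional distributions. -/
lemma eq_of_moments {m₁ m₂ : Measure (Measure S)} [IsProbabilityMeasure m₁]
    [IsProbabilityMeasure m₂]
    (h₁ : ∀ᵐ m ∂m₁, IsProbabilityMeasure m) (h₂ : ∀ᵐ m ∂m₂, IsProbabilityMeasure m)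
    (h : ∀ f : S → ℝ≥0∞, Measurable f → (∀ x, f x ≤ 1) → ∀ n : ℕ,
      ∫⁻ m, (∫⁻ x, f x ∂m) ^ n ∂m₁ = ∫⁻ m, (∫⁻ x, f x ∂m) ^ n ∂m₂) : m₁ = m₂ := by
  refine eq_of_map_realEval h₁ h₂ ?_
  refine IsProjectiveLimit.unique (P := fun I => (m₂.map realEval).map I.restrict) (fun I => ?_)
    fun I => rfl
  have mI : Measurable (I.restrict ∘ realEval (S := S)) :=
    (Finset.measurable_restrict I).comp measurable_realEval
  change _ = (m₂.map realEval).map I.restrict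
  rw [Measure.map_map (Finset.measurable_restrict I) measurable_realEval,
    Measure.map_map (Finset.measurable_restrict I) measurable_realEval]
  have := Measure.isProbabilityMeasure_map (μ := m₁) mI.aemeasurable
  have := Measure.isProbabilityMeasure_map (μ := m₂) mI.aemeasurable
  refine Measure.ext_of_charFunDual (funext fun L => ?_)
  have hL : ∀ y : I → ℝ, L y = ∑ i, L (Pi.single i 1) * y i := by
    intro y
    conv_lhs => rw [← Finset.univ_sum_single y]
    rw [map_sum]
    refine Finset.sum_congr rfl fun i _ => ?_
    rw [mul_comm, ← smul_eq_mul, ← map_smul, ← Pi.single_smul, smul_eq_mul, mul_one]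
  obtain ⟨f, s, hf, hf1, hfs⟩ := exists_lintegral_eq_sum (fun i : I => i.1.1) (fun i => i.1.2)
    fun i => L (Pi.single i 1)
  have hZ : Measurable fun m : Measure S => (∫⁻ x, f x ∂m).toReal :=
    (Measure.measurable_lintegral hf).ennreal_toReal
  have hle : ∀ m : Measure S, IsProbabilityMeasure m → ∫⁻ x, f x ∂m ≤ 1 := fun m hm =>
    (lintegral_mono hf1).trans (by simp)
  have key : ∀ m' : Measure (Measure S), IsProbabilityMeasure m' →
      (∀ᵐ m ∂m', IsProbabilityMeasure m) →
      charFunDual (m'.map (I.restrict ∘ realEval)) L = Complex.exp (-(s * Complex.I)) *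
        ∫ m, Complex.exp (2 * s * Complex.I * (∫⁻ x, f x ∂m).toReal) ∂m' ∧
      HasSum (fun n : ℕ => (2 * s * Complex.I) ^ n / n.factorial *
        (((∫⁻ m, (∫⁻ x, f x ∂m) ^ n ∂m').toReal : ℝ) : ℂ))
        (∫ m, Complex.exp (2 * s * Complex.I * (∫⁻ x, f x ∂m).toReal) ∂m') := by
    intro m' _ hm'
    constructor
    · rw [charFunDual_apply, integral_map mI.aemeasurable (by fun_prop), ← integral_const_mul]
      refine integral_congr_ae (hm'.mono fun m hm => ?_)
      have : L ((I.restrict ∘ realEval) m) = 2 * s * (∫⁻ x, f x ∂m).toReal - s := by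
        rw [← hfs m hm, hL]
        rfl
      simp only [this]
      rw [← Complex.exp_add]
      congr 1
      push_cast
      ring
    · have := hasSum_integral_cexp m' hZ (hm'.mono fun m hm => by
        rw [abs_of_nonneg ENNReal.toReal_nonneg]
        exact ENNReal.toReal_le_of_le_ofReal zero_le_one (by simpa using hle m hm))
        (2 * s * Complex.I)
      have e : ∀ n : ℕ, ∫ m, (∫⁻ x, f x ∂m).toReal ^ n ∂m' =
          (∫⁻ m, (∫⁻ x, f x ∂m) ^ n ∂m').toReal := by
        intro n
        rw [← integral_toReal ((Measure.measurable_lintegral hf).pow_const n).aemeasurable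
          (hm'.mono fun m hm => (pow_le_one' (hle m hm) n).trans_lt ENNReal.one_lt_top)]
        simp only [ENNReal.toReal_pow]
      simp_rw [e] at this
      exact this
  rw [(key m₁ inferInstance h₁).1, (key m₂ inferInstance h₂).1]
  have s₁ := (key m₁ inferInstance h₁).2
  have s₂ := (key m₂ inferInstance h₂).2
  simp_rw [h f hf hf1] at s₁
  rw [s₁.unique s₂]

end Moments

/-! ### The law of the directing measure off the null set -/

section DirectingLaw

variable {Ω : Type*} [MeasurableSpace Ω] {P : Measure Ω} [IsProbabilityMeasure P]
  {𝕏 : Type*} [MeasurableSpace 𝕏] [StandardBorelSpace 𝕏] [Nonempty 𝕏]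
  {X : ℕ → Ω → 𝕏} {θ : ℝ} {ν : Measure 𝕏} [IsProbabilityMeasure ν] {R : Kernel 𝕏 𝕏}
  {Pt : Kernel Ω 𝕏} [IsMarkovKernel Pt]

lemma IsRegularPoint.isProbabilityMeasure_offNull (hc : ν (nullPart R)ᶜ ≠ 0) {x : 𝕏}
    (hx : IsRegularPoint ν R x) : IsProbabilityMeasure (offNull R x) :=
  cond_isProbabilityMeasure_of_finite (hx.apply_compl ▸ hc)
    (hx.apply_compl ▸ measure_ne_top ν _)

lemma IsRegularPoint.lintegral_pow (hc : ν (nullPart R)ᶜ ≠ 0) {x : 𝕏}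
    (hx : IsRegularPoint ν R x) (f : 𝕏 → ℝ≥0∞) {k : ℕ} (hk : k ≠ 0) :
    ∫⁻ y, (∫⁻ z, f z ∂(offNull R y)) ^ k ∂(R x) =
      ν (nullPart R)ᶜ * (∫⁻ z, f z ∂(offNull R x)) ^ k := by
  have := hx.isProbabilityMeasure_offNull hc
  have h1 : ∫⁻ y in nullPart R, (∫⁻ z, f z ∂(offNull R y)) ^ k ∂ν = 0 := by
    rw [setLIntegral_congr_fun (g := fun _ => 0) (measurableSet_nullPart R) fun y hy => by
      simp [offNull_eq_zero_of_mem hy, hk]]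
    simp
  have h2 : ∫⁻ y, (∫⁻ z, f z ∂(offNull R y)) ^ k ∂(offNull R x) =
      (∫⁻ z, f z ∂(offNull R x)) ^ k := by
    rw [lintegral_congr_ae (hx.ae_mem_fiber.mono fun y hy => by
      rw [offNull_congr (show R y = R x from hy)]), lintegral_const, measure_univ, mul_one]
  rw [hx.eq_add, lintegral_add_measure, lintegral_smul_measure, h1, h2, zero_add, smul_eq_mul]

lemma IsDirecting.lintegral_prod_erase (hPt : IsDirecting P X Pt) (hX : ∀ n, Measurable (X n))
    {g g' : 𝕏 → ℝ≥0∞} (hg : Measurable g) (hg' : Measurable g') {n i : ℕ} (hi : i < n + 1) :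
    ∫⁻ ω, (∏ j ∈ (Finset.range (n + 1)).erase i, g (X j ω)) * g' (X i ω) ∂P =
      ∫⁻ ω, (∫⁻ x, g x ∂(Pt ω)) ^ n * ∫⁻ x, g' x ∂(Pt ω) ∂P := by
  have hi' : i ∈ Finset.range (n + 1) := Finset.mem_range.2 hi
  have h := hPt.lintegral_prod hX (n + 1) (f := fun j => if j = i then g' else g) fun j => by
    by_cases hj : j = i
    · simpa [hj] using hg'
    · simpa [hj] using hg
  simp_rw [← Finset.mul_prod_erase _ _ hi'] at h
  convert h using 1
  · refine lintegral_congr fun ω => ?_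
    rw [if_pos trivial, mul_comm]
    congr 1
    exact Finset.prod_congr rfl fun j hj => by rw [if_neg (Finset.ne_of_mem_erase hj)]
  · refine lintegral_congr fun ω => ?_
    rw [if_pos trivial, mul_comm]
    congr 1
    rw [Finset.prod_congr rfl fun j hj => by rw [if_neg (Finset.ne_of_mem_erase hj)],
      Finset.prod_const, Finset.card_erase_of_mem hi', Finset.card_range, Nat.add_sub_cancel]

lemma IsDirecting.lintegral_prod_mul (hPt : IsDirecting P X Pt) (hX : ∀ n, Measurable (X n))
    {g g' : 𝕏 → ℝ≥0∞} (hg : Measurable g) (hg' : Measurable g') (n : ℕ) :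
    ∫⁻ ω, (∏ j ∈ Finset.range n, g (X j ω)) * g' (X n ω) ∂P =
      ∫⁻ ω, (∫⁻ x, g x ∂(Pt ω)) ^ n * ∫⁻ x, g' x ∂(Pt ω) ∂P := by
  rw [← hPt.lintegral_prod_erase hX hg hg' (Nat.lt_succ_self n),
    Finset.range_add_one, Finset.erase_insert Finset.notMem_range_self]

/-- The predictive rule, in terms of moments of the directing measure. On the event that the
product does not vanish no observation lies in the null set, so that the total mass of the
reinforcement is the number of observations; and each reinforcement is constant on its class. -/
lemma IsMVPS.lintegral_moment (h : IsMVPS P X θ ν R) (hR : IsCanonical R)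
    (hPt : IsDirecting P X Pt) (hc : ν (nullPart R)ᶜ ≠ 0) {f : 𝕏 → ℝ≥0∞} (hf : Measurable f)
    {k : ℕ} (hk : k ≠ 0) (n : ℕ) :
    (ENNReal.ofReal θ + (n + 1 : ℕ)) * ∫⁻ ω, (∫⁻ x, ∫⁻ z, f z ∂(offNull R x) ∂(Pt ω)) ^ (n + 1) *
        ∫⁻ x, (∫⁻ z, f z ∂(offNull R x)) ^ k ∂(Pt ω) ∂P =
      ENNReal.ofReal θ * ((∫⁻ x, (∫⁻ z, f z ∂(offNull R x)) ^ k ∂ν) *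
        ∫⁻ ω, (∫⁻ x, ∫⁻ z, f z ∂(offNull R x) ∂(Pt ω)) ^ (n + 1) ∂P) +
      (n + 1 : ℕ) * (ν (nullPart R)ᶜ * ∫⁻ ω, (∫⁻ x, ∫⁻ z, f z ∂(offNull R x) ∂(Pt ω)) ^ n *
        ∫⁻ x, (∫⁻ z, f z ∂(offNull R x)) ^ (k + 1) ∂(Pt ω) ∂P) := by
  set g : 𝕏 → ℝ≥0∞ := fun x => ∫⁻ z, f z ∂(offNull R x) with hgdef
  have hg : Measurable g := hf.lintegral_kernel
  set c := ν (nullPart R)ᶜ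
  have hs0 : ENNReal.ofReal θ + (n + 1 : ℕ) ≠ 0 := by simp
  have hst : ENNReal.ofReal θ + (n + 1 : ℕ) ≠ ∞ := by simp
  have mX : ∀ j, Measurable fun ω => g (X j ω) := fun j => hg.comp (h.measurable j)
  have mprod : ∀ s : Finset ℕ, Measurable fun ω => ∏ j ∈ s, g (X j ω) := fun s =>
    Finset.measurable_fun_prod s fun j _ => mX j
  have mi : ∀ i, Measurable fun ω => (∏ j ∈ (Finset.range (n + 1)).erase i, g (X j ω)) *
      g (X i ω) ^ (k + 1) := fun i => (mprod _).mul ((mX i).pow_const _)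
  have e1 := h.lintegral_predictive (n := n + 1) (by omega)
    (F := fun p => (∏ j, g (p.1 j)) * g p.2 ^ k) (by fun_prop)
  have e2 : ∀ ω, ∏ j : Fin (n + 1), g (X j ω) = ∏ j ∈ Finset.range (n + 1), g (X j ω) := fun ω =>
    Fin.prod_univ_eq_prod_range (fun j => g (X j ω)) (n + 1)
  simp only [e2] at e1
  rw [hPt.lintegral_prod_mul h.measurable hg (hg.pow_const k)] at e1
  have e3 : ∀ᵐ ω ∂P, (ENNReal.ofReal θ + ∑ i ∈ Finset.range (n + 1), R (X i ω) Set.univ)⁻¹ *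
      (ENNReal.ofReal θ * ∫⁻ y, (∏ j ∈ Finset.range (n + 1), g (X j ω)) * g y ^ k ∂ν +
        ∑ i ∈ Finset.range (n + 1),
          ∫⁻ y, (∏ j ∈ Finset.range (n + 1), g (X j ω)) * g y ^ k ∂(R (X i ω))) =
      (ENNReal.ofReal θ + (n + 1 : ℕ))⁻¹ *
        (ENNReal.ofReal θ * ((∏ j ∈ Finset.range (n + 1), g (X j ω)) * ∫⁻ y, g y ^ k ∂ν) +
        ∑ i ∈ Finset.range (n + 1), c *
          ((∏ j ∈ (Finset.range (n + 1)).erase i, g (X j ω)) * g (X i ω) ^ (k + 1))) := by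
    filter_upwards [hPt.ae_of_ae_apply h (h.ae_isRegularPoint hR hPt hc)] with ω hω
    by_cases hZ : ∃ i ∈ Finset.range (n + 1), X i ω ∈ nullPart R
    · have hg0 : ∀ i, X i ω ∈ nullPart R → g (X i ω) = 0 := fun i hi => by
        simp [hgdef, offNull_eq_zero_of_mem hi]
      obtain ⟨i, hi, hiZ⟩ := hZ
      have h0 : ∏ j ∈ Finset.range (n + 1), g (X j ω) = 0 := Finset.prod_eq_zero hi (hg0 i hiZ)
      have h0' : ∀ j ∈ Finset.range (n + 1), c * ((∏ j' ∈ (Finset.range (n + 1)).erase j,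
          g (X j' ω)) * g (X j ω) ^ (k + 1)) = 0 := by
        intro j hj
        by_cases hij : j = i
        · rw [hij, hg0 i hiZ]
          simp
        · rw [Finset.prod_eq_zero (Finset.mem_erase.2 ⟨fun h => hij h.symm, hi⟩) (hg0 i hiZ)]
          simp
      rw [Finset.sum_eq_zero h0']
      simp [h0]
    · push Not at hZ
      have hR1 : ∑ i ∈ Finset.range (n + 1), R (X i ω) Set.univ = ((n + 1 : ℕ) : ℝ≥0∞) := by
        rw [Finset.sum_congr rfl fun i hi => hR (X i ω) (hZ i hi)]
        simp
      rw [hR1, lintegral_const_mul _ (hg.pow_const k)]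
      congr 2
      refine Finset.sum_congr rfl fun i hi => ?_
      rw [lintegral_const_mul _ (hg.pow_const k), (hω i (hZ i hi)).lintegral_pow hc f hk,
        ← Finset.mul_prod_erase _ _ hi]
      ring
  have mtot : Measurable fun ω =>
      ENNReal.ofReal θ * ((∏ j ∈ Finset.range (n + 1), g (X j ω)) * ∫⁻ y, g y ^ k ∂ν) +
        ∑ i ∈ Finset.range (n + 1), c *
          ((∏ j ∈ (Finset.range (n + 1)).erase i, g (X j ω)) * g (X i ω) ^ (k + 1)) :=
    (((mprod _).mul_const _).const_mul _).add (Finset.measurable_fun_sum _ fun i _ =>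
      (mi i).const_mul c)
  rw [e1, lintegral_congr_ae e3, lintegral_const_mul _ mtot, ← mul_assoc, ENNReal.mul_inv_cancel hs0 hst, one_mul, lintegral_add_left
    (((mprod _).mul_const _).const_mul _), lintegral_const_mul _ ((mprod _).mul_const _), lintegral_mul_const _ (mprod _),
    lintegral_finsetSum _ fun i _ => (mi i).const_mul c]
  congr 1
  · have h2 := hPt.lintegral_prod h.measurable (n + 1) (f := fun _ => g) fun _ => hg
    simp only [Finset.prod_const, Finset.card_range] at h2
    rw [h2, mul_comm (∫⁻ y, g y ^ k ∂ν)]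
  · rw [Finset.sum_congr rfl fun i hi => by
      rw [lintegral_const_mul _ (mi i), hPt.lintegral_prod_erase h.measurable hg
        (hg.pow_const (k + 1)) (Finset.mem_range.1 hi)]]
    rw [Finset.sum_const, Finset.card_range, nsmul_eq_mul]

lemma cond_measurable {s : Set 𝕏} (hs : MeasurableSet s) :
    Measurable fun m : Measure 𝕏 => ProbabilityTheory.cond m s := by
  refine Measure.measurable_of_measurable_coe _ fun A hA => ?_
  simp_rw [cond_apply hs]
  exact (Measure.measurable_coe hs).inv.mul (Measure.measurable_coe (hs.inter hA))

lemma IsTypical.lintegral_cond {μ : Measure 𝕏} [IsProbabilityMeasure μ] (hμ : IsTypical ν R μ)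
    {f : 𝕏 → ℝ≥0∞} (hf : Measurable f) :
    ∫⁻ x, f x ∂(ProbabilityTheory.cond μ (nullPart R)ᶜ) =
      (ν (nullPart R)ᶜ)⁻¹ * ∫⁻ x, ∫⁻ z, f z ∂(offNull R x) ∂μ := by
  rw [ProbabilityTheory.cond, lintegral_smul_measure, hμ.apply_compl, hμ.bind_offNull,
    Measure.lintegral_bind (offNull R).aemeasurable hf.aemeasurable, smul_eq_mul]

/-- The moments of the normalised restriction of the directing measure satisfy the same recursion
as those of the stick-breaking sum. -/
lemma IsMVPS.momentRecursion (h : IsMVPS P X θ ν R) (hR : IsCanonical R)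
    (hPt : IsDirecting P X Pt) (hc : ν (nullPart R)ᶜ ≠ 0) {f : 𝕏 → ℝ≥0∞} (hf : Measurable f)
    (hf1 : ∀ x, f x ≤ 1) :
    MomentRecursion θ
      (fun k => (∫⁻ x, (∫⁻ z, f z ∂(offNull R x)) ^ k
        ∂(ProbabilityTheory.cond ν (nullPart R)ᶜ)).toReal)
      (fun n => (∫⁻ ω, (∫⁻ x, f x ∂(ProbabilityTheory.cond (Pt ω) (nullPart R)ᶜ)) ^ n ∂P).toReal) := by
  have hθ := h.theta_pos
  set g : 𝕏 → ℝ≥0∞ := fun x => ∫⁻ z, f z ∂(offNull R x) with hgdef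
  have hg : Measurable g := hf.lintegral_kernel
  set c := ν (nullPart R)ᶜ with hcdef
  have hct : c ≠ ∞ := measure_ne_top ν _
  have hg1 : ∀ x, g x ≤ 1 := fun x => (lintegral_mono hf1).trans (by
    simpa using offNull_apply_le_one x Set.univ)
  have hgk : ∀ (k : ℕ) (m : Measure 𝕏) [IsProbabilityMeasure m], ∫⁻ x, g x ^ k ∂m ≤ 1 :=
    fun k m _ => (lintegral_mono fun x => pow_le_one' (hg1 x) k).trans (by simp)
  have hg1' : ∀ ω, ∫⁻ x, g x ∂(Pt ω) ≤ 1 := fun ω => by simpa using hgk 1 (Pt ω)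
  have mG : ∀ k, Measurable fun ω => ∫⁻ x, g x ^ k ∂(Pt ω) := fun k =>
    (hg.pow_const k).lintegral_kernel
  have mG1 : Measurable fun ω => ∫⁻ x, g x ∂(Pt ω) := hg.lintegral_kernel
  set A : ℕ → ℝ≥0∞ := fun n => ∫⁻ ω, (∫⁻ x, g x ∂(Pt ω)) ^ n ∂P with hA
  set L : ℕ → ℕ → ℝ≥0∞ := fun k n => ∫⁻ ω, (∫⁻ x, g x ∂(Pt ω)) ^ n * ∫⁻ x, g x ^ k ∂(Pt ω) ∂P
    with hL
  have hAt : ∀ n, A n ≠ ∞ := fun n => ((lintegral_mono fun ω =>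
    pow_le_one' (hg1' ω) n).trans_lt (by simp)).ne
  have hLt : ∀ k n, L k n ≠ ∞ := fun k n => ((lintegral_mono fun ω =>
    mul_le_one' (pow_le_one' (hg1' ω) n) (hgk k (Pt ω))).trans_lt (by simp)).ne
  have hq : ∀ k, k ≠ 0 → ∫⁻ x, g x ^ k ∂(ProbabilityTheory.cond ν (nullPart R)ᶜ) =
      c⁻¹ * ∫⁻ x, g x ^ k ∂ν := by
    intro k hk
    rw [ProbabilityTheory.cond, lintegral_smul_measure, smul_eq_mul,
      ← lintegral_add_compl (μ := ν) (fun x => g x ^ k) (measurableSet_nullPart R),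
      setLIntegral_congr_fun (g := fun _ => 0) (f := fun x => g x ^ k) (measurableSet_nullPart R)
        fun x hx => by simp [hgdef, offNull_eq_zero_of_mem hx, hk]]
    simp [hcdef]
  have ha : ∀ n, ∫⁻ ω, (∫⁻ x, f x ∂(ProbabilityTheory.cond (Pt ω) (nullPart R)ᶜ)) ^ n ∂P =
      c⁻¹ ^ n * A n := by
    intro n
    rw [hA, ← lintegral_const_mul _ (mG1.pow_const n)]
    refine lintegral_congr_ae ((h.ae_isTypical hR hPt hc).mono fun ω hω => ?_)
    simp only
    rw [hω.lintegral_cond hf, mul_pow]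
  have hL0 : ∀ k, L k 0 = ∫⁻ x, g x ^ k ∂ν := by
    intro k
    have h1 := hPt.lintegral_prod_mul h.measurable hg (hg.pow_const k) 0
    simp only [Finset.range_zero, Finset.prod_empty, one_mul] at h1
    rw [hL]
    simp only
    rw [← h1, ← h.law_zero, lintegral_map (hg.pow_const k) (h.measurable 0)]
  have hc' : c.toReal ≠ 0 := (ENNReal.toReal_pos hc hct).ne'
  simp only [ha]
  refine momentRecursion_of_predictive
    (l := fun k n => (c⁻¹ ^ (n + 1) * L k n).toReal) (fun n => ?_) (fun k hk => ?_)
    fun k n hk => ?_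
  · simp only [hA, hL, pow_one]
    simp_rw [pow_succ (_ : ℝ≥0∞) n]
  · have hA0 : A 0 = 1 := by simp [hA]
    rw [hq k (by omega), hL0 k, hA0]
    simp
  · have hm := congrArg ENNReal.toReal (h.lintegral_moment hR hPt hc hf (k := k) (by omega) n)
    change ((ENNReal.ofReal θ + (n + 1 : ℕ)) * L k (n + 1)).toReal =
      (ENNReal.ofReal θ * ((∫⁻ x, g x ^ k ∂ν) * A (n + 1)) +
        (n + 1 : ℕ) * (c * L (k + 1) n)).toReal at hm
    have hqt : ∫⁻ x, g x ^ k ∂ν ≠ ∞ := ((hgk k ν).trans_lt ENNReal.one_lt_top).ne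
    rw [ENNReal.toReal_add (ENNReal.mul_ne_top ENNReal.ofReal_ne_top
      (ENNReal.mul_ne_top hqt (hAt _))) (ENNReal.mul_ne_top (ENNReal.natCast_ne_top _)
      (ENNReal.mul_ne_top hct (hLt _ _)))] at hm
    simp only [ENNReal.toReal_mul] at hm
    rw [ENNReal.toReal_add ENNReal.ofReal_ne_top (ENNReal.natCast_ne_top _),
      ENNReal.toReal_ofReal hθ.le, ENNReal.toReal_natCast] at hm
    have hqk := congrArg ENNReal.toReal (hq k (by omega))
    simp only [ENNReal.toReal_mul, ENNReal.toReal_inv] at hqk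
    simp only [hgdef] at hqk hm ⊢
    simp only [hqk, ENNReal.toReal_mul, ENNReal.toReal_pow, ENNReal.toReal_inv]
    have h3 : (θ + (n + 1 : ℕ)) * (c.toReal⁻¹ ^ (n + 1 + 1) * (L k (n + 1)).toReal) =
        c.toReal⁻¹ ^ (n + 1 + 1) * ((θ + (n + 1 : ℕ)) * (L k (n + 1)).toReal) := by ring
    rw [h3, hm, pow_succ _ (n + 1)]
    field_simp

/-- The law of the normalised restriction of the directing measure. -/
theorem IsMVPS.map_cond_directing (h : IsMVPS P X θ ν R) (hR : IsCanonical R)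
    (hPt : IsDirecting P X Pt) (hc : ν (nullPart R)ᶜ ≠ 0) :
    P.map (fun ω => ProbabilityTheory.cond (Pt ω) (nullPart R)ᶜ) =
      stickBreakingLaw θ (ProbabilityTheory.cond ν (nullPart R)ᶜ) (offNull R) := by
  have hZ := (measurableSet_nullPart R).compl
  have hθ := h.theta_pos
  have hm : Measurable fun ω => ProbabilityTheory.cond (Pt ω) (nullPart R)ᶜ :=
    (cond_measurable hZ).comp Pt.measurable
  have := cond_isProbabilityMeasure hc
  have := Measure.isProbabilityMeasure_map (μ := P) hm.aemeasurable
  have := isProbabilityMeasure_stickBreakingLaw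
    (μ := ProbabilityTheory.cond ν (nullPart R)ᶜ) hθ (offNull R).measurable
  have hK1 : ∀ᵐ x ∂(ProbabilityTheory.cond ν (nullPart R)ᶜ), offNull R x Set.univ = 1 := by
    filter_upwards [cond_absolutelyContinuous.ae_le (h.ae_isRegularPoint hR hPt hc),
      ae_cond_mem hZ] with x hx hxZ
    exact (hx hxZ).isProbabilityMeasure_offNull hc |>.measure_univ
  have hms : MeasurableSet {m : Measure 𝕏 | IsProbabilityMeasure m} := by
    simp_rw [isProbabilityMeasure_iff]
    exact Measure.measurable_coe MeasurableSet.univ (measurableSet_singleton 1)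
  refine eq_of_moments ?_ (ae_isProbabilityMeasure_stickBreakingLaw hθ (offNull R).measurable hK1)
    fun f hf hf1 n => ?_
  · rw [ae_map_iff hm.aemeasurable hms]
    filter_upwards [h.ae_isTypical hR hPt hc] with ω hω
    exact cond_isProbabilityMeasure (by rwa [hω.apply_compl])
  · have e1 : ∀ n, ∫⁻ m, (∫⁻ x, f x ∂m) ^ n
        ∂(P.map fun ω => ProbabilityTheory.cond (Pt ω) (nullPart R)ᶜ) =
        ∫⁻ ω, (∫⁻ x, f x ∂(ProbabilityTheory.cond (Pt ω) (nullPart R)ᶜ)) ^ n ∂P := fun n =>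
      lintegral_map ((Measure.measurable_lintegral hf).pow_const n) hm
    have r1 := h.momentRecursion hR hPt hc hf hf1
    have r2 := momentRecursion_stickBreakingLaw (μ := ProbabilityTheory.cond ν (nullPart R)ᶜ) hθ
      (offNull R).measurable hK1 hf hf1
    have hun := r1.unique hθ r2 (by simp) n
    have hone : ∀ m : Measure 𝕏, m Set.univ ≤ 1 → (∫⁻ x, f x ∂m) ^ n ≤ 1 := fun m hm1 =>
      pow_le_one' ((lintegral_mono hf1).trans (by simpa using hm1)) n
    rw [e1]
    refine (ENNReal.toReal_eq_toReal_iff' ?_ ?_).1 hun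
    · refine ((lintegral_mono fun ω => hone _ prob_le_one).trans_lt (by simp)).ne
    · refine ((lintegral_mono_ae ((ae_isProbabilityMeasure_stickBreakingLaw hθ
        (offNull R).measurable hK1).mono fun m hm1 => hone m prob_le_one)).trans_lt (by simp)).ne

/-- The directing measure charges the null set by the base measure. -/
theorem IsMVPS.ae_directing_eq_add (h : IsMVPS P X θ ν R) (hR : IsCanonical R)
    (hPt : IsDirecting P X Pt) (hc : ν (nullPart R)ᶜ ≠ 0) (h0 : ν (nullPart R) ≠ 0) :
    ∀ᵐ ω ∂P, Pt ω = ν (nullPart R)ᶜ • ProbabilityTheory.cond (Pt ω) (nullPart R)ᶜ +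
      ν (nullPart R) • ProbabilityTheory.cond ν (nullPart R) := by
  filter_upwards [h.ae_isTypical hR hPt hc] with ω hω
  rw [ProbabilityTheory.cond, ProbabilityTheory.cond, smul_smul, smul_smul, hω.apply_compl,
    ENNReal.mul_inv_cancel hc (measure_ne_top ν _), ENNReal.mul_inv_cancel h0 (measure_ne_top ν _),
    one_smul, one_smul, ← hω.restrict_nullPart, add_comm,
    Measure.restrict_add_restrict_compl (measurableSet_nullPart R)]

end DirectingLaw

/-! ### The reinforcement as a parameter -/

section Parameter

variable {𝕏 : Type*} [MeasurableSpace 𝕏] [StandardBorelSpace 𝕏] [Nonempty 𝕏]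
  {θ : ℝ} {ν : Measure 𝕏} [IsProbabilityMeasure ν] {R : Kernel 𝕏 𝕏}

/-- The space of reinforcements: the values of the kernel `R`, with the σ-algebra generated by the
evaluations. -/
abbrev ClassSpace (R : Kernel 𝕏 𝕏) : Type _ := Set.range (fun x => R x)

/-- The parameter of the hierarchical model: the reinforcement caused by an observation. Two
observations have the same parameter exactly when they lie in the same class `fiber R x`. -/
def toClass (R : Kernel 𝕏 𝕏) (x : 𝕏) : ClassSpace R := ⟨R x, x, rfl⟩

instance : Nonempty (ClassSpace R) := ⟨toClass R (Classical.arbitrary 𝕏)⟩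

lemma measurable_toClass : Measurable (toClass R) := R.measurable.subtype_mk

lemma toClass_eq_iff {x y : 𝕏} : toClass R x = toClass R y ↔ R x = R y := Subtype.ext_iff

lemma IsCanonical.isFiniteMeasure_class (hR : IsCanonical R) (t : ClassSpace R) :
    IsFiniteMeasure t.1 := by
  have := hR.isFiniteKernel
  obtain ⟨_, x, rfl⟩ := t
  exact inferInstanceAs (IsFiniteMeasure (R x))

lemma image_toClass_compl :
    toClass R '' (nullPart R)ᶜ = {t : ClassSpace R | t.1 Set.univ ≠ 0} := by
  ext t
  constructor
  · rintro ⟨x, hx, rfl⟩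
    exact hx
  · intro ht
    obtain ⟨_, x, rfl⟩ := t
    exact ⟨x, ht, rfl⟩

lemma measurableSet_image_toClass_compl : MeasurableSet (toClass R '' (nullPart R)ᶜ) := by
  rw [image_toClass_compl]
  exact ((Measure.measurable_coe MeasurableSet.univ).comp measurable_subtype_coe)
    (measurableSet_singleton 0).compl

lemma preimage_image_toClass_compl :
    toClass R ⁻¹' (toClass R '' (nullPart R)ᶜ) = (nullPart R)ᶜ := by
  rw [image_toClass_compl]
  rfl

/-- The reinforcements are finite measures on a countably generated space, hence determined by
countably many evaluations. -/
lemma IsCanonical.countablyGenerated_classSpace (hR : IsCanonical R) :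
    MeasurableSpace.CountablyGenerated (ClassSpace R) := by
  have hfin := hR.isFiniteMeasure_class
  let b := MeasurableSpace.countableGeneratingSet ℝ≥0∞
  let C : Set (Set (ClassSpace R)) :=
    ⋃ A ∈ countableAlgebra 𝕏, (fun B : Set ℝ≥0∞ => (fun t : ClassSpace R => t.1 A) ⁻¹' B) '' b
  have hC : C.Countable := countable_countableAlgebra.biUnion fun A _ =>
    (MeasurableSpace.countable_countableGeneratingSet (α := ℝ≥0∞)).image _
  have hgen : (inferInstance : MeasurableSpace (ClassSpace R)) = MeasurableSpace.generateFrom C := by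
    refine le_antisymm ?_ (MeasurableSpace.generateFrom_le ?_)
    · have hbasic : ∀ A ∈ countableAlgebra 𝕏,
          Measurable[MeasurableSpace.generateFrom C] fun t : ClassSpace R => t.1 A := by
        intro A hA
        refine measurable_iff_comap_le.2 ?_
        calc MeasurableSpace.comap (fun t : ClassSpace R => t.1 A) inferInstance
            = MeasurableSpace.comap (fun t : ClassSpace R => t.1 A)
                (MeasurableSpace.generateFrom b) := by
              rw [MeasurableSpace.generateFrom_countableGeneratingSet]
          _ ≤ _ := by
              rw [MeasurableSpace.comap_generateFrom]
              exact MeasurableSpace.generateFrom_mono (Set.subset_biUnion_of_mem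
                (u := fun A => (fun B : Set ℝ≥0∞ => (fun t : ClassSpace R => t.1 A) ⁻¹' B) '' b) hA)
      have halg : IsSetAlgebra (countableAlgebra 𝕏) := isSetAlgebra_generateSetAlgebra
      exact measurable_iff_comap_le.1 (@Measurable.measure_of_isPiSystem _ _
        (MeasurableSpace.generateFrom C) _ (fun t : ClassSpace R => t.1) hfin _
        generateFrom_countableAlgebra.symm halg.isSetRing.isSetSemiring.isPiSystem hbasic
        (hbasic _ halg.univ_mem))
    · intro s hs
      obtain ⟨A, hA, B, hB, rfl⟩ := Set.mem_iUnion₂.1 hs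
      exact ((Measure.measurable_coe (measurableSet_of_mem_countableAlgebra hA)).comp
        measurable_subtype_coe) (MeasurableSpace.measurableSet_countableGeneratingSet hB)
  exact ⟨C, hC, hgen⟩

lemma isParameter_toClass (hR : IsCanonical R) : IsParameter ν (toClass R) where
  measurable := measurable_toClass
  singleton := by
    refine Eventually.of_forall fun t => ?_
    have h := measurableSet_eq_measure (measurable_subtype_coe (p := (· ∈ Set.range fun x => R x)))
      (measurable_const (a := t.1)) fun t => hR.isFiniteMeasure_class t
    convert h using 1
    ext t'
    exact Subtype.ext_iff
  countablyGenerated := by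
    refine ⟨Set.univ, MeasurableSet.univ, measure_univ, ?_⟩
    have := hR.countablyGenerated_classSpace
    exact @MeasurableSpace.CountablyGenerated.comap _ _ (MeasurableSpace.comap (toClass R)
      inferInstance) (MeasurableSpace.CountablyGenerated.comap _) _

lemma isTypical_self {Ω : Type*} [MeasurableSpace Ω] {P : Measure Ω} [IsProbabilityMeasure P]
    {X : ℕ → Ω → 𝕏} {Pt : Kernel Ω 𝕏} [IsMarkovKernel Pt] (h : IsMVPS P X θ ν R)
    (hR : IsCanonical R) (hPt : IsDirecting P X Pt) (hc : ν (nullPart R)ᶜ ≠ 0) :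
    IsTypical ν R ν :=
  ⟨rfl, (h.bind_offNull hR hPt hc).symm, h.ae_isRegularPoint hR hPt hc⟩

variable {μ : Measure 𝕏}

lemma IsTypical.lintegral_compl (hμ : IsTypical ν R μ) {b : ClassSpace R → ℝ≥0∞}
    (hb : Measurable b) {A : Set 𝕏} (hA : MeasurableSet A) :
    ∫⁻ x in (nullPart R)ᶜ, b (toClass R x) * A.indicator 1 x ∂μ =
      ∫⁻ x in (nullPart R)ᶜ, b (toClass R x) * offNull R x A ∂μ := by
  have mb : Measurable fun x => b (toClass R x) * A.indicator 1 x :=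
    (hb.comp measurable_toClass).mul (measurable_one.indicator hA)
  rw [hμ.bind_offNull, Measure.lintegral_bind (offNull R).aemeasurable mb.aemeasurable,
    ← hμ.bind_offNull, ← lintegral_add_compl _ (measurableSet_nullPart R),
    setLIntegral_congr_fun (g := fun _ => 0) (measurableSet_nullPart R) fun x hx => by
      simp [offNull_eq_zero_of_mem hx], lintegral_zero, zero_add]
  refine setLIntegral_congr_fun_ae (measurableSet_nullPart R).compl ?_
  filter_upwards [hμ.ae_isRegularPoint] with x hx hxZ
  rw [lintegral_congr_ae ((hx hxZ).ae_mem_fiber.mono fun y hy => by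
    rw [toClass_eq_iff.2 (show R y = R x from hy)]),
    lintegral_const_mul _ (measurable_one.indicator hA), lintegral_indicator_one hA]

/-- The conditional law of an observation given its parameter. -/
def classKernel (ν : Measure 𝕏) (R : Kernel 𝕏 𝕏) : Kernel (ClassSpace R) 𝕏 := by
  classical
  exact Kernel.piecewise (s := toClass R '' (nullPart R)ᶜ) measurableSet_image_toClass_compl
    ⟨fun t => ProbabilityTheory.cond t.1 (nullPart R)ᶜ,
      (cond_measurable (measurableSet_nullPart R).compl).comp measurable_subtype_coe⟩
    (Kernel.const _ (ProbabilityTheory.cond ν (nullPart R)))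

lemma classKernel_toClass_of_notMem {x : 𝕏} (hx : x ∈ (nullPart R)ᶜ) :
    classKernel ν R (toClass R x) = offNull R x := by
  classical
  exact (Kernel.piecewise_apply ..).trans (if_pos ⟨x, hx, rfl⟩)

lemma classKernel_toClass_of_mem {x : 𝕏} (hx : x ∈ nullPart R) :
    classKernel ν R (toClass R x) = ProbabilityTheory.cond ν (nullPart R) := by
  classical
  refine (Kernel.piecewise_apply ..).trans (if_neg fun h => ?_)
  have : x ∈ (nullPart R)ᶜ := by rwa [← preimage_image_toClass_compl]
  exact this hx

instance : IsFiniteKernel (classKernel ν R) := by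
  refine ⟨1, ENNReal.one_lt_top, ?_⟩
  rintro ⟨_, x, rfl⟩
  by_cases hx : x ∈ nullPart R
  · exact (congrArg (fun m : Measure 𝕏 => m Set.univ) (classKernel_toClass_of_mem hx)).trans_le
      prob_le_one
  · exact (congrArg (fun m : Measure 𝕏 => m Set.univ)
      (classKernel_toClass_of_notMem hx)).trans_le (offNull_apply_le_one x _)

/-- The regular conditional distribution of the identity given the parameter is the normalised
reinforcement on each class, and the conditioned base measure on the null set. -/
lemma condDistrib_toClass (hν : IsTypical ν R ν) :
    condDistrib id (toClass R) ν =ᵐ[ν.map (toClass R)] classKernel ν R := by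
  have hZ := measurableSet_nullPart R
  refine condDistrib_ae_eq_of_measure_eq_compProd (toClass R) measurable_id.aemeasurable ?_
  have mpair : Measurable fun x => (toClass R x, id x) := measurable_toClass.prodMk measurable_id
  have := Measure.isProbabilityMeasure_map (μ := ν) mpair.aemeasurable
  refine Measure.ext_prod fun {s A} hs hA => ?_
  have hs' : MeasurableSet (toClass R ⁻¹' s) := measurable_toClass hs
  have mb : Measurable (s.indicator (1 : ClassSpace R → ℝ≥0∞)) := measurable_one.indicator hs
  rw [Measure.map_apply mpair (hs.prod hA), Measure.compProd_apply_prod hs hA,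
    setLIntegral_map hs ((classKernel ν R).measurable_coe hA) measurable_toClass]
  change ν (toClass R ⁻¹' s ∩ A) = _
  rw [← lintegral_indicator_one (hs'.inter hA), ← lintegral_indicator hs',
    ← lintegral_add_compl _ hZ, ← lintegral_add_compl (μ := ν) ((toClass R ⁻¹' s).indicator _) hZ]
  congr 1
  · by_cases hne : (nullPart R ∩ toClass R ⁻¹' s).Nonempty
    · obtain ⟨x, hxZ, hxs⟩ := hne
      have hall : ∀ y ∈ nullPart R, y ∈ toClass R ⁻¹' s := by
        intro y hy
        have : toClass R y = toClass R x := toClass_eq_iff.2 (by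
          rw [eq_zero_of_mem_nullPart hxZ, eq_zero_of_mem_nullPart hy])
        rw [Set.mem_preimage, this]
        exact hxs
      have e1 : ∫⁻ y in nullPart R, (toClass R ⁻¹' s ∩ A).indicator 1 y ∂ν =
          ν (nullPart R ∩ A) := by
        rw [lintegral_indicator_one (hs'.inter hA), Measure.restrict_apply (hs'.inter hA)]
        congr 1
        ext y
        exact ⟨fun h => ⟨h.2, h.1.2⟩, fun h => ⟨⟨hall y h.1, h.2⟩, h.1⟩⟩
      have e2 : ∫⁻ y in nullPart R,
          (toClass R ⁻¹' s).indicator (fun y => classKernel ν R (toClass R y) A) y ∂ν =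
          ∫⁻ _ in nullPart R, ProbabilityTheory.cond ν (nullPart R) A ∂ν := by
        refine setLIntegral_congr_fun hZ fun y hy => ?_
        rw [Set.indicator_of_mem (hall y hy), classKernel_toClass_of_mem hy]
      rw [e1, e2, setLIntegral_const, cond_mul_eq_inter hZ]
    · have hall : ∀ y ∈ nullPart R, y ∉ toClass R ⁻¹' s := fun y hy hys => hne ⟨y, hy, hys⟩
      refine setLIntegral_congr_fun hZ fun y hy => ?_
      rw [Set.indicator_of_notMem (hall y hy), Set.indicator_of_notMem fun h => hall y hy h.1]
  · have h1 := hν.lintegral_compl mb hA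
    convert h1 using 1
    · refine lintegral_congr fun x => ?_
      by_cases hxs : toClass R x ∈ s <;> by_cases hxA : x ∈ A <;> simp [hxs, hxA]
    · refine setLIntegral_congr_fun hZ.compl fun x hx => ?_
      rw [← classKernel_toClass_of_notMem (ν := ν) hx]
      by_cases hxs : toClass R x ∈ s <;> simp [hxs]

lemma ae_condDistrib_toClass (hν : IsTypical ν R ν) :
    ∀ᵐ x ∂ν, x ∈ (nullPart R)ᶜ → condDistrib id (toClass R) ν (toClass R x) = offNull R x := by
  filter_upwards [ae_of_ae_map measurable_toClass.aemeasurable (condDistrib_toClass hν)]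
    with x hx hxZ
  rw [hx, classKernel_toClass_of_notMem hxZ]

lemma cond_map_toClass :
    ProbabilityTheory.cond (ν.map (toClass R)) (toClass R '' (nullPart R)ᶜ) =
      (ProbabilityTheory.cond ν (nullPart R)ᶜ).map (toClass R) := by
  have hU := measurableSet_image_toClass_compl (R := R)
  ext s hs
  rw [cond_apply hU, Measure.map_apply measurable_toClass hU,
    Measure.map_apply measurable_toClass (hU.inter hs), Set.preimage_inter,
    preimage_image_toClass_compl, Measure.map_apply measurable_toClass hs,
    cond_apply (measurableSet_nullPart R).compl]

/-- Collapsing each class to its parameter turns the stick-breaking sum of normalised reinforcements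
into a Dirichlet process. -/
lemma map_stickBreakingLaw_offNull (hθ : 0 < θ) (hν : IsTypical ν R ν)
    (hc : ν (nullPart R)ᶜ ≠ 0) :
    (stickBreakingLaw θ (ProbabilityTheory.cond ν (nullPart R)ᶜ) (offNull R)).map
        (fun m => m.map (toClass R)) =
      dirichletProcess θ ((ProbabilityTheory.cond ν (nullPart R)ᶜ).map (toClass R)) := by
  have := isProbabilityMeasureBeta one_pos hθ
  have := cond_isProbabilityMeasure hc
  set ν' := ProbabilityTheory.cond ν (nullPart R)ᶜ with hν'
  have hπ := measurable_toClass (R := R)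
  have := Measure.isProbabilityMeasure_map (μ := ν') hπ.aemeasurable
  have mpi : Measurable fun (u : ℕ → 𝕏) i => toClass R (u i) :=
    measurable_pi_lambda _ fun i => hπ.comp (measurable_pi_apply i)
  have hatom : ∀ᵐ x ∂ν', (offNull R x).map (toClass R) = Measure.dirac (toClass R x) := by
    filter_upwards [cond_absolutelyContinuous.ae_le hν.ae_isRegularPoint,
      ae_cond_mem (measurableSet_nullPart R).compl] with x hx hxZ
    have := (hx hxZ).isProbabilityMeasure_offNull hc
    rw [Measure.map_congr ((hx hxZ).ae_mem_fiber.mono fun y hy =>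
      toClass_eq_iff.2 (show R y = R x from hy) : toClass R =ᵐ[offNull R x] fun _ => toClass R x),
      Measure.map_const, measure_univ, one_smul]
  have hin : stickInput θ (ν'.map (toClass R)) =
      (stickInput θ ν').map (Prod.map id fun u i => toClass R (u i)) := by
    rw [stickInput, stickInput, ← Measure.map_prod_map _ _ measurable_id mpi, Measure.map_id,
      Measure.infinitePi_map_pi (fun _ : ℕ => ν') (f := fun _ => toClass R) fun _ => hπ]
  rw [dirichletProcess, stickBreakingLaw, stickBreakingLaw]
  change _ = (stickInput θ (ν'.map (toClass R))).map _
  rw [hin, Measure.map_map (Measure.measurable_map _ hπ) (measurable_stickSum (offNull R).measurable),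
    Measure.map_map (measurable_stickSum Measure.measurable_dirac) (measurable_id.prodMap mpi)]
  refine Measure.map_congr ?_
  filter_upwards [Measure.quasiMeasurePreserving_snd.ae (ae_infinitePi_of_ae hatom)] with p hp
  simp only [Function.comp_apply, stickSum, Prod.map_fst, Prod.map_snd, id_eq]
  rw [Measure.map_sum hπ.aemeasurable]
  congr 1
  funext j
  rw [Measure.map_smul, hp j]

end Parameter

/-! ### The hierarchical representation -/

section Extension

variable {Ω E S T : Type*} [MeasurableSpace Ω] [MeasurableSpace E] [MeasurableSpace S]
  [MeasurableSpace T] {P : Measure Ω} [IsProbabilityMeasure P] {M : Ω → E} {K : Kernel E S}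
  [IsMarkovKernel K] {Y : ℕ → Ω → S}

lemma measurable_prod_apply (n : ℕ) {f : ℕ → S → ℝ≥0∞} (hf : ∀ i, Measurable (f i)) :
    Measurable fun y : ℕ → S => ∏ i ∈ Finset.range n, f i (y i) :=
  Finset.measurable_fun_prod _ fun i _ => (hf i).comp (measurable_pi_apply i)

/-- Extending the probability space by a sequence that is conditionally i.i.d. and independent of
a given conditionally i.i.d. sequence produces conditionally i.i.d. pairs. -/
lemma IsMixedIID.extend (h : IsMixedIID P M K Y) (q : Kernel E T) [IsMarkovKernel q] :
    IsMixedIID (P ⊗ₘ iidKernel (q.comap M h.measurable_param)) (fun ω => M ω.1) (K ×ₖ q)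
      (fun n ω => (Y n ω.1, ω.2 n)) := by
  have hM := h.measurable_param
  have hM' : Measurable fun ω : Ω × (ℕ → T) => M ω.1 := hM.comp measurable_fst
  have hY' : ∀ n, Measurable fun ω : Ω × (ℕ → T) => (Y n ω.1, ω.2 n) := fun n =>
    ((h.measurable n).comp measurable_fst).prodMk ((measurable_pi_apply n).comp measurable_snd)
  refine IsMixedIID.of_measure_eq hM' hY' fun D n A hD hA => ?_
  have mB : MeasurableSet (⋂ i ∈ Finset.range n, (fun ω : Ω × (ℕ → T) => (Y i ω.1, ω.2 i)) ⁻¹' A i) :=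
    Finset.measurableSet_biInter _ fun i _ => hY' i (hA i)
  have mq : ∀ i, Measurable fun x : E × S => q x.1 (Prod.mk x.2 ⁻¹' A i) := fun i =>
    Kernel.measurable_kernel_prodMk_left (κ := q.comap Prod.fst measurable_fst)
      (t := {x : (E × S) × T | (x.1.2, x.2) ∈ A i})
      ((by fun_prop : Measurable fun x : (E × S) × T => (x.1.2, x.2)) (hA i))
  have mD : Measurable fun e : E => D.indicator (1 : E → ℝ≥0∞) e := measurable_one.indicator hD
  have mind : ∀ i, Measurable ((A i).indicator (1 : S × T → ℝ≥0∞)) := fun i =>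
    measurable_one.indicator (hA i)
  calc (P ⊗ₘ iidKernel (q.comap M hM)) ((fun ω => M ω.1) ⁻¹' D ∩
        ⋂ i ∈ Finset.range n, (fun ω : Ω × (ℕ → T) => (Y i ω.1, ω.2 i)) ⁻¹' A i)
      = ∫⁻ ω, D.indicator 1 (M ω.1) * ∏ i ∈ Finset.range n, (A i).indicator 1 (Y i ω.1, ω.2 i)
          ∂(P ⊗ₘ iidKernel (q.comap M hM)) := by
        rw [← lintegral_indicator_one ((hM' hD).inter mB)]
        refine lintegral_congr fun ω => ?_
        rw [prod_range_indicator_one (fun i (ω : Ω × (ℕ → T)) => (Y i ω.1, ω.2 i)),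
          ← indicator_one_mul_indicator]
        rfl
    _ = ∫⁻ ω, D.indicator 1 (M ω) * ∏ i ∈ Finset.range n, q (M ω) (Prod.mk (Y i ω) ⁻¹' A i) ∂P := by
        have mtot : Measurable fun ω : Ω × (ℕ → T) => D.indicator (1 : E → ℝ≥0∞) (M ω.1) *
            ∏ i ∈ Finset.range n, (A i).indicator (1 : S × T → ℝ≥0∞) (Y i ω.1, ω.2 i) :=
          (mD.comp hM').mul (Finset.measurable_fun_prod _ fun i _ => (mind i).comp (hY' i))
        rw [Measure.lintegral_compProd mtot]
        refine lintegral_congr fun ω => ?_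
        have m1 : ∀ i, Measurable fun t => (A i).indicator (1 : S × T → ℝ≥0∞) (Y i ω, t) :=
          fun i => (mind i).comp measurable_prodMk_left
        simp only
        rw [lintegral_const_mul _ (measurable_prod_apply n m1), iidKernel_apply, lintegral_infinitePi_prod _ n m1]
        congr 1
        refine Finset.prod_congr rfl fun i _ => ?_
        rw [Kernel.comap_apply, ← lintegral_indicator_one (measurable_prodMk_left (hA i))]
        rfl
    _ = ∫⁻ ω, D.indicator 1 (M ω) * ∏ i ∈ Finset.range n, (K ×ₖ q) (M ω) (A i) ∂P := by
        refine (h.lintegral (F := fun x => D.indicator 1 x.1 *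
          ∏ i ∈ Finset.range n, q x.1 (Prod.mk (x.2 i) ⁻¹' A i)) ((mD.comp measurable_fst).mul
          (Finset.measurable_fun_prod _ fun i _ => (mq i).comp
          (by fun_prop : Measurable fun x : E × (ℕ → S) => (x.1, x.2 i))))).trans ?_
        refine lintegral_congr fun ω => ?_
        have m1 : ∀ i, Measurable fun y => q (M ω) (Prod.mk y ⁻¹' A i) := fun i =>
          (mq i).comp (measurable_prodMk_left (x := M ω))
        simp only
        rw [lintegral_const_mul _ (measurable_prod_apply n m1), lintegral_infinitePi_prod _ n m1]
        congr 1
        refine Finset.prod_congr rfl fun i _ => ?_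
        rw [Kernel.prod_apply, Measure.prod_apply (hA i)]
    _ = ∫⁻ ω, D.indicator 1 (M ω.1) * ∏ i ∈ Finset.range n, (K ×ₖ q) (M ω.1) (A i)
          ∂(P ⊗ₘ iidKernel (q.comap M hM)) := by
        have m1 : ∀ i, Measurable fun ω : Ω × (ℕ → T) => (K ×ₖ q) (M ω.1) (A i) := fun i =>
          ((K ×ₖ q).measurable_coe (hA i)).comp hM'
        have mtot : Measurable fun ω : Ω × (ℕ → T) => D.indicator (1 : E → ℝ≥0∞) (M ω.1) *
            ∏ i ∈ Finset.range n, (K ×ₖ q) (M ω.1) (A i) :=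
          (mD.comp hM').mul (Finset.measurable_fun_prod _ fun i _ => m1 i)
        rw [Measure.lintegral_compProd mtot]
        simp
    _ = _ := by
        rw [← lintegral_indicator (hM' hD)]
        refine lintegral_congr fun ω => ?_
        by_cases hω : M ω.1 ∈ D <;> simp [hω]

end Extension

section Hierarchical

variable {𝕏 : Type*} [MeasurableSpace 𝕏] [StandardBorelSpace 𝕏] [Nonempty 𝕏]
  {θ : ℝ} {ν : Measure 𝕏} [IsProbabilityMeasure ν] {R : Kernel 𝕏 𝕏} {μ : Measure 𝕏}

lemma bernoulliOf_apply {A : Set 𝕏} (hA : MeasurableSet A) (b : Set Bool) :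
    bernoulliOf ν A b = ν A * b.indicator 1 true + ν Aᶜ * b.indicator 1 false := by
  classical
  have h1 : ENNReal.ofNNReal (unitInterval.toNNReal
      ⟨ν.real A, measureReal_nonneg, measureReal_le_one⟩) = ν A := by
    rw [unitInterval.toNNReal, ← ofReal_measureReal (μ := ν) (s := A)]
    exact (ENNReal.ofReal_eq_coe_nnreal measureReal_nonneg).symm
  have h2 : ENNReal.ofNNReal (unitInterval.toNNReal (unitInterval.symm
      ⟨ν.real A, measureReal_nonneg, measureReal_le_one⟩)) = ν Aᶜ := by
    rw [unitInterval.toNNReal, ← ofReal_measureReal (μ := ν) (s := Aᶜ), probReal_compl_eq_one_sub hA]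
    exact (ENNReal.ofReal_eq_coe_nnreal (sub_nonneg.2 measureReal_le_one)).symm
  rw [bernoulliOf, bernoulliMeasure, Measure.add_apply, Measure.smul_apply, Measure.smul_apply,
    Measure.dirac_apply, Measure.dirac_apply, ENNReal.smul_def, ENNReal.smul_def, h1, h2,
    smul_eq_mul, smul_eq_mul]

/-- The random probability measure on the parameter space associated with a directing measure: the
law of the parameter off the null set. -/
def paramKernel (R : Kernel 𝕏 𝕏) : Kernel (Measure 𝕏) (ClassSpace R) :=
  (probKernel (ClassSpace R)).comap
    (fun m => (ProbabilityTheory.cond m (nullPart R)ᶜ).map (toClass R))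
    ((Measure.measurable_map _ measurable_toClass).comp
      (cond_measurable (measurableSet_nullPart R).compl))

instance : IsMarkovKernel (paramKernel R) := by
  unfold paramKernel
  infer_instance

lemma IsTypical.paramKernel_apply [IsProbabilityMeasure μ] (hμ : IsTypical ν R μ)
    (hc : ν (nullPart R)ᶜ ≠ 0) :
    paramKernel R μ = (ProbabilityTheory.cond μ (nullPart R)ᶜ).map (toClass R) := by
  have : IsProbabilityMeasure (ProbabilityTheory.cond μ (nullPart R)ᶜ) :=
    cond_isProbabilityMeasure (by rwa [hμ.apply_compl])
  have := Measure.isProbabilityMeasure_map (μ := ProbabilityTheory.cond μ (nullPart R)ᶜ)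
    (measurable_toClass (R := R)).aemeasurable
  exact probKernel_apply _

/-- The latent pair of an observation `x`: its parameter and a success off the null set, and an
auxiliary parameter and a failure on it. -/
def latentMap (R : Kernel 𝕏 𝕏) (z : 𝕏 × ClassSpace R) : ClassSpace R × Bool := by
  classical
  exact if z.1 ∈ (nullPart R)ᶜ then (toClass R z.1, true) else (z.2, false)

lemma latentMap_of_notMem {x : 𝕏} (hx : x ∈ (nullPart R)ᶜ) (t : ClassSpace R) :
    latentMap R (x, t) = (toClass R x, true) := if_pos hx

lemma latentMap_of_mem {x : 𝕏} (hx : x ∈ nullPart R) (t : ClassSpace R) :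
    latentMap R (x, t) = (t, false) := if_neg (not_not_intro hx)

lemma measurable_latentMap : Measurable (latentMap R) := by
  classical
  exact Measurable.ite ((measurableSet_nullPart R).compl.preimage measurable_fst)
    ((measurable_toClass.comp measurable_fst).prodMk measurable_const)
    (measurable_snd.prodMk measurable_const)

/-- Integrals of functions of an observation and its latent pair. -/
lemma lintegral_latentMap [IsProbabilityMeasure μ] (q : Measure (ClassSpace R))
    [IsProbabilityMeasure q] {f : (ClassSpace R × Bool) × 𝕏 → ℝ≥0∞} (hf : Measurable f) :
    ∫⁻ z, f (latentMap R z, z.1) ∂(μ.prod q) =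
      ∫⁻ x in nullPart R, ∫⁻ t, f ((t, false), x) ∂q ∂μ +
        ∫⁻ x in (nullPart R)ᶜ, f ((toClass R x, true), x) ∂μ := by
  have hZ := measurableSet_nullPart R
  have hm : Measurable fun z => f (latentMap R z, z.1) :=
    hf.comp (measurable_latentMap.prodMk measurable_fst)
  rw [lintegral_prod _ hm.aemeasurable, ← lintegral_add_compl _ hZ]
  congr 1
  · exact setLIntegral_congr_fun hZ fun x hx => by simp only [latentMap_of_mem hx]
  · exact setLIntegral_congr_fun hZ.compl fun x hx => by
      simp only [latentMap_of_notMem hx, lintegral_const, measure_univ, mul_one]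

/-- Under a typical directing measure, the coin is independent of the parameter. -/
lemma IsTypical.map_latentMap [IsProbabilityMeasure μ] (hμ : IsTypical ν R μ)
    (hc : ν (nullPart R)ᶜ ≠ 0) :
    (μ.prod (paramKernel R μ)).map (latentMap R) =
      (paramKernel R μ).prod (bernoulliOf ν (nullPart R)ᶜ) := by
  have hZ := measurableSet_nullPart R
  have : IsProbabilityMeasure (bernoulliOf ν (nullPart R)ᶜ) := by
    unfold bernoulliOf
    infer_instance
  refine (Measure.prod_eq fun s b hs hb => ?_).symm
  have hsb := hs.prod hb
  have hπs : MeasurableSet (toClass R ⁻¹' s) := measurable_toClass hs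
  have hq : paramKernel R μ s = (ν (nullPart R)ᶜ)⁻¹ * μ ((nullPart R)ᶜ ∩ toClass R ⁻¹' s) := by
    rw [hμ.paramKernel_apply hc, Measure.map_apply measurable_toClass hs, cond_apply hZ.compl,
      hμ.apply_compl]
  have hq' : μ ((nullPart R)ᶜ ∩ toClass R ⁻¹' s) = ν (nullPart R)ᶜ * paramKernel R μ s := by
    rw [hq, ← mul_assoc, ENNReal.mul_inv_cancel hc (measure_ne_top ν _), one_mul]
  have h1 := lintegral_latentMap (μ := μ) (paramKernel R μ)
    (f := fun r => (s ×ˢ b).indicator 1 r.1) ((measurable_one.indicator hsb).comp measurable_fst)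
  rw [Measure.map_apply measurable_latentMap hsb,
    ← lintegral_indicator_one (measurable_latentMap hsb)]
  refine h1.trans ?_
  have e1 : ∫⁻ t, (s ×ˢ b).indicator (1 : ClassSpace R × Bool → ℝ≥0∞) (t, false) ∂(paramKernel R μ) =
      paramKernel R μ s * b.indicator 1 false := by
    rw [← lintegral_indicator_one hs, ← lintegral_mul_const _ (measurable_one.indicator hs)]
    refine lintegral_congr fun t => ?_
    by_cases ht : t ∈ s <;> by_cases hb : false ∈ b <;> simp [ht, hb]
  have e2 : ∫⁻ x in (nullPart R)ᶜ, (s ×ˢ b).indicator (1 : ClassSpace R × Bool → ℝ≥0∞) (toClass R x, true) ∂μ =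
      μ ((nullPart R)ᶜ ∩ toClass R ⁻¹' s) * b.indicator 1 true := by
    rw [Set.inter_comm, ← Measure.restrict_apply hπs, ← lintegral_indicator_one hπs,
      ← lintegral_mul_const _ (measurable_one.indicator hπs)]
    refine lintegral_congr fun x => ?_
    by_cases ht : toClass R x ∈ s <;> by_cases hb : true ∈ b <;> simp [ht, hb]
  simp only [e1, e2]
  rw [setLIntegral_const, hμ.apply_nullPart, hq', bernoulliOf_apply hZ.compl, compl_compl]
  ring

/-- The conditional law of an observation given its latent pair. -/
def obsLaw (ν : Measure 𝕏) [IsProbabilityMeasure ν] (R : Kernel 𝕏 𝕏) (r : ClassSpace R × Bool) :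
    Measure 𝕏 :=
  if r.2 = true then condDistrib id (toClass R) ν r.1 else ProbabilityTheory.cond ν (nullPart R)

lemma measurable_obsLaw : Measurable (obsLaw ν R) :=
  Measurable.ite (measurable_snd (measurableSet_singleton true))
    ((condDistrib id (toClass R) ν).measurable.comp measurable_fst) measurable_const

lemma obsLaw_univ (h0 : ν (nullPart R) ≠ 0) (r : ClassSpace R × Bool) :
    obsLaw ν R r Set.univ = 1 := by
  have := cond_isProbabilityMeasure h0
  unfold obsLaw
  split_ifs <;> exact measure_univ

/-- Under a typical directing measure, `obsLaw` is the conditional law of an observation given its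
latent pair. -/
lemma IsTypical.lintegral_obsLaw [IsProbabilityMeasure μ] (hμ : IsTypical ν R μ)
    (hdis : ∀ᵐ x ∂μ, x ∈ (nullPart R)ᶜ →
      condDistrib id (toClass R) ν (toClass R x) = offNull R x)
    {C : Set (ClassSpace R × Bool)} (hC : MeasurableSet C) {A : Set 𝕏} (hA : MeasurableSet A) :
    ∫⁻ z, C.indicator 1 (latentMap R z) * A.indicator 1 z.1 ∂(μ.prod (paramKernel R μ)) =
      ∫⁻ z, C.indicator 1 (latentMap R z) * obsLaw ν R (latentMap R z) A
        ∂(μ.prod (paramKernel R μ)) := by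
  have hZ := measurableSet_nullPart R
  have mC : Measurable (C.indicator (1 : ClassSpace R × Bool → ℝ≥0∞)) := measurable_one.indicator hC
  have mA : Measurable (A.indicator (1 : 𝕏 → ℝ≥0∞)) := measurable_one.indicator hA
  have ml : Measurable fun r => obsLaw ν R r A := (Measure.measurable_coe hA).comp measurable_obsLaw
  have h1 := lintegral_latentMap (μ := μ) (paramKernel R μ)
    (f := fun r => C.indicator 1 r.1 * A.indicator 1 r.2)
    ((mC.comp measurable_fst).mul (mA.comp measurable_snd))
  have h2 := lintegral_latentMap (μ := μ) (paramKernel R μ)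
    (f := fun r => C.indicator 1 r.1 * obsLaw ν R r.1 A)
    ((mC.comp measurable_fst).mul (ml.comp measurable_fst))
  refine h1.trans (Eq.trans ?_ h2.symm)
  have mCf : Measurable fun t : ClassSpace R => C.indicator (1 : ClassSpace R × Bool → ℝ≥0∞) (t, false) :=
    mC.comp measurable_prodMk_right
  congr 1
  · have e1 : ∀ x, ∫⁻ t, C.indicator (1 : ClassSpace R × Bool → ℝ≥0∞) (t, false) * A.indicator 1 x ∂(paramKernel R μ) =
        (∫⁻ t, C.indicator (1 : ClassSpace R × Bool → ℝ≥0∞) (t, false) ∂(paramKernel R μ)) * A.indicator 1 x :=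
      fun x => lintegral_mul_const _ mCf
    have e2 : ∫⁻ t, C.indicator (1 : ClassSpace R × Bool → ℝ≥0∞) (t, false) * obsLaw ν R (t, false) A
        ∂(paramKernel R μ) = (∫⁻ t, C.indicator (1 : ClassSpace R × Bool → ℝ≥0∞) (t, false) ∂(paramKernel R μ)) *
          ProbabilityTheory.cond ν (nullPart R) A := by
      rw [← lintegral_mul_const _ mCf]
      simp [obsLaw]
    simp only [e1, e2]
    rw [lintegral_const_mul _ mA, setLIntegral_const, hμ.apply_nullPart, mul_assoc,
      cond_mul_eq_inter hZ, lintegral_indicator_one hA, hμ.restrict_nullPart,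
      Measure.restrict_apply hA, Set.inter_comm]
  · refine (hμ.lintegral_compl (b := fun t => C.indicator 1 (t, true))
      (mC.comp measurable_prodMk_right) hA).trans ?_
    refine setLIntegral_congr_fun_ae hZ.compl ?_
    filter_upwards [hdis] with x hx hxZ
    simp [obsLaw, hx hxZ]

lemma prod_range_ite_one {N N' : ℕ} (h : N ≤ N') (f : ℕ → ℝ≥0∞) :
    ∏ i ∈ Finset.range N', (if i < N then f i else 1) = ∏ i ∈ Finset.range N, f i := by
  rw [← Finset.prod_subset (Finset.range_mono h) fun i _ hi => if_neg (by simpa using hi)]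
  exact Finset.prod_congr rfl fun i hi => if_pos (Finset.mem_range.1 hi)

variable {Ω : Type*} [MeasurableSpace Ω] {P : Measure Ω} [IsProbabilityMeasure P]
  {X : ℕ → Ω → 𝕏} {Pt : Kernel Ω 𝕏} [IsMarkovKernel Pt]

/-- The extension of the probability space by a sequence which is conditionally i.i.d. with the law
of the parameter, used to fill in the parameters of the observations in the null set. -/
def hierMeasure (P : Measure Ω) (R : Kernel 𝕏 𝕏) (Pt : Kernel Ω 𝕏) :
    Measure (Ω × (ℕ → ClassSpace R)) :=
  P ⊗ₘ iidKernel ((paramKernel R).comap (fun ω => Pt ω) Pt.measurable)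

instance : IsProbabilityMeasure (hierMeasure P R Pt) := by
  unfold hierMeasure
  infer_instance

lemma measurePreserving_fst_hierMeasure :
    MeasurePreserving Prod.fst (hierMeasure P R Pt) P :=
  ⟨measurable_fst, Measure.fst_compProd _ _⟩

/-- The random probability measure on the parameter space, on the extension. -/
def hierKernel (R : Kernel 𝕏 𝕏) (Pt : Kernel Ω 𝕏) :
    Kernel (Ω × (ℕ → ClassSpace R)) (ClassSpace R) :=
  (paramKernel R).comap (fun ω => Pt ω.1) (Pt.measurable.comp measurable_fst)

instance : IsMarkovKernel (hierKernel R Pt) := by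
  unfold hierKernel
  infer_instance

lemma hierKernel_apply (ω : Ω × (ℕ → ClassSpace R)) :
    hierKernel R Pt ω = paramKernel R (Pt ω.1) := rfl

lemma IsDirecting.isMixedIID_extend (hPt : IsDirecting P X Pt) (hX : ∀ n, Measurable (X n)) :
    IsMixedIID (hierMeasure P R Pt) (fun ω => Pt ω.1) (probKernel 𝕏 ×ₖ paramKernel R)
      (fun n ω => (X n ω.1, ω.2 n)) :=
  (hPt.isMixedIID hX).extend (paramKernel R)

/-- The random measure on the parameter space is the image of `Pt(· | Zᶜ)` under the parameter, so it
inherits a stick-breaking law, which collapses to a Dirichlet process. -/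
lemma map_hierKernel (h : IsMVPS P X θ ν R) (hR : IsCanonical R) (hPt : IsDirecting P X Pt)
    (hc : ν (nullPart R)ᶜ ≠ 0) :
    (hierMeasure P R Pt).map (fun ω => hierKernel R Pt ω) =
      dirichletProcess θ (ProbabilityTheory.cond (ν.map (toClass R))
        (toClass R '' (nullPart R)ᶜ)) := by
  have hν := isTypical_self h hR hPt hc
  have hZ := (measurableSet_nullPart R).compl
  have hcond : Measurable fun ω => ProbabilityTheory.cond (Pt ω) (nullPart R)ᶜ :=
    (cond_measurable hZ).comp Pt.measurable
  rw [cond_map_toClass, ← map_stickBreakingLaw_offNull h.theta_pos hν hc,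
    ← h.map_cond_directing hR hPt hc,
    Measure.map_map (Measure.measurable_map _ measurable_toClass) hcond]
  have h1 : (fun ω => hierKernel R Pt ω) = (fun ω => paramKernel R (Pt ω)) ∘
      (Prod.fst : Ω × (ℕ → ClassSpace R) → Ω) := rfl
  have mp : Measurable fun ω => paramKernel R (Pt ω) :=
    (paramKernel R).measurable.comp Pt.measurable
  rw [h1, ← Measure.map_map mp measurable_fst,
    measurePreserving_fst_hierMeasure.map_eq]
  refine Measure.map_congr ?_
  filter_upwards [h.ae_isTypical hR hPt hc] with ω hω using hω.paramKernel_apply hc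

lemma condIndep_latent (h : IsMVPS P X θ ν R) (hR : IsCanonical R) (hPt : IsDirecting P X Pt)
    (hc : ν (nullPart R)ᶜ ≠ 0) :
    CondIndepWithLaws (hierMeasure P R Pt)
      (MeasurableSpace.comap (fun ω => hierKernel R Pt ω) inferInstance)
      (fun n ω => latentMap R (X n ω.1, ω.2 n))
      (fun _ ω => (hierKernel R Pt ω).prod (bernoulliOf ν (nullPart R)ᶜ)) := by
  have : IsProbabilityMeasure (bernoulliOf ν (nullPart R)ᶜ) := by
    unfold bernoulliOf
    infer_instance
  have hmix := hPt.isMixedIID_extend (R := R) h.measurable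
  have hY : ∀ n, Measurable fun ω : Ω × (ℕ → ClassSpace R) => latentMap R (X n ω.1, ω.2 n) :=
    fun n => measurable_latentMap.comp (hmix.measurable n)
  have hQ := (hierKernel R Pt).measurable
  refine (condIndepWithLaws_iff_isMixedIID (K := probKernel (ClassSpace R) ×ₖ
    Kernel.const _ (bernoulliOf ν (nullPart R)ᶜ)) hQ hY (Eventually.of_forall fun ω => ?_)).2 ?_
  · rw [Kernel.prod_apply, probKernel_apply, Kernel.const_apply]
  refine IsMixedIID.of_measure_eq hQ hY fun D n A hD hA => ?_
  have mB : MeasurableSet (⋂ i ∈ Finset.range n,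
      (fun ω : Ω × (ℕ → ClassSpace R) => latentMap R (X i ω.1, ω.2 i)) ⁻¹' A i) :=
    Finset.measurableSet_biInter _ fun i _ => hY i (hA i)
  have mD : MeasurableSet {m : Measure 𝕏 | paramKernel R m ∈ D} := (paramKernel R).measurable hD
  have h1 := hmix.lintegral_mul_prod (measurable_one.indicator mD) n
    (f := fun i z => (A i).indicator 1 (latentMap R z))
    fun i => (measurable_one.indicator (hA i)).comp measurable_latentMap
  rw [← lintegral_indicator_one ((hQ hD).inter mB), ← lintegral_indicator (hQ hD)]
  refine Eq.trans (lintegral_congr fun ω => ?_) (h1.trans (lintegral_congr_ae ?_))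
  · rw [prod_range_indicator_one
      (fun i (ω : Ω × (ℕ → ClassSpace R)) => latentMap R (X i ω.1, ω.2 i)),
      ← indicator_one_mul_indicator]
    rfl
  · filter_upwards [measurePreserving_fst_hierMeasure.quasiMeasurePreserving.ae
      (h.ae_isTypical hR hPt hc)] with ω hω
    have e1 : ∀ i, ∫⁻ z, (A i).indicator 1 (latentMap R z)
        ∂((probKernel 𝕏 ×ₖ paramKernel R) (Pt ω.1)) =
        (probKernel (ClassSpace R) ×ₖ Kernel.const _ (bernoulliOf ν (nullPart R)ᶜ))
          (hierKernel R Pt ω) (A i) := by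
      intro i
      rw [Kernel.prod_apply, Kernel.prod_apply, probKernel_apply, probKernel_apply,
        Kernel.const_apply, hierKernel_apply, ← hω.map_latentMap hc,
        Measure.map_apply measurable_latentMap (hA i),
        ← lintegral_indicator_one (measurable_latentMap (hA i))]
      rfl
    simp only [e1]
    by_cases hD' : hierKernel R Pt ω ∈ D
    · rw [Set.indicator_of_mem (show ω ∈ (fun ω => hierKernel R Pt ω) ⁻¹' D from hD'),
        Set.indicator_of_mem (show Pt ω.1 ∈ {m : Measure 𝕏 | paramKernel R m ∈ D} from hD'),
        Pi.one_apply, one_mul]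
    · rw [Set.indicator_of_notMem (show ω ∉ (fun ω => hierKernel R Pt ω) ⁻¹' D from hD'),
        Set.indicator_of_notMem (show Pt ω.1 ∉ {m : Measure 𝕏 | paramKernel R m ∈ D} from hD'),
        zero_mul]

lemma condIndep_obs (h : IsMVPS P X θ ν R) (hR : IsCanonical R) (hPt : IsDirecting P X Pt)
    (hc : ν (nullPart R)ᶜ ≠ 0) (h0 : ν (nullPart R) ≠ 0) :
    CondIndepWithLaws (hierMeasure P R Pt)
      (MeasurableSpace.comap (fun ω => (hierKernel R Pt ω,
        fun n => latentMap R (X n ω.1, ω.2 n))) inferInstance)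
      (fun n ω => X n ω.1) (fun n ω => obsLaw ν R (latentMap R (X n ω.1, ω.2 n))) := by
  have hmix := hPt.isMixedIID_extend (R := R) h.measurable
  have hν := isTypical_self h hR hPt hc
  set G : Ω × (ℕ → ClassSpace R) → Measure (ClassSpace R) × (ℕ → ClassSpace R × Bool) :=
    fun ω => (hierKernel R Pt ω, fun n => latentMap R (X n ω.1, ω.2 n)) with hG
  have hY : ∀ n, Measurable fun ω : Ω × (ℕ → ClassSpace R) => latentMap R (X n ω.1, ω.2 n) :=
    fun n => measurable_latentMap.comp (hmix.measurable n)
  have hX : ∀ n, Measurable fun ω : Ω × (ℕ → ClassSpace R) => X n ω.1 := fun n =>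
    (h.measurable n).comp measurable_fst
  have mG : Measurable G := (hierKernel R Pt).measurable.prodMk (measurable_pi_lambda _ hY)
  have hl : ∀ {A : Set 𝕏}, MeasurableSet A → Measurable fun r => obsLaw ν R r A := fun hA =>
    (Measure.measurable_coe hA).comp measurable_obsLaw
  refine (condIndepWithLaws_iff mG.comap_le hX
    (fun i => Eventually.of_forall fun ω => (obsLaw_univ h0 _).le) fun i A hA => ?_).2 ?_
  · have mi : Measurable fun y : Measure (ClassSpace R) × (ℕ → ClassSpace R × Bool) =>
        obsLaw ν R (y.2 i) A := (hl hA).comp (by fun_prop)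
    exact mi.comp (comap_measurable G)
  rintro n A hA _ ⟨D', hD', rfl⟩
  set B := ⋂ i ∈ Finset.range n, (fun ω : Ω × (ℕ → ClassSpace R) => X i ω.1) ⁻¹' A i with hB
  have mB : MeasurableSet B := Finset.measurableSet_biInter _ fun i _ => hX i (hA i)
  set L : Ω × (ℕ → ClassSpace R) → ℝ≥0∞ := fun ω =>
    ∏ i ∈ Finset.range n, obsLaw ν R (latentMap R (X i ω.1, ω.2 i)) (A i) with hL
  have mL : Measurable L := Finset.measurable_fun_prod _ fun i _ => (hl (hA i)).comp (hY i)
  have key : ((hierMeasure P R Pt).restrict B).map G =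
      ((hierMeasure P R Pt).withDensity L).map G := by
    refine ext_prod_pi fun D N C hD hC => ?_
    have mcyl : MeasurableSet {y : ℕ → ClassSpace R × Bool | ∀ i ∈ Finset.range N, y i ∈ C i} := by
      have : {y : ℕ → ClassSpace R × Bool | ∀ i ∈ Finset.range N, y i ∈ C i} =
          ⋂ i ∈ Finset.range N, (fun y => y i) ⁻¹' C i := by ext y; simp
      rw [this]
      exact Finset.measurableSet_biInter _ fun i _ => measurable_pi_apply i (hC i)
    have mD : MeasurableSet {m : Measure 𝕏 | paramKernel R m ∈ D} := (paramKernel R).measurable hD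
    have mpre := mG (hD.prod mcyl)
    set N' := max N n
    -- the factors beyond the first `N` cylinder sets and the first `n` observations are trivial
    let c : ℕ → ClassSpace R × Bool → ℝ≥0∞ := fun i r => if i < N then (C i).indicator 1 r else 1
    have mc : ∀ i, Measurable (c i) := fun i => by
      by_cases hi : i < N
      · simpa [c, hi] using measurable_one.indicator (hC i)
      · simp [c, hi]
    have h1 := hmix.lintegral_mul_prod (measurable_one.indicator mD) N'
      (f := fun i z => c i (latentMap R z) * if i < n then (A i).indicator 1 z.1 else 1)
      fun i => ((mc i).comp measurable_latentMap).mul (by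
        split_ifs
        · exact (measurable_one.indicator (hA i)).comp measurable_fst
        · exact measurable_const)
    have h2 := hmix.lintegral_mul_prod (measurable_one.indicator mD) N'
      (f := fun i z => c i (latentMap R z) * if i < n then obsLaw ν R (latentMap R z) (A i) else 1)
      fun i => ((mc i).comp measurable_latentMap).mul (by
        split_ifs
        · exact (hl (hA i)).comp measurable_latentMap
        · exact measurable_const)
    have hind : ∀ ω : Ω × (ℕ → ClassSpace R), {m : Measure 𝕏 | paramKernel R m ∈ D}.indicator
        (1 : Measure 𝕏 → ℝ≥0∞) (Pt ω.1) * ∏ i ∈ Finset.range N', c i (latentMap R (X i ω.1, ω.2 i)) =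
        (G ⁻¹' (D ×ˢ {y | ∀ i ∈ Finset.range N, y i ∈ C i})).indicator 1 ω := by
      intro ω
      rw [prod_range_ite_one (le_max_left N n) (fun i => (C i).indicator 1
        (latentMap R (X i ω.1, ω.2 i))), prod_range_indicator_one
        (fun i (ω : Ω × (ℕ → ClassSpace R)) => latentMap R (X i ω.1, ω.2 i))]
      have : G ⁻¹' (D ×ˢ {y | ∀ i ∈ Finset.range N, y i ∈ C i}) =
          ((fun ω : Ω × (ℕ → ClassSpace R) => Pt ω.1) ⁻¹' {m : Measure 𝕏 | paramKernel R m ∈ D}) ∩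
          ⋂ i ∈ Finset.range N,
            (fun ω : Ω × (ℕ → ClassSpace R) => latentMap R (X i ω.1, ω.2 i)) ⁻¹' C i := by
        ext ω
        simp [hG, hierKernel_apply]
      rw [this, ← indicator_one_mul_indicator]
      rfl
    rw [Measure.map_apply mG (hD.prod mcyl), Measure.map_apply mG (hD.prod mcyl),
      Measure.restrict_apply mpre, withDensity_apply _ mpre, ← lintegral_indicator mpre,
      ← lintegral_indicator_one (mpre.inter mB)]
    refine Eq.trans (lintegral_congr fun ω => ?_) ((h1.trans (lintegral_congr_ae ?_)).trans
      (h2.symm.trans (lintegral_congr fun ω => ?_)))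
    · rw [Finset.prod_mul_distrib, ← mul_assoc, hind, prod_range_ite_one (le_max_right N n)
        (fun i => (A i).indicator 1 (X i ω.1)), prod_range_indicator_one
        (fun i (ω : Ω × (ℕ → ClassSpace R)) => X i ω.1), indicator_one_mul_indicator]
    · filter_upwards [measurePreserving_fst_hierMeasure.quasiMeasurePreserving.ae
        ((h.ae_isTypical hR hPt hc).and (hPt.ae_of_ae h (ae_condDistrib_toClass hν)))] with ω hω
      congr 1
      refine Finset.prod_congr rfl fun i _ => ?_
      rw [Kernel.prod_apply, probKernel_apply]
      by_cases hi : i < n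
      · simp only [if_pos hi]
        by_cases hiN : i < N
        · simpa [c, hiN] using hω.1.lintegral_obsLaw hω.2 (hC i) (hA i)
        · simpa [c, hiN] using hω.1.lintegral_obsLaw hω.2 MeasurableSet.univ (hA i)
      · simp only [if_neg hi]
    · rw [Finset.prod_mul_distrib, ← mul_assoc, hind, prod_range_ite_one (le_max_right N n)
        (fun i => obsLaw ν R (latentMap R (X i ω.1, ω.2 i)) (A i))]
      by_cases hω : ω ∈ G ⁻¹' (D ×ˢ {y | ∀ i ∈ Finset.range N, y i ∈ C i})
      · rw [Set.indicator_of_mem hω, Set.indicator_of_mem hω, Pi.one_apply, one_mul]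
      · rw [Set.indicator_of_notMem hω, Set.indicator_of_notMem hω, zero_mul]
  have hfin := congrArg (fun m => m D') key
  simp only [Measure.map_apply mG hD'] at hfin
  rwa [Measure.restrict_apply (mG hD'), withDensity_apply _ (mG hD')] at hfin

/-- The hierarchical model on the extended probability space. -/
theorem isHierarchical_toClass (h : IsMVPS P X θ ν R) (hR : IsCanonical R)
    (hPt : IsDirecting P X Pt) (hc : ν (nullPart R)ᶜ ≠ 0) (h0 : ν (nullPart R) ≠ 0) :
    IsHierarchical (hierMeasure P R Pt) (fun n ω => X n ω.1)
      (fun n ω => (latentMap R (X n ω.1, ω.2 n)).1) (fun n ω => (latentMap R (X n ω.1, ω.2 n)).2)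
      (hierKernel R Pt) θ ν (nullPart R) (toClass R) := by
  have hmix := hPt.isMixedIID_extend (R := R) h.measurable
  have hY : ∀ n, Measurable fun ω : Ω × (ℕ → ClassSpace R) => latentMap R (X n ω.1, ω.2 n) :=
    fun n => measurable_latentMap.comp (hmix.measurable n)
  exact
  { measurable_obs := fun n => (h.measurable n).comp measurable_fst
    measurable_param := fun n => measurable_fst.comp (hY n)
    measurable_coin := fun n => measurable_snd.comp (hY n)
    isMarkov := inferInstance
    law_Q := map_hierKernel h hR hPt hc
    latent := condIndep_latent h hR hPt hc
    obs := condIndep_obs h hR hPt hc h0 }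

end Hierarchical

end MVPS

end

theorem mainTheorem3 {Ω : Type u} [MeasurableSpace Ω] (P : Measure Ω) [IsProbabilityMeasure P]
    {𝕏 : Type v} [MeasurableSpace 𝕏] [StandardBorelSpace 𝕏] [Nonempty 𝕏]
    (X : ℕ → Ω → 𝕏) (θ : ℝ) (ν : Measure 𝕏) [IsProbabilityMeasure ν] (R : Kernel 𝕏 𝕏)
    (hX : MVPS.IsMVPS P X θ ν R) (hR : MVPS.IsCanonical R) (hexch : MVPS.Exchangeable P X)
    (hZ0 : 0 < ν (MVPS.nullPart R)) (hZ1 : ν (MVPS.nullPart R) < 1)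
    (Pt : Kernel Ω 𝕏) [IsMarkovKernel Pt] (hPt : MVPS.IsDirecting P X Pt) :
    -- convergence of the predictive distributions in total variation
    (∀ᵐ ω ∂P, Tendsto (fun n => MVPS.tvDist (MVPS.predDist P X n ω) (Pt ω)) atTop (𝓝 0)) ∧
    -- form of the directing random measure
    (∀ᵐ ω ∂P, Pt ω =
      ν (MVPS.nullPart R)ᶜ • cond (Pt ω) (MVPS.nullPart R)ᶜ +
        ν (MVPS.nullPart R) • cond ν (MVPS.nullPart R)) ∧
    -- law of its restriction to the complement of the null set
    P.map (fun ω => cond (Pt ω) (MVPS.nullPart R)ᶜ) =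
      MVPS.stickBreakingLaw θ (cond ν (MVPS.nullPart R)ᶜ)
        (fun x => cond (R x) (MVPS.nullPart R)ᶜ) ∧
    -- hierarchical representation, on an extension of the probability space
    ∃ (T : Type v) (_ : MeasurableSpace T) (π : 𝕏 → T),
      MVPS.IsParameter ν π ∧
      MeasurableSet (π '' (MVPS.nullPart R)ᶜ) ∧
      π ⁻¹' (π '' (MVPS.nullPart R)ᶜ) = (MVPS.nullPart R)ᶜ ∧
      ∃ (Ω' : Type (max u v)) (_ : MeasurableSpace Ω') (P' : Measure Ω') (φ : Ω' → Ω)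
        (p : ℕ → Ω' → T) (ξ : ℕ → Ω' → Bool) (Q : Kernel Ω' T),
        MeasurePreserving φ P' P ∧
        MVPS.IsHierarchical P' (fun n ω => X n (φ ω)) p ξ Q θ ν (MVPS.nullPart R) π := by
  have hc : ν (MVPS.nullPart R)ᶜ ≠ 0 := by
    rw [prob_compl_eq_one_sub (MVPS.measurableSet_nullPart R)]
    exact (tsub_pos_of_lt hZ1).ne'
  refine ⟨hX.ae_tendsto_tvDist hR hPt hc, hX.ae_directing_eq_add hR hPt hc hZ0.ne',
    hX.map_cond_directing hR hPt hc, MVPS.ClassSpace R, inferInstance, MVPS.toClass R,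
    MVPS.isParameter_toClass hR, MVPS.measurableSet_image_toClass_compl,
    MVPS.preimage_image_toClass_compl, Ω × (ℕ → MVPS.ClassSpace R), inferInstance,
    MVPS.hierMeasure P R Pt, Prod.fst, _, _, MVPS.hierKernel R Pt,
    MVPS.measurePreserving_fst_hierMeasure,
    MVPS.isHierarchical_toClass hX hR hPt hc hZ0.ne'⟩
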